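/- Let $n\ge 1$, let $q=e^{\hbar}$ with $\hbar\in\mathbb{C}$ be not a root of unity, and put $q^z=e^{\hbar z}$, $p=q^{1/2}$, $[z]_q=\frac{q^z-q^{-z}}{q-q^{-1}}$, $[x,y]_a=xy-a\,yx$. Let $\mathfrak g=\mathfrak{so}(2n+1)$, with $\mathfrak h^*=\mathbb{C}^n$, orthonormal basis $\varepsilon_1,\dots,\varepsilon_n$ and simple roots $\alpha_1=\varepsilon_1$, $\alpha_i=\varepsilon_i-\varepsilon_{i-1}$ ($i\ge 2$). Let $U_q(\mathfrak g)$ be the quantum group with generators $e_i,f_i,q^{\pm h_i}$ ($1\le i\le n$), pairwise commuting $q^{\pm h_i}$ with $q^{h_i}q^{-h_i}=q^{-h_i}q^{h_i}=1$, and relations $q^{h_i}e_j=q^{(\alpha_i,\alpha_j)}e_jq^{h_i}$, $q^{h_i}f_j=q^{-(\alpha_i,\alpha_j)}f_jq^{h_i}$, $[e_i,f_j]=\delta_{ij}\frac{q^{h_i}-q^{-h_i}}{q-q^{-1}}$, $[e_i,[e_i,e_j]_q]_{q^{-1}}=0$ for $i\ge2$, $|i-j|=1$, $[e_i,e_j]=0$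 for $|i-j|\ge 2$, $[e_1,\hat e_\delta]=0$ (if $n\ge2$), and the same three relations with $f$ in place of $e$, where $\hat e_\delta=[e_1,[e_1,e_2]_q]_{q^{-1}}$, $\hat f_\delta=[f_1,[f_1,f_2]_q]_{q^{-1}}$. The comultiplication is $\Delta(e_i)=e_i\otimes q^{h_i}+1\otimes e_i$, $\Delta(f_i)=f_i\otimes1+q^{-h_i}\otimes f_i$, $\Delta(q^{\pm h_i})=q^{\pm h_i}\otimes q^{\pm h_i}$. For $\mu\in\mathfrak h^*$ let $\hat M_\mu$ be the Verma module of highest weight $\mu$ with canonical generator $1_\mu$, and for a module $W$ put $W[\mu]=\{w: q^{h_i}w=q^{(\mu,\alpha_i)}w\ \forall i\}$; a vector is singular if all $e_i$ annihilate it. Let $\mathfrak k=\mathfrak{so}(2n)$, with the set of simple roots $\Pi_{\mathfrak k}=\{\delta,\alpha_2,\dots,\alpha_n\}$, $\delta=\varepsilon_1+\varepsilon_2$, if $n\ge2$, and $\Pi_{\mathfrak k}=\varnothing$ if $n=1$. Below, everything that involves $\delta$ is omitted if $n=1$. Let $\lambda\in\mathfrak h^*$ satisfy $q^{2(\lambda,\varepsilon_i)}=-q^{-1}$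 for all $i$ and $(\alpha_i,\lambda)=0$ for $i\ge2$. The base module $M$ is the quotient of $\hat M_\lambda$ by the submodule generated by $f_i1_\lambda$, $i\ge2$, and $\hat f_\delta1_\lambda$; its generator is also denoted by $1_\lambda$. Let $V$ be a finite-dimensional $U_q(\mathfrak g)$-module, let $V^+_M\subset V$ be the joint kernel of $e_2,\dots,e_n$ and $\hat e_\delta$, and let $\xi\in\mathfrak h^*$ be integral with respect to $\mathfrak k$, that is, $(\xi,\alpha^\vee)\in\mathbb Z$ for all $\alpha\in\Pi_{\mathfrak k}$, where $\alpha^\vee=2\alpha/(\alpha,\alpha)$. Let $v\in V^+_M[\xi]=V^+_M\cap V[\xi]$ be non-zero. Then: 1. $m_\alpha=(\xi,\alpha^\vee)+1$ is a positive integer for every $\alpha\in\Pi_{\mathfrak k}$, so that $\xi$ is the highest weight of an irreducible finite-dimensional $\mathfrak k$-module $X$. 2. There is a unique singular vector $\delta_l(v)\in V\otimes M$ of the form $v\otimes 1_\lambda+\dots$, where the omitted terms lie in the tensor product of $V$ with the sum of the weight spaces of $M$ of weights other than that of $1_\lambda$. 3. There is a homomorphism of $U_q(\mathfrak g)$-modules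 $\hat M_{\xi+\lambda}\to V\otimes M$ with $1_{\xi+\lambda}\mapsto\delta_l(v)$, and it factors through the projection $\hat M_{\xi+\lambda}\to M_{X,\lambda}$ and a homomorphism $M_{X,\lambda}\to V\otimes M$. Here the pseudo-parabolic Verma module $M_{X,\lambda}$ is the quotient of $\hat M_{\xi+\lambda}$ by the submodule generated by the vectors $f_i^{m_{\alpha_i}}1_{\xi+\lambda}$, $i\ge2$, and $\hat f_\delta(x)\hat f_\delta(x+2)\cdots\hat f_\delta(x+2m_\delta-2)1_{\xi+\lambda}$ with $x=2(\lambda+\xi,\alpha_1)-2m_\delta+1$ and $$\hat f_\delta(s)=p^{-2}\Bigl(f_1^2f_2\tfrac{[s]_p}{[s+2]_p}-f_1f_2f_1[2]_p\tfrac{[s]_p}{[s+1]_p}+f_2f_1^2\Bigr),\qquad [z]_p=\tfrac{p^z-p^{-z}}{p-p^{-1}}.$$ -/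

import Mathlib

open scoped TensorProduct

noncomputable section

namespace QSphere

/-! ### Powers of `q`, quantum integers and the root system of type `B` -/

/-- `q ^ z`, where `q = exp ħ`. -/
def qpow (ħ z : ℂ) : ℂ := Complex.exp (ħ * z)

/-- The quantum number `[z]_q = (q ^ z - q ^ (-z)) / (q - q ^ (-1))` with `q = exp ħ`. -/
def qnum (ħ z : ℂ) : ℂ := (qpow ħ z - qpow ħ (-z)) / (qpow ħ 1 - qpow ħ (-1))

/-- `[x, y]_a = x y - a y x`. -/
def qcomm {A : Type*} [Ring A] [Algebra ℂ A] (a : ℂ) (x y : A) : A := x * y - a • (y * x)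

/-- Elements of `𝔥*` are written in the orthonormal basis `ε₁, …, εₙ` (indexed by `Fin n`,
so `ε₁` has index `0`); the inner product is `dotProduct`. -/
abbrev Weight (n : ℕ) : Type := Fin n → ℂ

/-- The short root `ε i`. -/
def eps {n : ℕ} (i : Fin n) : Weight n := Pi.single i 1

/-- The simple roots: `ε₁` for the first index and `εᵢ - εᵢ₋₁` for the others. -/
def simpleRoot {n : ℕ} (i : Fin n) : Weight n :=
  if i.val = 0 then eps i else eps i - eps ⟨i.val - 1, by omega⟩

/-- The pairing `(ξ, α^∨) = 2 (ξ, α) / (α, α)`. -/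
def corootPairing {n : ℕ} (ξ α : Weight n) : ℂ := 2 * (ξ ⬝ᵥ α) / (α ⬝ᵥ α)

/-- The simple roots of `𝔨 = so(2n)`: `α₂, …, αₙ` and, if `n ≥ 2`, `δ = ε₁ + ε₂`. -/
def kSimpleRoots (n : ℕ) : Set (Weight n) :=
  {α | (∃ i : Fin n, 0 < i.val ∧ α = simpleRoot i) ∨
    ∃ i j : Fin n, i.val = 0 ∧ j.val = 1 ∧ α = eps i + eps j}

/-- The indices `i`, `j` are neighbours in the Dynkin diagram. -/
def Adjacent {n : ℕ} (i j : Fin n) : Prop := i.val + 1 = j.val ∨ j.val + 1 = i.val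

theorem simpleRoot_self {n : ℕ} (i : Fin n) (hi : i.val ≠ 0) :
    simpleRoot i ⬝ᵥ simpleRoot i = 2 := by
  have h : i ≠ ⟨i.val - 1, by omega⟩ := by
    intro h
    have := congrArg Fin.val h
    simp at this
    omega
  simp [simpleRoot, hi, eps, h, h.symm]
  norm_num

theorem simpleRoot_zero {n : ℕ} (i : Fin n) (hi : i.val = 0) :
    simpleRoot i ⬝ᵥ simpleRoot i = 1 := by
  simp [simpleRoot, hi, eps]

theorem simpleRoot_adj {n : ℕ} (i j : Fin n) (h : Adjacent i j) :
    simpleRoot i ⬝ᵥ simpleRoot j = -1 := by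
  rcases h with h | h <;>
  by_cases hi : i.val = 0 <;> by_cases hj : j.val = 0 <;> try omega
  all_goals simp [simpleRoot, hi, hj, eps, Pi.single_apply, Fin.ext_iff]
  all_goals grind

theorem simpleRoot_far {n : ℕ} (i j : Fin n) (hij : i ≠ j) (h : ¬ Adjacent i j) :
    simpleRoot i ⬝ᵥ simpleRoot j = 0 := by
  have hij' : i.val ≠ j.val := fun h => hij (Fin.ext h)
  simp only [Adjacent, not_or] at h
  by_cases hi : i.val = 0 <;> by_cases hj : j.val = 0 <;>
  simp [simpleRoot, hi, hj, eps, Pi.single_apply, Fin.ext_iff] <;> grind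

/-! ### The quantum group -/

/-- Generators `e_α`, `f_α`, `q ^ h_α`, `q ^ (-h_α)`, for the simple roots `α`. -/
inductive Gen (n : ℕ) : Type
  | e (i : Fin n)
  | f (i : Fin n)
  | k (i : Fin n)
  | kinv (i : Fin n)

/-- A generator as an element of the free algebra. -/
abbrev gen {n : ℕ} (g : Gen n) : FreeAlgebra ℂ (Gen n) := FreeAlgebra.ι ℂ g

/-- The defining relations of `U_q(so(2n+1))`, `q = exp ħ`. -/
inductive Rel (n : ℕ) (ħ : ℂ) : FreeAlgebra ℂ (Gen n) → FreeAlgebra ℂ (Gen n) → Prop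
  | k_kinv (i : Fin n) : Rel n ħ (gen (.k i) * gen (.kinv i)) 1
  | kinv_k (i : Fin n) : Rel n ħ (gen (.kinv i) * gen (.k i)) 1
  | k_k (i j : Fin n) : Rel n ħ (gen (.k i) * gen (.k j)) (gen (.k j) * gen (.k i))
  | k_e (i j : Fin n) : Rel n ħ (gen (.k i) * gen (.e j))
      (qpow ħ (simpleRoot i ⬝ᵥ simpleRoot j) • (gen (.e j) * gen (.k i)))
  | k_f (i j : Fin n) : Rel n ħ (gen (.k i) * gen (.f j))
      (qpow ħ (-(simpleRoot i ⬝ᵥ simpleRoot j)) • (gen (.f j) * gen (.k i)))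
  | e_f_same (i : Fin n) : Rel n ħ (gen (.e i) * gen (.f i) - gen (.f i) * gen (.e i))
      ((qpow ħ 1 - qpow ħ (-1))⁻¹ • (gen (.k i) - gen (.kinv i)))
  | e_f_ne (i j : Fin n) (hij : i ≠ j) :
      Rel n ħ (gen (.e i) * gen (.f j) - gen (.f j) * gen (.e i)) 0
  | serre_e (i j : Fin n) (hi : i.val ≠ 0) (hij : Adjacent i j) :
      Rel n ħ (qcomm (qpow ħ (-1)) (gen (.e i)) (qcomm (qpow ħ 1) (gen (.e i)) (gen (.e j)))) 0
  | serre_f (i j : Fin n) (hi : i.val ≠ 0) (hij : Adjacent i j) :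
      Rel n ħ (qcomm (qpow ħ (-1)) (gen (.f i)) (qcomm (qpow ħ 1) (gen (.f i)) (gen (.f j)))) 0
  | serre_e_far (i j : Fin n) (hij : i ≠ j) (h : ¬ Adjacent i j) :
      Rel n ħ (qcomm 1 (gen (.e i)) (gen (.e j))) 0
  | serre_f_far (i j : Fin n) (hij : i ≠ j) (h : ¬ Adjacent i j) :
      Rel n ħ (qcomm 1 (gen (.f i)) (gen (.f j))) 0
  | serre_e_short (i j : Fin n) (hi : i.val = 0) (hj : j.val = 1) :
      Rel n ħ (qcomm 1 (gen (.e i)) (qcomm (qpow ħ (-1)) (gen (.e i))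
        (qcomm (qpow ħ 1) (gen (.e i)) (gen (.e j))))) 0
  | serre_f_short (i j : Fin n) (hi : i.val = 0) (hj : j.val = 1) :
      Rel n ħ (qcomm 1 (gen (.f i)) (qcomm (qpow ħ (-1)) (gen (.f i))
        (qcomm (qpow ħ 1) (gen (.f i)) (gen (.f j))))) 0

/-- The quantum group `U_q(so(2n+1))` with `q = exp ħ`. -/
def Uq (n : ℕ) (ħ : ℂ) : Type := RingQuot (Rel n ħ)

instance (n : ℕ) (ħ : ℂ) : Ring (Uq n ħ) := inferInstanceAs (Ring (RingQuot (Rel n ħ)))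

instance (n : ℕ) (ħ : ℂ) : Algebra ℂ (Uq n ħ) :=
  inferInstanceAs (Algebra ℂ (RingQuot (Rel n ħ)))

namespace Uq

/-- The quotient map from the free algebra. -/
def mk (n : ℕ) (ħ : ℂ) : FreeAlgebra ℂ (Gen n) →ₐ[ℂ] Uq n ħ := RingQuot.mkAlgHom ℂ (Rel n ħ)

variable {n : ℕ} (ħ : ℂ)

/-- `e_{α_i}` -/
def E (i : Fin n) : Uq n ħ := mk n ħ (gen (.e i))

/-- `f_{α_i}` -/
def F (i : Fin n) : Uq n ħ := mk n ħ (gen (.f i))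

/-- `q ^ h_{α_i}` -/
def K (i : Fin n) : Uq n ħ := mk n ħ (gen (.k i))

/-- `q ^ (-h_{α_i})` -/
def Kinv (i : Fin n) : Uq n ħ := mk n ħ (gen (.kinv i))

variable {ħ}

theorem mk_rel {x y : FreeAlgebra ℂ (Gen n)} (h : Rel n ħ x y) : mk n ħ x = mk n ħ y :=
  RingQuot.mkAlgHom_rel ℂ h

theorem map_qcomm {A B : Type*} [Ring A] [Algebra ℂ A] [Ring B] [Algebra ℂ B] (φ : A →ₐ[ℂ] B)
    (a : ℂ) (x y : A) : φ (qcomm a x y) = qcomm a (φ x) (φ y) := by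
  simp [qcomm]

theorem K_mul_Kinv (i : Fin n) : K ħ i * Kinv ħ i = 1 := by
  simpa [K, Kinv] using mk_rel (Rel.k_kinv (ħ := ħ) i)

theorem Kinv_mul_K (i : Fin n) : Kinv ħ i * K ħ i = 1 := by
  simpa [K, Kinv] using mk_rel (Rel.kinv_k (ħ := ħ) i)

theorem K_mul_K (i j : Fin n) : K ħ i * K ħ j = K ħ j * K ħ i := by
  simpa [K] using mk_rel (Rel.k_k (ħ := ħ) i j)

theorem K_mul_E (i j : Fin n) :
    K ħ i * E ħ j = qpow ħ (simpleRoot i ⬝ᵥ simpleRoot j) • (E ħ j * K ħ i) := by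
  simpa [K, E] using mk_rel (Rel.k_e (ħ := ħ) i j)

theorem K_mul_F (i j : Fin n) :
    K ħ i * F ħ j = qpow ħ (-(simpleRoot i ⬝ᵥ simpleRoot j)) • (F ħ j * K ħ i) := by
  simpa [K, F] using mk_rel (Rel.k_f (ħ := ħ) i j)

theorem E_F_same (i : Fin n) : E ħ i * F ħ i - F ħ i * E ħ i =
    (qpow ħ 1 - qpow ħ (-1))⁻¹ • (K ħ i - Kinv ħ i) := by
  simpa [K, E, F, Kinv] using mk_rel (Rel.e_f_same (ħ := ħ) i)

theorem E_F_ne (i j : Fin n) (hij : i ≠ j) : E ħ i * F ħ j - F ħ j * E ħ i = 0 := by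
  simpa [E, F] using mk_rel (Rel.e_f_ne (ħ := ħ) i j hij)

theorem serre_E (i j : Fin n) (hi : i.val ≠ 0) (hij : Adjacent i j) :
    qcomm (qpow ħ (-1)) (E ħ i) (qcomm (qpow ħ 1) (E ħ i) (E ħ j)) = 0 := by
  simpa [E, map_qcomm] using mk_rel (Rel.serre_e (ħ := ħ) i j hi hij)

theorem serre_F (i j : Fin n) (hi : i.val ≠ 0) (hij : Adjacent i j) :
    qcomm (qpow ħ (-1)) (F ħ i) (qcomm (qpow ħ 1) (F ħ i) (F ħ j)) = 0 := by
  simpa [F, map_qcomm] using mk_rel (Rel.serre_f (ħ := ħ) i j hi hij)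

theorem serre_E_far (i j : Fin n) (hij : i ≠ j) (h : ¬ Adjacent i j) :
    qcomm 1 (E ħ i) (E ħ j) = 0 := by
  simpa [E, map_qcomm] using mk_rel (Rel.serre_e_far (ħ := ħ) i j hij h)

theorem serre_F_far (i j : Fin n) (hij : i ≠ j) (h : ¬ Adjacent i j) :
    qcomm 1 (F ħ i) (F ħ j) = 0 := by
  simpa [F, map_qcomm] using mk_rel (Rel.serre_f_far (ħ := ħ) i j hij h)

theorem serre_E_short (i j : Fin n) (hi : i.val = 0) (hj : j.val = 1) :
    qcomm 1 (E ħ i) (qcomm (qpow ħ (-1)) (E ħ i) (qcomm (qpow ħ 1) (E ħ i) (E ħ j))) = 0 := by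
  simpa [E, map_qcomm] using mk_rel (Rel.serre_e_short (ħ := ħ) i j hi hj)

theorem serre_F_short (i j : Fin n) (hi : i.val = 0) (hj : j.val = 1) :
    qcomm 1 (F ħ i) (qcomm (qpow ħ (-1)) (F ħ i) (qcomm (qpow ħ 1) (F ħ i) (F ħ j))) = 0 := by
  simpa [F, map_qcomm] using mk_rel (Rel.serre_f_short (ħ := ħ) i j hi hj)

end Uq

/-! ### The comultiplication -/

section Coproduct

variable {R : Type*} [Ring R] [Algebra ℂ R]

theorem qpow_add (ħ x y : ℂ) : qpow ħ (x + y) = qpow ħ x * qpow ħ y := by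
  simp [qpow, mul_add, Complex.exp_add]

theorem qpow_zero (ħ : ℂ) : qpow ħ 0 = 1 := by simp [qpow]

theorem qpow_neg_mul (ħ x : ℂ) : qpow ħ (-x) * qpow ħ x = 1 := by
  rw [← qpow_add, neg_add_cancel, qpow_zero]

theorem qpow_ne_zero (ħ x : ℂ) : qpow ħ x ≠ 0 := Complex.exp_ne_zero _

theorem qpow_neg (ħ x : ℂ) : qpow ħ (-x) = (qpow ħ x)⁻¹ :=
  eq_inv_of_mul_eq_one_left (qpow_neg_mul ħ x)

theorem qpow_two (ħ : ℂ) : qpow ħ 2 = qpow ħ 1 ^ 2 := by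
  rw [sq, ← qpow_add]; norm_num

theorem mul_left_swap {a b : R} {c : ℂ} (h : b * a = c • (a * b)) (z : R) :
    b * (a * z) = c • (a * (b * z)) := by
  rw [← mul_assoc, h, smul_mul_assoc, mul_assoc]

theorem serre_split_far {a b a' b' : R}
    (h2 : b * a' = (1 : ℂ) • (a' * b)) (h3 : b' * a = (1 : ℂ) • (a * b')) :
    qcomm 1 (a + b) (a' + b') = qcomm 1 a a' + qcomm 1 b b' := by
  simp only [one_smul] at h2 h3
  simp only [qcomm, mul_add, add_mul, one_smul, h2, h3]
  abel

theorem serre_split_long {a b a' b' : R} {q : ℂ} (hq : q ≠ 0)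
    (h1 : b * a = q ^ 2 • (a * b)) (h2 : b * a' = q⁻¹ • (a' * b)) (h3 : b' * a = q⁻¹ • (a * b')) :
    qcomm q⁻¹ (a + b) (qcomm q (a + b) (a' + b')) =
      qcomm q⁻¹ a (qcomm q a a') + qcomm q⁻¹ b (qcomm q b b') := by
  simp only [qcomm, mul_add, add_mul, mul_sub, sub_mul, mul_assoc, h1, h2, h3, mul_left_swap h1,
    mul_left_swap h2, mul_left_swap h3, smul_mul_assoc, mul_smul_comm, smul_smul, smul_add,
    smul_sub]
  match_scalars <;> field_simp <;> ring

theorem serre_split_short {a b a' b' : R} {q : ℂ} (hq : q ≠ 0)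
    (h1 : b * a = q • (a * b)) (h2 : b * a' = q⁻¹ • (a' * b)) (h3 : b' * a = q⁻¹ • (a * b')) :
    qcomm 1 (a + b) (qcomm q⁻¹ (a + b) (qcomm q (a + b) (a' + b'))) =
      qcomm 1 a (qcomm q⁻¹ a (qcomm q a a')) + qcomm 1 b (qcomm q⁻¹ b (qcomm q b b')) := by
  simp only [qcomm, mul_add, add_mul, mul_sub, sub_mul, mul_assoc, h1, h2, h3, mul_left_swap h1,
    mul_left_swap h2, mul_left_swap h3, smul_mul_assoc, mul_smul_comm, smul_smul, smul_add,
    smul_sub, one_smul]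
  match_scalars <;> field_simp <;> ring

theorem qcomm_tmul {A B : Type*} [Ring A] [Algebra ℂ A] [Ring B] [Algebra ℂ B] (c : ℂ)
    (x y : A) (u w : B) (h : w * u = u * w) :
    qcomm c (x ⊗ₜ[ℂ] u) (y ⊗ₜ[ℂ] w) = qcomm c x y ⊗ₜ[ℂ] (u * w) := by
  simp [qcomm, TensorProduct.sub_tmul, TensorProduct.smul_tmul', h]

theorem qcomm_tmul' {A B : Type*} [Ring A] [Algebra ℂ A] [Ring B] [Algebra ℂ B] (c : ℂ)
    (x y : A) (u w : B) (h : y * x = x * y) :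
    qcomm c (x ⊗ₜ[ℂ] u) (y ⊗ₜ[ℂ] w) = (x * y) ⊗ₜ[ℂ] qcomm c u w := by
  simp [qcomm, TensorProduct.tmul_sub, TensorProduct.tmul_smul, h]

end Coproduct

namespace Uq

variable {n : ℕ} {ħ : ℂ}

theorem Kinv_mul_F (i j : Fin n) :
    Kinv ħ i * F ħ j = qpow ħ (simpleRoot i ⬝ᵥ simpleRoot j) • (F ħ j * Kinv ħ i) := by
  have h := K_mul_F (ħ := ħ) i j
  have h2 : F ħ j = qpow ħ (-(simpleRoot i ⬝ᵥ simpleRoot j)) • (Kinv ħ i * (F ħ j * K ħ i)) := by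
    rw [← mul_smul_comm, ← h, ← mul_assoc, Kinv_mul_K, one_mul]
  have h3 : F ħ j * Kinv ħ i =
      qpow ħ (-(simpleRoot i ⬝ᵥ simpleRoot j)) • (Kinv ħ i * F ħ j) := by
    conv_lhs => rw [h2]
    rw [smul_mul_assoc, mul_assoc, mul_assoc, K_mul_Kinv, mul_one]
  rw [h3, smul_smul, mul_comm, qpow_neg_mul, one_smul]

theorem Kinv_mul_Kinv (i j : Fin n) : Kinv ħ i * Kinv ħ j = Kinv ħ j * Kinv ħ i := by
  have h : IsUnit (K ħ i * K ħ j) := by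
    refine IsUnit.mul ?_ ?_
    · exact ⟨⟨_, _, K_mul_Kinv i, Kinv_mul_K i⟩, rfl⟩
    · exact ⟨⟨_, _, K_mul_Kinv j, Kinv_mul_K j⟩, rfl⟩
  apply h.mul_left_cancel
  rw [K_mul_K]
  trans (1 : Uq n ħ)
  · rw [mul_assoc, ← mul_assoc (K ħ i), K_mul_Kinv, one_mul, K_mul_Kinv]
  · rw [K_mul_K, mul_assoc, ← mul_assoc (K ħ j), K_mul_Kinv, one_mul, K_mul_Kinv]

/-- The comultiplication on generators:
`Δ e = e ⊗ q^h + 1 ⊗ e`, `Δ f = f ⊗ 1 + q^(-h) ⊗ f`, `Δ q^(±h) = q^(±h) ⊗ q^(±h)`. -/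
def comulGen (n : ℕ) (ħ : ℂ) : Gen n → Uq n ħ ⊗[ℂ] Uq n ħ
  | .e i => E ħ i ⊗ₜ K ħ i + 1 ⊗ₜ E ħ i
  | .f i => F ħ i ⊗ₜ 1 + Kinv ħ i ⊗ₜ F ħ i
  | .k i => K ħ i ⊗ₜ K ħ i
  | .kinv i => Kinv ħ i ⊗ₜ Kinv ħ i

theorem comul_E_swap (i j : Fin n) :
    (E ħ i ⊗ₜ[ℂ] K ħ i) * ((1 : Uq n ħ) ⊗ₜ[ℂ] E ħ j) =
      qpow ħ (simpleRoot i ⬝ᵥ simpleRoot j) •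
        (((1 : Uq n ħ) ⊗ₜ[ℂ] E ħ j) * (E ħ i ⊗ₜ[ℂ] K ħ i)) := by
  simp [K_mul_E, TensorProduct.tmul_smul]

theorem comul_F_swap (i j : Fin n) :
    (Kinv ħ i ⊗ₜ[ℂ] F ħ i) * (F ħ j ⊗ₜ[ℂ] (1 : Uq n ħ)) =
      qpow ħ (simpleRoot i ⬝ᵥ simpleRoot j) •
        ((F ħ j ⊗ₜ[ℂ] (1 : Uq n ħ)) * (Kinv ħ i ⊗ₜ[ℂ] F ħ i)) := by
  simp [Kinv_mul_F, TensorProduct.smul_tmul']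

theorem adjacent_comm {i j : Fin n} (h : Adjacent i j) : Adjacent j i := Or.symm h

/-- The cross terms in `[Δ e_i, Δ f_j]` cancel. -/
theorem comul_E_F (i j : Fin n) :
    (E ħ i ⊗ₜ[ℂ] K ħ i + 1 ⊗ₜ E ħ i) * (F ħ j ⊗ₜ 1 + Kinv ħ j ⊗ₜ F ħ j) -
      (F ħ j ⊗ₜ[ℂ] 1 + Kinv ħ j ⊗ₜ F ħ j) * (E ħ i ⊗ₜ K ħ i + 1 ⊗ₜ E ħ i) =
    (E ħ i * F ħ j - F ħ j * E ħ i) ⊗ₜ K ħ i + Kinv ħ j ⊗ₜ (E ħ i * F ħ j - F ħ j * E ħ i) := by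
  have h1 : E ħ i * Kinv ħ j =
      qpow ħ (simpleRoot i ⬝ᵥ simpleRoot j) • (Kinv ħ j * E ħ i) := by
    have h : Kinv ħ j * (K ħ j * E ħ i) * Kinv ħ j = E ħ i * Kinv ħ j := by
      rw [← mul_assoc, Kinv_mul_K, one_mul]
    rw [← h, K_mul_E, dotProduct_comm, mul_smul_comm, smul_mul_assoc, mul_assoc, mul_assoc,
      K_mul_Kinv, mul_one]
  have h2 : (E ħ i * Kinv ħ j) ⊗ₜ[ℂ] (K ħ i * F ħ j) =
      (Kinv ħ j * E ħ i) ⊗ₜ[ℂ] (F ħ j * K ħ i) := by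
    rw [h1, K_mul_F, TensorProduct.tmul_smul, ← TensorProduct.smul_tmul', smul_smul,
      qpow_neg_mul, one_smul]
  simp only [mul_add, add_mul, Algebra.TensorProduct.tmul_mul_tmul, one_mul, mul_one, h2,
    TensorProduct.sub_tmul, TensorProduct.tmul_sub]
  abel

theorem comul_rel {x y : FreeAlgebra ℂ (Gen n)} (h : Rel n ħ x y) :
    FreeAlgebra.lift ℂ (comulGen n ħ) x = FreeAlgebra.lift ℂ (comulGen n ħ) y := by
  have kk : ∀ i j : Fin n, K ħ i * K ħ j = K ħ j * K ħ i := K_mul_K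
  have k'k' : ∀ i j : Fin n, Kinv ħ i * Kinv ħ j = Kinv ħ j * Kinv ħ i := Kinv_mul_Kinv
  cases h with
  | k_kinv i => simp [comulGen, K_mul_Kinv, Algebra.TensorProduct.one_def]
  | kinv_k i => simp [comulGen, Kinv_mul_K, Algebra.TensorProduct.one_def]
  | k_k i j => simp [comulGen, kk i j]
  | k_e i j =>
    simp [comulGen, mul_add, add_mul, K_mul_E, kk i j, TensorProduct.tmul_smul,
      TensorProduct.smul_tmul']
  | k_f i j =>
    have h : K ħ i * Kinv ħ j = Kinv ħ j * K ħ i := by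
      have : K ħ i * Kinv ħ j = Kinv ħ j * (K ħ j * K ħ i) * Kinv ħ j := by
        rw [← mul_assoc, Kinv_mul_K, one_mul]
      rw [this, ← kk, mul_assoc, mul_assoc, K_mul_Kinv, mul_one]
    simp [comulGen, mul_add, add_mul, K_mul_F, h, TensorProduct.tmul_smul,
      TensorProduct.smul_tmul']
  | e_f_same i =>
    simp only [map_sub, map_mul, map_smul, FreeAlgebra.lift_ι_apply, comulGen, comul_E_F,
      E_F_same, TensorProduct.sub_tmul, TensorProduct.tmul_sub, TensorProduct.tmul_smul,
      ← TensorProduct.smul_tmul']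
    module
  | e_f_ne i j hij =>
    simp only [map_sub, map_mul, map_zero, FreeAlgebra.lift_ι_apply, comulGen, comul_E_F,
      E_F_ne i j hij, TensorProduct.zero_tmul, TensorProduct.tmul_zero, add_zero]
  | serre_e i j hi hij =>
    simp only [map_qcomm, FreeAlgebra.lift_ι_apply, map_zero, comulGen]
    rw [add_comm (E ħ i ⊗ₜ[ℂ] K ħ i), add_comm (E ħ j ⊗ₜ[ℂ] K ħ j), qpow_neg,
      serre_split_long (qpow_ne_zero ħ 1), ← qpow_neg]
    · rw [qcomm_tmul' _ _ _ _ _ rfl, mul_one, qcomm_tmul' _ _ _ _ _ rfl, qcomm_tmul _ _ _ _ _ (kk j i),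
        qcomm_tmul _ _ _ _ _ (by rw [mul_assoc, kk j i]), serre_E i j hi hij]
      simp
    · rw [comul_E_swap, simpleRoot_self i hi, qpow_two]
    · rw [comul_E_swap, simpleRoot_adj i j hij, qpow_neg]
    · rw [comul_E_swap, simpleRoot_adj j i (adjacent_comm hij), qpow_neg]
  | serre_f i j hi hij =>
    simp only [map_qcomm, FreeAlgebra.lift_ι_apply, map_zero, comulGen]
    rw [qpow_neg, serre_split_long (qpow_ne_zero ħ 1), ← qpow_neg]
    · rw [qcomm_tmul _ _ _ _ _ rfl, mul_one, qcomm_tmul _ _ _ _ _ rfl, qcomm_tmul' _ _ _ _ _ (k'k' j i),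
        qcomm_tmul' _ _ _ _ _ (by rw [mul_assoc, k'k' j i]), serre_F i j hi hij]
      simp
    · rw [comul_F_swap, simpleRoot_self i hi, qpow_two]
    · rw [comul_F_swap, simpleRoot_adj i j hij, qpow_neg]
    · rw [comul_F_swap, simpleRoot_adj j i (adjacent_comm hij), qpow_neg]
  | serre_e_far i j hij h =>
    simp only [map_qcomm, FreeAlgebra.lift_ι_apply, map_zero, comulGen]
    rw [add_comm (E ħ i ⊗ₜ[ℂ] K ħ i), add_comm (E ħ j ⊗ₜ[ℂ] K ħ j), serre_split_far]
    · rw [qcomm_tmul' _ _ _ _ _ rfl, qcomm_tmul _ _ _ _ _ (kk j i), serre_E_far i j hij h]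
      simp
    · rw [comul_E_swap, simpleRoot_far i j hij h, qpow_zero]
    · rw [comul_E_swap, simpleRoot_far j i hij.symm (fun h' => h (adjacent_comm h')), qpow_zero]
  | serre_f_far i j hij h =>
    simp only [map_qcomm, FreeAlgebra.lift_ι_apply, map_zero, comulGen]
    rw [serre_split_far]
    · rw [qcomm_tmul _ _ _ _ _ rfl, qcomm_tmul' _ _ _ _ _ (k'k' j i), serre_F_far i j hij h]
      simp
    · rw [comul_F_swap, simpleRoot_far i j hij h, qpow_zero]
    · rw [comul_F_swap, simpleRoot_far j i hij.symm (fun h' => h (adjacent_comm h')), qpow_zero]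
  | serre_e_short i j hi hj =>
    have hij : Adjacent i j := Or.inl (by omega)
    simp only [map_qcomm, FreeAlgebra.lift_ι_apply, map_zero, comulGen]
    rw [add_comm (E ħ i ⊗ₜ[ℂ] K ħ i), add_comm (E ħ j ⊗ₜ[ℂ] K ħ j), qpow_neg,
      serre_split_short (qpow_ne_zero ħ 1), ← qpow_neg]
    · rw [qcomm_tmul' _ _ _ _ _ rfl, mul_one, qcomm_tmul' _ _ _ _ _ rfl, mul_one,
        qcomm_tmul' _ _ _ _ _ rfl,
        qcomm_tmul _ _ _ _ _ (kk j i), qcomm_tmul _ _ _ _ _ (by rw [mul_assoc, kk j i]),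
        qcomm_tmul _ _ _ _ _ (by rw [mul_assoc, mul_assoc, kk j i]), serre_E_short i j hi hj]
      simp
    · rw [comul_E_swap, simpleRoot_zero i hi]
    · rw [comul_E_swap, simpleRoot_adj i j hij, qpow_neg]
    · rw [comul_E_swap, simpleRoot_adj j i (adjacent_comm hij), qpow_neg]
  | serre_f_short i j hi hj =>
    have hij : Adjacent i j := Or.inl (by omega)
    simp only [map_qcomm, FreeAlgebra.lift_ι_apply, map_zero, comulGen]
    rw [qpow_neg, serre_split_short (qpow_ne_zero ħ 1), ← qpow_neg]
    · rw [qcomm_tmul _ _ _ _ _ rfl, mul_one, qcomm_tmul _ _ _ _ _ rfl, mul_one,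
        qcomm_tmul _ _ _ _ _ rfl,
        qcomm_tmul' _ _ _ _ _ (k'k' j i), qcomm_tmul' _ _ _ _ _ (by rw [mul_assoc, k'k' j i]),
        qcomm_tmul' _ _ _ _ _ (by rw [mul_assoc, mul_assoc, k'k' j i]), serre_F_short i j hi hj]
      simp
    · rw [comul_F_swap, simpleRoot_zero i hi]
    · rw [comul_F_swap, simpleRoot_adj i j hij, qpow_neg]
    · rw [comul_F_swap, simpleRoot_adj j i (adjacent_comm hij), qpow_neg]

/-- The comultiplication of `U_q(so(2n+1))`. -/
def comul (n : ℕ) (ħ : ℂ) : Uq n ħ →ₐ[ℂ] Uq n ħ ⊗[ℂ] Uq n ħ :=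
  RingQuot.liftAlgHom ℂ ⟨FreeAlgebra.lift ℂ (comulGen n ħ), fun _ _ h => comul_rel h⟩

end Uq

/-! ### Modules -/

section Modules

variable {n : ℕ} (ħ : ℂ)

/-- The weight space `V[μ]`: the vectors on which each `q ^ h_α` acts by `q ^ (μ, α)`. -/
def weightSpace (V : Type*) [AddCommGroup V] [Module ℂ V] [Module (Uq n ħ) V]
    [IsScalarTower ℂ (Uq n ħ) V] (μ : Weight n) : Submodule ℂ V where
  carrier := {v | ∀ i, Uq.K ħ i • v = qpow ħ (μ ⬝ᵥ simpleRoot i) • v}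
  add_mem' hv hw i := by rw [smul_add, smul_add, hv i, hw i]
  zero_mem' i := by simp
  smul_mem' c v hv i := by rw [smul_comm, hv i, smul_comm]

/-- A vector is singular if it is annihilated by all `e_α`. -/
def IsSingular (n : ℕ) (ħ : ℂ) {W : Type*} [AddCommGroup W] [Module (Uq n ħ) W] (w : W) : Prop :=
  ∀ i : Fin n, Uq.E ħ i • w = 0

/-- The Verma module of highest weight `μ`: the quotient of `U_q(𝔤)` by the left ideal generated
by `e_α` and `q ^ h_α - q ^ (μ, α)`, for all simple roots `α`. -/
abbrev Verma (μ : Weight n) : Type :=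
  Uq n ħ ⧸ (Submodule.span (Uq n ħ)
    (Set.range (Uq.E ħ) ∪
      Set.range fun i => Uq.K ħ i - algebraMap ℂ (Uq n ħ) (qpow ħ (μ ⬝ᵥ simpleRoot i))) :
      Submodule (Uq n ħ) (Uq n ħ))

/-- The canonical generator of the Verma module. -/
def Verma.one (μ : Weight n) : Verma ħ μ := Submodule.Quotient.mk 1

/-- `[e_i, [e_i, e_j]_q]_{q⁻¹}`; it is `ê_δ` when `i`, `j` are the first two indices. -/
def eHat (i j : Fin n) : Uq n ħ :=
  qcomm (qpow ħ (-1)) (Uq.E ħ i) (qcomm (qpow ħ 1) (Uq.E ħ i) (Uq.E ħ j))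

/-- `[f_i, [f_i, f_j]_q]_{q⁻¹}`; it is `f̂_δ` when `i`, `j` are the first two indices. -/
def fHat (i j : Fin n) : Uq n ħ :=
  qcomm (qpow ħ (-1)) (Uq.F ħ i) (qcomm (qpow ħ 1) (Uq.F ħ i) (Uq.F ħ j))

/-- The condition on the highest weight `λ` of the base module:
`q ^ (2 (λ, ε_i)) = - q ^ (-1)` for all `i`, and `(α_i, λ) = 0` for all `i` but the first. -/
def IsBaseWeight (lam : Weight n) : Prop :=
  (∀ i : Fin n, qpow ħ (2 * (lam ⬝ᵥ eps i)) = -qpow ħ (-1)) ∧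
    ∀ i : Fin n, 0 < i.val → simpleRoot i ⬝ᵥ lam = 0

/-- The submodule of the Verma module generated by `f_{α_i} 1_λ`, for all `i` but the first,
and by `f̂_δ 1_λ`. -/
def baseSubmodule (lam : Weight n) : Submodule (Uq n ħ) (Verma ħ lam) :=
  Submodule.span (Uq n ħ)
    ({w | ∃ i : Fin n, 0 < i.val ∧ w = Uq.F ħ i • Verma.one ħ lam} ∪
      {w | ∃ i j : Fin n, i.val = 0 ∧ j.val = 1 ∧ w = fHat ħ i j • Verma.one ħ lam})

/-- The base module `M` of highest weight `λ`. -/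
abbrev BaseModule (lam : Weight n) : Type := Verma ħ lam ⧸ baseSubmodule ħ lam

/-- The highest vector `1_λ` of the base module. -/
def BaseModule.one (lam : Weight n) : BaseModule ħ lam :=
  Submodule.Quotient.mk (Verma.one ħ lam)

/-- `V⁺_M`: the joint kernel in `V` of `e_{α_i}`, for all `i` but the first, and of `ê_δ`. -/
def VPlus (n : ℕ) (ħ : ℂ) (V : Type*) [AddCommGroup V] [Module ℂ V] [Module (Uq n ħ) V]
    [IsScalarTower ℂ (Uq n ħ) V] : Submodule ℂ V where
  carrier := {v | (∀ i : Fin n, 0 < i.val → Uq.E ħ i • v = 0) ∧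
    ∀ i j : Fin n, i.val = 0 → j.val = 1 → eHat ħ i j • v = 0}
  add_mem' hv hw := ⟨fun i hi => by rw [smul_add, hv.1 i hi, hw.1 i hi, add_zero],
    fun i j hi hj => by rw [smul_add, hv.2 i j hi hj, hw.2 i j hi hj, add_zero]⟩
  zero_mem' := ⟨fun i _ => smul_zero _, fun i j _ _ => smul_zero _⟩
  smul_mem' c v hv := ⟨fun i hi => by rw [smul_comm, hv.1 i hi, smul_zero],
    fun i j hi hj => by rw [smul_comm, hv.2 i j hi hj, smul_zero]⟩

/-- With `p = q ^ (1/2)`, the dynamical root vector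
`f̂_δ(s) = p⁻² (f_i² f_j [s]_p / [s+2]_p - f_i f_j f_i [2]_p [s]_p / [s+1]_p + f_j f_i²)`,
where `i`, `j` are the first two indices. -/
def fHatDyn (i j : Fin n) (s : ℂ) : Uq n ħ :=
  qpow (ħ / 2) (-2) •
    ((qnum (ħ / 2) s / qnum (ħ / 2) (s + 2)) • (Uq.F ħ i ^ 2 * Uq.F ħ j) -
      (qnum (ħ / 2) 2 * (qnum (ħ / 2) s / qnum (ħ / 2) (s + 1))) •
        (Uq.F ħ i * Uq.F ħ j * Uq.F ħ i) +
      Uq.F ħ j * Uq.F ħ i ^ 2)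

/-- The product `f̂_δ(x) f̂_δ(x + 2) ⋯ f̂_δ(x + 2 m - 2)`, in this order. -/
def fHatDynProd (i j : Fin n) (x : ℂ) (m : ℕ) : Uq n ħ :=
  (List.ofFn fun k : Fin m => fHatDyn ħ i j (x + 2 * (k.val : ℂ))).prod

/-- The submodule of the Verma module of highest weight `ξ + λ` which is generated by its singular
vectors of weights `ξ + λ - m_α α`, for the simple roots `α` of `𝔨`, where
`m_α = (ξ, α^∨) + 1`: the vectors `f_α ^ m_α 1` for `α = α_i`, for all `i` but the first, and
`f̂_δ(x) ⋯ f̂_δ(x + 2 m_δ - 2) 1` with `x = 2 (ξ + λ, α₁) - 2 m_δ + 1`. -/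
def pseudoParabolicSubmodule (ξ lam : Weight n) : Submodule (Uq n ħ) (Verma ħ (ξ + lam)) :=
  Submodule.span (Uq n ħ)
    ({w | ∃ (i : Fin n) (m : ℕ), 0 < i.val ∧ (m : ℂ) = corootPairing ξ (simpleRoot i) + 1 ∧
        w = Uq.F ħ i ^ m • Verma.one ħ (ξ + lam)} ∪
      {w | ∃ (i j : Fin n) (m : ℕ), i.val = 0 ∧ j.val = 1 ∧
        (m : ℂ) = corootPairing ξ (eps i + eps j) + 1 ∧
        w = fHatDynProd ħ i j (2 * ((ξ + lam) ⬝ᵥ simpleRoot i) - 2 * m + 1) m •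
          Verma.one ħ (ξ + lam)})

/-- The pseudo-parabolic Verma module `M_{X,λ}`, where `X` is the irreducible `𝔨`-module of
highest weight `ξ`. -/
abbrev PseudoParabolic (ξ lam : Weight n) : Type :=
  Verma ħ (ξ + lam) ⧸ pseudoParabolicSubmodule ħ ξ lam

/-- The tensor product `V ⊗ W` with the `U_q(𝔤)`-action through the comultiplication. It is a type
of its own because `V ⊗[ℂ] W` carries the action on the left factor. -/
def QTensor (V W : Type*) [AddCommGroup V] [Module ℂ V] [AddCommGroup W] [Module ℂ W] : Type _ :=
  V ⊗[ℂ] W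

end Modules

namespace QTensor

variable {n : ℕ} {ħ : ℂ} {V W : Type*} [AddCommGroup V] [Module ℂ V] [AddCommGroup W] [Module ℂ W]

instance : AddCommGroup (QTensor V W) := inferInstanceAs (AddCommGroup (V ⊗[ℂ] W))

instance : Module ℂ (QTensor V W) := inferInstanceAs (Module ℂ (V ⊗[ℂ] W))

variable (V W) in
/-- The identity map to the underlying vector space. -/
def equiv : QTensor V W ≃ₗ[ℂ] V ⊗[ℂ] W := LinearEquiv.refl ℂ _

variable [Module (Uq n ħ) V] [IsScalarTower ℂ (Uq n ħ) V]
  [Module (Uq n ħ) W] [IsScalarTower ℂ (Uq n ħ) W]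

variable (n ħ V W) in
/-- The representation of `U_q(𝔤)` on `V ⊗ W`. -/
def rep : Uq n ħ →ₐ[ℂ] Module.End ℂ (V ⊗[ℂ] W) :=
  ((Module.endTensorEndAlgHom (R := ℂ) (A := ℂ) (S := ℂ) (M := V) (N := W)).comp
    (Algebra.TensorProduct.map (Algebra.lsmul ℂ ℂ V) (Algebra.lsmul ℂ ℂ W))).comp (Uq.comul n ħ)

instance : Module (Uq n ħ) (QTensor V W) :=
  Module.compHom (V ⊗[ℂ] W) (rep n ħ V W).toRingHom

theorem equiv_smul (a : Uq n ħ) (u : QTensor V W) :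
    equiv V W (a • u) = rep n ħ V W a (equiv V W u) := rfl

instance : IsScalarTower ℂ (Uq n ħ) (QTensor V W) where
  smul_assoc c a u := by
    apply (equiv V W).injective
    rw [equiv_smul, map_smul, map_smul, equiv_smul, LinearMap.smul_apply]

end QTensor

section Delta

variable {n : ℕ} (ħ : ℂ)

/-- `V ⊗ M'`, where `M'` is the sum of the weight spaces of the base module `M` whose weights,
as characters of the Cartan subalgebra, are different from that of the highest vector. -/
def lowerTerms (lam : Weight n) (V : Type*) [AddCommGroup V] [Module ℂ V] :
    Submodule ℂ (V ⊗[ℂ] BaseModule ħ lam) :=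
  Submodule.span ℂ {t | ∃ (μ : Weight n) (w : V) (m : BaseModule ħ lam),
    (∃ i, qpow ħ (μ ⬝ᵥ simpleRoot i) ≠ qpow ħ (lam ⬝ᵥ simpleRoot i)) ∧
      m ∈ weightSpace ħ (BaseModule ħ lam) μ ∧ t = w ⊗ₜ[ℂ] m}

/-- `u = δ_l(v)`: the vector `u` of `V ⊗ M` is singular, and `v` is its coefficient at `1_λ`, that
is, `u = v ⊗ 1_λ + …`, where the other terms have second factors of other weights. -/
def IsDelta (lam : Weight n) {V : Type*} [AddCommGroup V] [Module ℂ V] [Module (Uq n ħ) V]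
    [IsScalarTower ℂ (Uq n ħ) V] (v : V) (u : QTensor V (BaseModule ħ lam)) : Prop :=
  IsSingular n ħ u ∧
    QTensor.equiv V (BaseModule ħ lam) u - v ⊗ₜ[ℂ] BaseModule.one ħ lam ∈ lowerTerms ħ lam V

end Delta

end QSphere

end

open scoped TensorProduct

noncomputable section

namespace QSphere

/-! ### Quantum numbers -/

/-! The engine is one computation with the Serre relations. If `z` is killed by the generators `g_2,
…, g_n` and by the double commutator `ĝ_δ`, then `z` generates a family `y(m)`, `m ∈ ℕⁿ`, with `g_1
y(m) = y(m + ε_1)` and `g_j y(m + ε_{j-1}) = [m_{j-1} + 1] y(m + ε_j)`; also `g_j y(m) = 0` if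
`m_{j-1} = 0` (`SerreRelations.exists_monomialFamily`). It is used twice, for the `f_i` on `1_λ ∈ M`
and for the `e_i` on `v ∈ V`.

In `M` the family spans. It is linearly independent because `M` maps to an explicit oscillator
representation on Laurent polynomials, where the family becomes a set of distinct monomials. So `M`
has a basis of weights `λ - Σ m_i ε_i`, each of multiplicity one, and the action of the `e_i` is
read off in the model (`exists_baseBasis`).

Write an element of `V ⊗ M` through its `V`-valued coefficients in this basis. Singularity becomes a
recursion in `m`, so the coefficient at `1_λ` determines a singular vector
(`BaseBasis.eq_zero_of_isSingular`). Conversely, multiples of the family generated by the `e_i` from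
`v` solve the recursion; the sum is finite because `V` has finitely many weights
(`BaseBasis.exists_isDelta`).

The rest follows from a vanishing principle: a singular vector of weight `ζ + λ` is zero if `(ζ, α)
< 0` is an integer for some simple root `α` of `𝔨` (and `2(ζ, ε_1)` is an integer when `α = δ`). For
`α = α_i`, `i ≥ 2`, the leading coefficient is an `sl(2)`-highest vector of negative weight in `V`.
For `δ`, repeated use of `f̂_δ(s)` with shifted parameters keeps a vector in the kernel of `e_1`,
and `e_2` returns `f_1²` times the previous vector with the factor `[k+1][(ζ, δ) - k]` of an
`sl(2)`-string, up to a non-zero constant. If `(ζ, δ) < 0` the string never stops, which gives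
`q^{h_1}` infinitely many eigenvalues on `V` (`BaseBasis.eq_zero_of_pairing_neg`).

Since `δ_l(v) ≠ 0`, the pairings of `ξ` are non-negative. The generators of the kernel of `M̂_{ξ+λ}
→ M_{X,λ}` are sent to singular vectors with `(ζ, α) = -m_α - 1 < 0`, hence to zero. -/

/-- `q = exp ħ` is not a root of unity. -/
def NotRootOfUnity (ħ : ℂ) : Prop := ∀ k : ℕ, 0 < k → qpow ħ 1 ^ k ≠ 1

theorem qpow_intCast (ħ : ℂ) (k : ℤ) : qpow ħ k = qpow ħ 1 ^ k := by
  rw [qpow, qpow, mul_one, mul_comm, Complex.exp_int_mul]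

theorem NotRootOfUnity.qpow_ne_one {ħ : ℂ} (hq : NotRootOfUnity ħ) {k : ℤ} (hk : k ≠ 0) :
    qpow ħ k ≠ 1 := by
  have key : ∀ m : ℕ, 0 < m → qpow ħ ((m : ℤ) : ℂ) ≠ 1 := fun m hm => by
    rw [qpow_intCast, zpow_natCast]
    exact hq m hm
  rcases Int.natAbs_eq k with h | h
  · rw [h]
    exact key _ (by omega)
  · rw [h, Int.cast_neg, qpow_neg]
    exact fun h' => key k.natAbs (by omega) (inv_eq_one.mp h')

theorem NotRootOfUnity.qpow_injective {ħ : ℂ} (hq : NotRootOfUnity ħ) {k l : ℤ}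
    (h : qpow ħ k = qpow ħ l) : k = l := by
  by_contra hne
  apply hq.qpow_ne_one (sub_ne_zero.mpr hne)
  rw [Int.cast_sub, sub_eq_add_neg, qpow_add, h, mul_comm, qpow_neg_mul]

theorem NotRootOfUnity.sub_ne_zero {ħ : ℂ} (hq : NotRootOfUnity ħ) :
    qpow ħ 1 - qpow ħ (-1) ≠ 0 := by
  intro h
  have := hq.qpow_injective (k := 1) (l := -1) (by push_cast; exact _root_.sub_eq_zero.mp h)
  omega

@[simp]
theorem qnum_zero (ħ : ℂ) : qnum ħ 0 = 0 := by simp [qnum]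

theorem NotRootOfUnity.qnum_one {ħ : ℂ} (hq : NotRootOfUnity ħ) : qnum ħ 1 = 1 :=
  div_self hq.sub_ne_zero

theorem NotRootOfUnity.qnum_ne_zero {ħ : ℂ} (hq : NotRootOfUnity ħ) {k : ℤ} (hk : k ≠ 0) :
    qnum ħ k ≠ 0 := by
  refine div_ne_zero (fun h => ?_) hq.sub_ne_zero
  have := hq.qpow_injective (k := k) (l := -k) (by push_cast; exact _root_.sub_eq_zero.mp h)
  omega

theorem NotRootOfUnity.qnum_succ_ne_zero {ħ : ℂ} (hq : NotRootOfUnity ħ) (k : ℕ) :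
    qnum ħ (k + 1) ≠ 0 := by
  have := hq.qnum_ne_zero (k := k + 1) (by omega)
  exact_mod_cast this

theorem qnum_add_one (ħ z : ℂ) :
    qnum ħ (z + 1) = (qpow ħ 1 + qpow ħ (-1)) * qnum ħ z - qnum ħ (z - 1) := by
  simp only [qnum, neg_add, sub_eq_add_neg, qpow_add, neg_neg]
  ring

/-- `[k]_q! = [1]_q [2]_q ⋯ [k]_q`. -/
def qfactorial (ħ : ℂ) : ℕ → ℂ
  | 0 => 1
  | k + 1 => qnum ħ (k + 1) * qfactorial ħ k

theorem NotRootOfUnity.qfactorial_ne_zero {ħ : ℂ} (hq : NotRootOfUnity ħ) (k : ℕ) :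
    qfactorial ħ k ≠ 0 := by
  induction k with
  | zero => exact one_ne_zero
  | succ k ih => exact mul_ne_zero (hq.qnum_succ_ne_zero k) ih

/-! ### Operators with Serre relations of type `A` -/

section Pair

variable {W : Type*} [AddCommGroup W] [Module ℂ W] {ħ : ℂ}

/-- Two operators `X`, `Y` and a vector `z` killed by `Y`, with the quantum Serre relations of
`sl(3)`, one of which is required only on the vectors `X ^ a z`. -/
structure SerrePair (ħ : ℂ) (X Y : Module.End ℂ W) (z : W) : Prop where
  apply_eq_zero : Y z = 0
  serre_left : ∀ a : ℕ, X (X (Y ((X ^ a) z))) - (qpow ħ 1 + qpow ħ (-1)) • X (Y (X ((X ^ a) z))) +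
    Y (X (X ((X ^ a) z))) = 0
  serre_right : ∀ w, Y (Y (X w)) - (qpow ħ 1 + qpow ħ (-1)) • Y (X (Y w)) + X (Y (Y w)) = 0

theorem End.pow_succ_apply (X : Module.End ℂ W) (a : ℕ) (z : W) :
    (X ^ (a + 1)) z = X ((X ^ a) z) := by
  rw [pow_succ', Module.End.mul_apply]

/-- `serre_left` is the three-term recursion of quantum numbers in disguise: solving it from `Y z =
0` makes `X Y X^a z` proportional to `Y X^{a+1} z`. Division is avoided by keeping both quantum
numbers. -/
theorem SerrePair.apply_apply_pow {X Y : Module.End ℂ W} {z : W} (h : SerrePair ħ X Y z) (a : ℕ) :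
    qnum ħ (a + 1) • X (Y ((X ^ a) z)) = qnum ħ a • Y ((X ^ (a + 1)) z) := by
  induction a with
  | zero => simp [h.apply_eq_zero]
  | succ a ih =>
    have h1 := h.serre_left a
    have h2 := congrArg X ih
    have h3 := qnum_add_one ħ (a + 1)
    simp only [map_smul, End.pow_succ_apply, Nat.cast_add, Nat.cast_one, add_sub_cancel_right]
      at h1 h2 h3 ⊢
    rw [h3]
    linear_combination (norm := module) h2 - qnum ħ (a + 1) • h1

/-- `serre_right` is a second-order recursion in `b` whose solution is again a quantum number; the
case `b = 1` supplies the initial condition. -/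
theorem SerrePair.apply_pow_pow {X Y : Module.End ℂ W} {z : W} (h : SerrePair ħ X Y z) (a b : ℕ) :
    qnum ħ (a + 1) • X ((Y ^ b) ((X ^ a) z)) =
      qnum ħ (a + 1 - b) • (Y ^ b) ((X ^ (a + 1)) z) := by
  induction b using Nat.twoStepInduction with
  | zero => simp [End.pow_succ_apply]
  | one => simpa using h.apply_apply_pow a
  | more b ih0 ih1 =>
    have h1 := h.serre_right ((Y ^ b) ((X ^ a) z))
    have h2 := congrArg (fun w => Y (Y w)) ih0
    have h3 := congrArg Y ih1
    have h4 := qnum_add_one ħ (a - b)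
    rw [show (a : ℂ) - b + 1 = a + 1 - b by ring] at h4
    rw [show (a : ℂ) + 1 - (b + 1 : ℕ) = a - b by push_cast; ring] at h3
    rw [show (a : ℂ) + 1 - (b + 2 : ℕ) = a - b - 1 by push_cast; ring]
    simp only [map_smul, End.pow_succ_apply] at h1 h2 h3 ⊢
    rw [h4] at h2
    linear_combination (norm := module)
      (qpow ħ 1 + qpow ħ (-1)) • h3 - h2 + qnum ħ (a + 1) • h1

/-- Applying `X` to the vanishing vector with exponent `a` leaves `[a + 1 - b]` times the next one,
and this factor is non-zero as long as `a + 1 < b`. -/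
theorem SerrePair.pow_pow_eq_zero (hq : NotRootOfUnity ħ) {X Y : Module.End ℂ W} {z : W}
    (h : SerrePair ħ X Y z) {a b : ℕ} (hab : a < b) : (Y ^ b) ((X ^ a) z) = 0 := by
  induction a with
  | zero =>
    obtain ⟨b, rfl⟩ := Nat.exists_eq_add_of_lt hab
    simp [pow_succ, h.apply_eq_zero]
  | succ a ih =>
    have h1 := h.apply_pow_pow a b
    rw [ih (by omega), map_zero, smul_zero] at h1
    have h2 := hq.qnum_ne_zero (k := a + 1 - b) (by omega)
    push_cast at h2
    exact (smul_eq_zero.mp h1.symm).resolve_left h2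

end Pair

/-! ### Ordered words in a chain of operators of type A. -/

section Words

variable {W : Type*} [AddCommGroup W] [Module ℂ W] {ħ : ℂ}

/-- `t_{j-1} ^ k_{j-1} ⋯ t_0 ^ k_0 z` -/
def wordVec (t : ℕ → Module.End ℂ W) (z : W) (k : ℕ → ℕ) : ℕ → W
  | 0 => z
  | j + 1 => (t j ^ k j) (wordVec t z k j)

/-- Operators `t_0, t_1, …` with the Serre relations of type `A`, except that the relation of
degree two in `t_0` holds up to an operator which commutes with `t_0` and kills the vector `z`;
`z` is killed by `t_1, t_2, …`. -/
structure SerreChain (ħ : ℂ) (t : ℕ → Module.End ℂ W) (z : W) : Prop where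
  apply_eq_zero : ∀ i, 0 < i → t i z = 0
  comm : ∀ i j, i + 1 < j → ∀ w, t i (t j w) = t j (t i w)
  serre_up : ∀ i, 0 < i → ∀ w, t i (t i (t (i + 1) w)) -
    (qpow ħ 1 + qpow ħ (-1)) • t i (t (i + 1) (t i w)) + t (i + 1) (t i (t i w)) = 0
  serre_down : ∀ i w, t (i + 1) (t (i + 1) (t i w)) -
    (qpow ħ 1 + qpow ħ (-1)) • t (i + 1) (t i (t (i + 1) w)) + t i (t (i + 1) (t (i + 1) w)) = 0
  serre_zero : ∀ a : ℕ, t 0 (t 0 (t 1 ((t 0 ^ a) z))) -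
    (qpow ħ 1 + qpow ħ (-1)) • t 0 (t 1 (t 0 ((t 0 ^ a) z))) + t 1 (t 0 (t 0 ((t 0 ^ a) z))) = 0

theorem wordVec_congr (t : ℕ → Module.End ℂ W) (z : W) {k k' : ℕ → ℕ} {j : ℕ}
    (h : ∀ l < j, k l = k' l) : wordVec t z k j = wordVec t z k' j := by
  induction j with
  | zero => rfl
  | succ j ih => rw [wordVec, wordVec, ih fun l hl => h l (by omega), h j (by omega)]

theorem End.apply_pow_of_comm {X Y : Module.End ℂ W} (h : ∀ w, X (Y w) = Y (X w)) (a : ℕ) (w : W) :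
    X ((Y ^ a) w) = (Y ^ a) (X w) := by
  induction a with
  | zero => rfl
  | succ a ih => rw [End.pow_succ_apply, End.pow_succ_apply, h, ih]

variable {t : ℕ → Module.End ℂ W} {z : W}

theorem SerreChain.apply_wordVec_eq_zero (h : SerreChain ħ t z) (k : ℕ → ℕ) {i j : ℕ}
    (hij : j < i) :
    t i (wordVec t z k j) = 0 := by
  induction j with
  | zero => exact h.apply_eq_zero i hij
  | succ j ih =>
    rw [wordVec, End.apply_pow_of_comm fun w => (h.comm j i hij w).symm, ih (by omega), map_zero]

theorem SerreChain.serrePair (h : SerreChain ħ t z) (k : ℕ → ℕ) (i : ℕ) :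
    SerrePair ħ (t i) (t (i + 1)) (wordVec t z k i) where
  apply_eq_zero := h.apply_wordVec_eq_zero k (by omega)
  serre_left a := by
    rcases Nat.eq_zero_or_pos i with rfl | hi
    · exact h.serre_zero a
    · exact h.serre_up i hi _
  serre_right := h.serre_down i

/-- Letters of index at least `i + 2` commute with `t i`, so only the pair `t i`, `t (i + 1)`
matters, and there `SerrePair.apply_pow_pow` applies. -/
theorem SerreChain.apply_wordVec (h : SerreChain ħ t z) {k k' : ℕ → ℕ} {i : ℕ} (hi : k' i = k i + 1)
    (hk : ∀ l, l ≠ i → k' l = k l) {j : ℕ} (hj : i + 2 ≤ j) :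
    qnum ħ (k i + 1) • t i (wordVec t z k j) =
      qnum ħ (k i + 1 - k (i + 1)) • wordVec t z k' j := by
  induction j, hj using Nat.le_induction with
  | base =>
    have h1 := (h.serrePair k i).apply_pow_pow (k i) (k (i + 1))
    rw [wordVec, wordVec, h1, wordVec, wordVec, hi, hk (i + 1) (by omega),
      wordVec_congr t z fun l hl => hk l (by omega)]
  | succ j hj ih =>
    rw [wordVec, wordVec, End.apply_pow_of_comm (h.comm i j (by omega)), ← map_smul, ih, map_smul,
      hk j (by omega)]

/-- Thus only words with non-increasing exponents survive; these are the tail sums of some `m`. -/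
theorem SerreChain.wordVec_eq_zero (h : SerreChain ħ t z) (hq : NotRootOfUnity ħ) {k : ℕ → ℕ}
    {i : ℕ} (hi : k i < k (i + 1)) {j : ℕ} (hj : i + 2 ≤ j) : wordVec t z k j = 0 := by
  induction j, hj using Nat.le_induction with
  | base => exact (h.serrePair k i).pow_pow_eq_zero hq hi
  | succ j hj ih => rw [wordVec, ih, map_zero]

end Words

/-! ### Normalization of the words to a monomial family indexed by `ℕⁿ`. -/

section Family

variable {n : ℕ} {W : Type*} [AddCommGroup W] [Module ℂ W] {ħ : ℂ}

/-- A family of vectors on which the operators `t_i` act as the `f_{α_i}` act on the monomials in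
the base module. -/
structure IsMonomialFamily (ħ : ℂ) (t : Fin n → Module.End ℂ W) (y : (Fin n → ℕ) → W) : Prop where
  apply_first : ∀ i : Fin n, i.val = 0 → ∀ m : Fin n → ℕ, t i (y m) = y (m + Pi.single i 1)
  apply_add : ∀ i j : Fin n, i.val + 1 = j.val → ∀ m : Fin n → ℕ,
    t j (y (m + Pi.single i 1)) = qnum ħ (m i + 1) • y (m + Pi.single j 1)
  apply_of_eq_zero : ∀ i j : Fin n, i.val + 1 = j.val → ∀ m : Fin n → ℕ, m i = 0 → t j (y m) = 0

theorem exponent_eq_add_single {m : Fin n → ℕ} {j : Fin n} (h : m j ≠ 0) :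
    ∃ m' : Fin n → ℕ, m = m' + Pi.single j 1 := by
  refine ⟨m - Pi.single j 1, (tsub_add_cancel_of_le fun l => ?_).symm⟩
  rcases eq_or_ne l j with rfl | hl
  · simp
    omega
  · simp [hl]

/-- Every exponent is reached from zero by adding a unit in the first place and moving units one
place up; `Σ (l + 1) m_l` grows by one at each move. The actions of `f_1` and `f_j`, up to scalars,
follow exactly these moves. -/
theorem exponent_induction {P : (Fin n → ℕ) → Prop} (h0 : P 0)
    (h1 : ∀ i : Fin n, i.val = 0 → ∀ m : Fin n → ℕ, P m → P (m + Pi.single i 1))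
    (h2 : ∀ i j : Fin n, i.val + 1 = j.val → ∀ m : Fin n → ℕ,
      P (m + Pi.single i 1) → P (m + Pi.single j 1))
    (m : Fin n → ℕ) : P m := by
  have key : ∀ N, ∀ m : Fin n → ℕ, ∑ l, (l.val + 1) * m l = N → P m := by
    intro N
    induction N using Nat.strong_induction_on with
    | _ N ih =>
      intro m hm
      by_cases hz : m = 0
      · exact hz ▸ h0
      · obtain ⟨j, hj⟩ := Function.ne_iff.mp hz
        obtain ⟨m', rfl⟩ := exponent_eq_add_single hj
        have hs : ∀ l : Fin n, ∑ r : Fin n, (r.val + 1) * (m' + Pi.single l 1 : Fin n → ℕ) r =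
            ∑ r : Fin n, (r.val + 1) * m' r + (l.val + 1) := fun l => by
          simp [mul_add, Finset.sum_add_distrib, Pi.single_apply]
        rw [hs] at hm
        by_cases h : j.val = 0
        · exact h1 j h m' (ih _ (by omega) m' rfl)
        · have hlt : j.val - 1 < n := by omega
          refine h2 ⟨j.val - 1, hlt⟩ j (by simp; omega) m' (ih _ ?_ _ rfl)
          rw [hs]
          simp
          omega
  exact key _ m rfl

/-- `m_i + m_{i+1} + ⋯` -/
def tailSum (m : Fin n → ℕ) (i : ℕ) : ℕ := ∑ j : Fin n, if i ≤ j.val then m j else 0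

theorem tailSum_val (m : Fin n → ℕ) (i : Fin n) :
    tailSum m i.val = m i + tailSum m (i.val + 1) := by
  have h : m i = ∑ j, if j = i then m j else 0 := by simp
  rw [h, tailSum, tailSum, ← Finset.sum_add_distrib]
  refine Finset.sum_congr rfl fun j _ => ?_
  rcases lt_trichotomy i.val j.val with h | h | h
  · simp [h.le, Nat.succ_le_of_lt h, Fin.ext_iff, h.ne']
  · simp [h, Fin.ext_iff]
  · simp [h.not_ge, Fin.ext_iff, h.ne, (Nat.lt_succ_of_lt h).not_ge]

theorem tailSum_add_single (m : Fin n → ℕ) (i : Fin n) (l : ℕ) :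
    tailSum (m + Pi.single i 1) l = tailSum m l + if l ≤ i.val then 1 else 0 := by
  have h : (if l ≤ i.val then 1 else 0) =
      ∑ j : Fin n, if l ≤ j.val then (Pi.single i 1 : Fin n → ℕ) j else 0 := by
    rw [Finset.sum_eq_single i (fun j _ hj => by simp [hj]) (by simp)]
    simp
  rw [h, tailSum, tailSum, ← Finset.sum_add_distrib]
  refine Finset.sum_congr rfl fun j _ => ?_
  split <;> simp

theorem prod_qfactorial_succ {ι : Type*} [DecidableEq ι] {s : Finset ι} {i : ι} (hi : i ∈ s)
    {k k' : ι → ℕ} (h : k' i = k i + 1) (hk : ∀ l, l ≠ i → k' l = k l) :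
    ∏ l ∈ s, qfactorial ħ (k' l) = qnum ħ (k i + 1) * ∏ l ∈ s, qfactorial ħ (k l) := by
  rw [← Finset.mul_prod_erase s _ hi, ← Finset.mul_prod_erase s _ hi, h, qfactorial, mul_assoc]
  congr 2
  exact Finset.prod_congr rfl fun l hl => by rw [hk l (Finset.ne_of_mem_erase hl)]

theorem prod_qfactorial_add_single (m : Fin n → ℕ) (i : Fin n) :
    ∏ l, qfactorial ħ ((m + Pi.single i 1 : Fin n → ℕ) l) =
      qnum ħ (m i + 1) * ∏ l, qfactorial ħ (m l) :=
  prod_qfactorial_succ (Finset.mem_univ i) (k' := m + Pi.single i 1) (by simp)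
    fun l hl => by simp [hl]

/-- The family which is generated by `t_0, …, t_{n-1}` from the vector `z`. -/
def monomialFamily (ħ : ℂ) (t : ℕ → Module.End ℂ W) (z : W) (m : Fin n → ℕ) : W :=
  ((∏ i, qfactorial ħ (m i)) / ∏ i ∈ Finset.range n, qfactorial ħ (tailSum m i)) •
    -- The last tail sum is zero, so the letter `t n` does not occur. It is included so that every
    -- letter `t i` with `i < n` has a successor in the word.
    wordVec t z (tailSum m) (n + 1)

theorem monomialFamily_zero (t : ℕ → Module.End ℂ W) (z : W) :
    monomialFamily ħ t z (0 : Fin n → ℕ) = z := by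
  have h : ∀ l, tailSum (0 : Fin n → ℕ) l = 0 := fun l => by simp [tailSum]
  have hw : ∀ j, wordVec t z (tailSum (0 : Fin n → ℕ)) j = z := fun j => by
    induction j with
    | zero => rfl
    | succ j ih => rw [wordVec, ih, h]; rfl
  simp [monomialFamily, h, qfactorial, hw]

/-- Since `k_j - k_{j+1} = m_j` for tail sums, applying `t_j` replaces `[k_j + 1]` by `[m_j + 1]`.
The quotient of factorials absorbs the former; what remains is the comparison `hc`. -/
theorem SerreChain.apply_monomialFamily {t : ℕ → Module.End ℂ W} {z : W}
    (h : SerreChain ħ t z) (hq : NotRootOfUnity ħ) (j : Fin n) {m m' : Fin n → ℕ}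
    (hj : tailSum m' j = tailSum m j + 1) (hm : ∀ l, l ≠ j.val → tailSum m' l = tailSum m l)
    {c : ℂ} (hc : qnum ħ (m j + 1) * ∏ i, qfactorial ħ (m i) = c * ∏ i, qfactorial ħ (m' i)) :
    t j (monomialFamily ħ t z m) = c • monomialFamily ħ t z m' := by
  have hr : j.val ∈ Finset.range n := Finset.mem_range.mpr j.isLt
  have h1 := h.apply_wordVec (k := tailSum m) (k' := tailSum m') (i := j) hj hm
    (j := n + 1) (by omega)
  have h2 : (tailSum m j.val : ℂ) + 1 - (tailSum m (j.val + 1) : ℕ) = m j + 1 := by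
    rw [tailSum_val]
    push_cast
    ring
  have hne := hq.qnum_succ_ne_zero (tailSum m j)
  have hp : ∏ i ∈ Finset.range n, qfactorial ħ (tailSum m i) ≠ 0 :=
    Finset.prod_ne_zero_iff.mpr fun i _ => hq.qfactorial_ne_zero _
  rw [h2] at h1
  rw [monomialFamily, monomialFamily, map_smul, ← smul_right_injective W hne |>.eq_iff,
    smul_comm, h1, prod_qfactorial_succ hr hj hm, smul_smul, smul_smul, smul_smul]
  congr 1
  field_simp
  linear_combination hc

theorem SerreChain.isMonomialFamily {t : ℕ → Module.End ℂ W} {z : W}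
    (h : SerreChain ħ t z) (hq : NotRootOfUnity ħ) :
    IsMonomialFamily ħ (fun i : Fin n => t i) (monomialFamily ħ t z) where
  apply_first i hi m := by
    rw [← one_smul ℂ (monomialFamily ħ t z (m + _))]
    refine h.apply_monomialFamily hq i (by simp [tailSum_add_single]) (fun l hl => ?_) ?_
    · rw [tailSum_add_single, if_neg (by omega), add_zero]
    · rw [one_mul, prod_qfactorial_add_single]
  apply_add i j hij m := by
    have hne : j ≠ i := fun h => by rw [h] at hij; omega
    refine h.apply_monomialFamily hq j ?_ (fun l hl => ?_) ?_
    · rw [tailSum_add_single, tailSum_add_single, if_pos le_rfl, if_neg (by omega), add_zero]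
    · rw [tailSum_add_single, tailSum_add_single]
      congr 1
      exact if_congr (by omega) rfl rfl
    · rw [prod_qfactorial_add_single, prod_qfactorial_add_single]
      simp only [Pi.add_apply, Pi.single_eq_of_ne hne, add_zero]
      ring
  apply_of_eq_zero i j hij m hm := by
    -- If `m_i = 0`, the exponents at `i` and `j` are equal. Raising the one at `j` breaks
    -- monotonicity; the new exponents are no longer tail sums, hence the `update`.
    have h1 := h.apply_wordVec (k := tailSum m)
      (k' := Function.update (tailSum m) j (tailSum m j + 1)) (i := j) (by simp)
      (fun l hl => by simp [hl]) (j := n + 1) (by omega)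
    rw [h.wordVec_eq_zero hq (k := Function.update _ _ _) (i := i) ?_ (by omega), smul_zero] at h1
    · rw [monomialFamily, map_smul,
        (smul_eq_zero.mp h1).resolve_left (hq.qnum_succ_ne_zero _), smul_zero]
    · rw [hij, Function.update_self, Function.update_of_ne (by omega), tailSum_val, hm, hij]
      omega

end Family

/-! ### The monomial family for the generators of the quantum group. -/

section Generators

variable {n : ℕ} {ħ : ℂ} {A : Type*} [Ring A] [Algebra ℂ A]

/-- The Serre relations of `U_q(so(2n+1))`. -/
structure SerreRelations (ħ : ℂ) (g : Fin n → A) : Prop where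
  long : ∀ i j : Fin n, i.val ≠ 0 → Adjacent i j →
    qcomm (qpow ħ (-1)) (g i) (qcomm (qpow ħ 1) (g i) (g j)) = 0
  far : ∀ i j : Fin n, i ≠ j → ¬ Adjacent i j → qcomm 1 (g i) (g j) = 0
  short : ∀ i j : Fin n, i.val = 0 → j.val = 1 →
    qcomm 1 (g i) (qcomm (qpow ħ (-1)) (g i) (qcomm (qpow ħ 1) (g i) (g j))) = 0

theorem serreRelations_E : SerreRelations ħ (Uq.E ħ : Fin n → Uq n ħ) :=
  ⟨Uq.serre_E, Uq.serre_E_far, Uq.serre_E_short⟩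

theorem serreRelations_F : SerreRelations ħ (Uq.F ħ : Fin n → Uq n ħ) :=
  ⟨Uq.serre_F, Uq.serre_F_far, Uq.serre_F_short⟩

theorem qcomm_qcomm (x y : A) : qcomm (qpow ħ (-1)) x (qcomm (qpow ħ 1) x y) =
    x * x * y - (qpow ħ 1 + qpow ħ (-1)) • (x * y * x) + y * x * x := by
  simp only [qcomm, mul_sub, sub_mul, mul_smul_comm, smul_mul_assoc, smul_sub, smul_smul,
    qpow_neg_mul, mul_assoc]
  module

variable {W : Type*} [AddCommGroup W] [Module ℂ W] [Module A W] [IsScalarTower ℂ A W]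

theorem qcomm_qcomm_smul (x y : A) (w : W) :
    qcomm (qpow ħ (-1)) x (qcomm (qpow ħ 1) x y) • w =
    x • x • y • w - (qpow ħ 1 + qpow ħ (-1)) • x • y • x • w + y • x • x • w := by
  simp only [qcomm_qcomm, add_smul, sub_smul, smul_assoc, mul_smul]

variable (W) in
/-- The operators of the generators on a module, extended by zero. -/
def generatorEnd (g : Fin n → A) (i : ℕ) : Module.End ℂ W :=
  if h : i < n then Algebra.lsmul ℂ ℂ W (g ⟨i, h⟩) else 0

theorem generatorEnd_apply (g : Fin n → A) (i : Fin n) (w : W) :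
    generatorEnd W g i w = g i • w := by simp [generatorEnd]

theorem SerreRelations.serreChain {g : Fin n → A} (h : SerreRelations ħ g) {z : W}
    (hz : ∀ i : Fin n, 0 < i.val → g i • z = 0)
    (hz' : ∀ i j : Fin n, i.val = 0 → j.val = 1 →
      qcomm (qpow ħ (-1)) (g i) (qcomm (qpow ħ 1) (g i) (g j)) • z = 0) :
    SerreChain ħ (generatorEnd W g) z where
  apply_eq_zero i hi := by
    by_cases hin : i < n
    · simp [generatorEnd, hin, hz ⟨i, hin⟩ hi]
    · simp [generatorEnd, hin]
  comm i j hij w := by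
    by_cases hj : j < n
    · have hi : i < n := by omega
      have h1 := h.far ⟨i, hi⟩ ⟨j, hj⟩ (by simp; omega) (by simp [Adjacent]; omega)
      rw [qcomm, one_smul, sub_eq_zero] at h1
      simp [generatorEnd, hi, hj, smul_smul, h1]
    · simp [generatorEnd, hj]
  serre_up i hi w := by
    by_cases hj : i + 1 < n
    · have hin : i < n := by omega
      have h1 := congrArg (· • w) (h.long ⟨i, hin⟩ ⟨i + 1, hj⟩ (by simp; omega) (Or.inl rfl))
      simp only [qcomm_qcomm_smul, zero_smul] at h1
      simpa [generatorEnd, hin, hj] using h1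
    · simp [generatorEnd, hj]
  serre_down i w := by
    by_cases hj : i + 1 < n
    · have hin : i < n := by omega
      have h1 := congrArg (· • w) (h.long ⟨i + 1, hj⟩ ⟨i, hin⟩ (by simp) (Or.inr rfl))
      simp only [qcomm_qcomm_smul, zero_smul] at h1
      simpa [generatorEnd, hin, hj] using h1
    · simp [generatorEnd, hj]
  serre_zero a := by
    by_cases hj : 1 < n
    · have hin : 0 < n := by omega
      have h1 := h.short ⟨0, hin⟩ ⟨1, hj⟩ rfl rfl
      rw [qcomm, one_smul, sub_eq_zero] at h1
      -- The short Serre relation says that the double commutator commutes with `g_1`, so it kills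
      -- all `g_1^a z` as soon as it kills `z`.
      have h2 : ∀ a : ℕ, qcomm (qpow ħ (-1)) (g ⟨0, hin⟩)
          (qcomm (qpow ħ 1) (g ⟨0, hin⟩) (g ⟨1, hj⟩)) • (generatorEnd W g 0 ^ a) z = 0 := by
        intro a
        induction a with
        | zero => exact hz' _ _ rfl rfl
        | succ a ih =>
          rw [End.pow_succ_apply, generatorEnd_apply g ⟨0, hin⟩, ← mul_smul, ← h1, mul_smul, ih,
            smul_zero]
      have h3 := h2 a
      rw [qcomm_qcomm_smul] at h3
      rw [← h3]
      simp [generatorEnd, hin, hj]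
    · simp [generatorEnd, hj]

theorem SerreRelations.exists_monomialFamily {g : Fin n → A} (h : SerreRelations ħ g)
    (hq : NotRootOfUnity ħ) {z : W} (hz : ∀ i : Fin n, 0 < i.val → g i • z = 0)
    (hz' : ∀ i j : Fin n, i.val = 0 → j.val = 1 →
      qcomm (qpow ħ (-1)) (g i) (qcomm (qpow ħ 1) (g i) (g j)) • z = 0) :
    ∃ y : (Fin n → ℕ) → W, y 0 = z ∧
      IsMonomialFamily ħ (fun i => Algebra.lsmul ℂ ℂ W (g i)) y := by
  refine ⟨monomialFamily ħ (generatorEnd W g) z, monomialFamily_zero _ _, ?_⟩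
  have h1 := (h.serreChain hz hz').isMonomialFamily (n := n) hq
  convert h1 using 2 with i
  simp [generatorEnd]

end Generators

/-! ### Weighted shifts of Laurent monomials. -/

section ShiftOperators

/-- The operator `x ^ m ↦ c(m) x ^ (m + v)` on Laurent polynomials. -/
def shiftOp (c : (ℕ → ℤ) → ℂ) (v : ℕ → ℤ) : Module.End ℂ ((ℕ → ℤ) →₀ ℂ) :=
  Finsupp.linearCombination ℂ fun m => c m • Finsupp.single (m + v) 1

theorem shiftOp_single (c : (ℕ → ℤ) → ℂ) (v m : ℕ → ℤ) :
    shiftOp c v (Finsupp.single m 1) = c m • Finsupp.single (m + v) 1 := by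
  simp [shiftOp, Finsupp.linearCombination_single]

theorem laurent_ext {f g : Module.End ℂ ((ℕ → ℤ) →₀ ℂ)}
    (h : ∀ m, f (Finsupp.single m 1) = g (Finsupp.single m 1)) : f = g :=
  Finsupp.lhom_ext fun m c => by
    rw [← mul_one c, ← smul_eq_mul, ← Finsupp.smul_single, map_smul, map_smul, h]

theorem shiftOp_mul (c d : (ℕ → ℤ) → ℂ) (v w : ℕ → ℤ) :
    shiftOp c v * shiftOp d w = shiftOp (fun m => c (m + w) * d m) (v + w) := by
  refine laurent_ext fun m => ?_
  simp only [Module.End.mul_apply, shiftOp_single, map_smul, smul_smul]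
  rw [mul_comm, add_assoc, add_comm w]

theorem shiftOp_add (c d : (ℕ → ℤ) → ℂ) (v : ℕ → ℤ) :
    shiftOp c v + shiftOp d v = shiftOp (c + d) v :=
  laurent_ext fun m => by
    simp only [LinearMap.add_apply, shiftOp_single, Pi.add_apply, add_smul]

theorem shiftOp_sub (c d : (ℕ → ℤ) → ℂ) (v : ℕ → ℤ) :
    shiftOp c v - shiftOp d v = shiftOp (c - d) v :=
  laurent_ext fun m => by
    simp only [LinearMap.sub_apply, shiftOp_single, Pi.sub_apply, sub_smul]

theorem smul_shiftOp (a : ℂ) (c : (ℕ → ℤ) → ℂ) (v : ℕ → ℤ) :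
    a • shiftOp c v = shiftOp (a • c) v :=
  laurent_ext fun m => by
    simp only [LinearMap.smul_apply, shiftOp_single, Pi.smul_apply, smul_smul, smul_eq_mul]

theorem shiftOp_eq_zero {c : (ℕ → ℤ) → ℂ} {v : ℕ → ℤ} (h : ∀ m, c m = 0) : shiftOp c v = 0 :=
  laurent_ext fun m => by simp [shiftOp_single, h]

theorem shiftOp_eq_one {c : (ℕ → ℤ) → ℂ} (h : ∀ m, c m = 1) : shiftOp c 0 = 1 :=
  laurent_ext fun m => by simp [shiftOp_single, h]

theorem shiftOp_comm {c d : (ℕ → ℤ) → ℂ} {v w : ℕ → ℤ}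
    (h : ∀ m, c (m + w) * d m = d (m + v) * c m) :
    shiftOp c v * shiftOp d w = shiftOp d w * shiftOp c v := by
  rw [shiftOp_mul, shiftOp_mul, add_comm v, funext h]

theorem qcomm_qcomm_shiftOp {ħ : ℂ} {c d : (ℕ → ℤ) → ℂ} {v w : ℕ → ℤ}
    (h : ∀ m, c (m + w + v) * c (m + w) * d m -
      (qpow ħ 1 + qpow ħ (-1)) * (c (m + v + w) * d (m + v) * c m) +
      d (m + v + v) * c (m + v) * c m = 0) :
    qcomm (qpow ħ (-1)) (shiftOp c v) (qcomm (qpow ħ 1) (shiftOp c v) (shiftOp d w)) = 0 := by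
  rw [qcomm_qcomm]
  simp only [shiftOp_mul]
  rw [show v + w + v = v + v + w by abel, show w + v + v = v + v + w by abel, smul_shiftOp,
    shiftOp_sub, shiftOp_add]
  refine shiftOp_eq_zero fun m => ?_
  have := h m
  simp only [Pi.add_apply, Pi.sub_apply, Pi.smul_apply, smul_eq_mul]
  linear_combination this

end ShiftOperators

/-! ### The oscillator representation on Laurent polynomials. -/

section Model

variable {n : ℕ} (ħ : ℂ)

/-- The quantum number of an integer. -/
def qint (z : ℤ) : ℂ := qnum ħ z

theorem qint_add_one (z : ℤ) :
    qint ħ (z + 1) = (qpow ħ 1 + qpow ħ (-1)) * qint ħ z - qint ħ (z - 1) := by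
  simpa [qint] using qnum_add_one ħ z

theorem qint_sub_add (z : ℤ) :
    qint ħ z - (qpow ħ 1 + qpow ħ (-1)) * qint ħ (z + 1) + qint ħ (z + 2) = 0 := by
  have h := qint_add_one ħ (z + 1)
  rw [add_sub_cancel_right, add_assoc] at h
  norm_num at h
  rw [h]
  ring

/-- The exponents of the variables of index `i + 1` are those at the roots `ε_i`. The variable of
index zero carries no information. -/
def rootShift (i : ℕ) : ℕ → ℤ := Pi.single (i + 1) 1 - Pi.single i 1

/-- The coefficient of `f_{α_i}` in the polynomial model. -/
def modelF (i : ℕ) (m : ℕ → ℤ) : ℂ := if i = 0 then 1 else qint ħ (m i)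

/-- The coefficient of `e_{α_i}` in the polynomial model. -/
def modelE (κ : ℂ) (i : ℕ) (m : ℕ → ℤ) : ℂ := (if i = 0 then κ else 1) * qint ħ (m (i + 1))

/-- The coefficient of `q ^ h_{α_i}` in the polynomial model. -/
def modelK (b : ℂ) (i : ℕ) (m : ℕ → ℤ) : ℂ :=
  if i = 0 then b * qpow ħ (-(m 1 : ℤ)) else qpow ħ ((m i - m (i + 1) : ℤ))

/-- The operators of the generators in the polynomial model. -/
def modelGen (n : ℕ) (κ b : ℂ) : Gen n → Module.End ℂ ((ℕ → ℤ) →₀ ℂ)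
  | .e i => shiftOp (modelE ħ κ i) (-rootShift i)
  | .f i => shiftOp (modelF ħ i) (rootShift i)
  | .k i => shiftOp (modelK ħ b i) 0
  | .kinv i => shiftOp (fun m => (modelK ħ b i m)⁻¹) 0

theorem rootShift_apply (i l : ℕ) :
    rootShift i l = (if l = i + 1 then 1 else 0) - if l = i then 1 else 0 := by
  simp [rootShift, Pi.single_apply]

variable {ħ}

theorem modelK_ne_zero {b : ℂ} (hb : b ≠ 0) (i : ℕ) (m : ℕ → ℤ) : modelK ħ b i m ≠ 0 := by
  unfold modelK
  split
  · exact mul_ne_zero hb (qpow_ne_zero _ _)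
  · exact qpow_ne_zero _ _

/-- The operators of the model are graded: the shift by a root changes the weight by the entry of
the Cartan form. This accounts for all relations between `q^h` and the other generators. -/
theorem modelK_add_rootShift (b : ℂ) (i j : Fin n) (m : ℕ → ℤ) :
    modelK ħ b i (m + rootShift j) =
      qpow ħ (-(simpleRoot i ⬝ᵥ simpleRoot j)) * modelK ħ b i m := by
  have key : ∀ c : ℂ, (if i.val = 0 then -((rootShift j 1 : ℤ) : ℂ)
      else ((rootShift j i.val - rootShift j (i.val + 1) : ℤ) : ℂ)) = -c →
      modelK ħ b i (m + rootShift j) = qpow ħ (-c) * modelK ħ b i m := fun c hc => by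
    unfold modelK
    split_ifs at hc ⊢ with hi
    · rw [← hc, Pi.add_apply, mul_left_comm, ← qpow_add]
      push_cast
      ring_nf
    · rw [← hc, ← qpow_add]
      simp only [Pi.add_apply]
      push_cast
      ring_nf
  apply key
  simp only [rootShift_apply]
  rcases eq_or_ne i j with rfl | hij
  · by_cases hi : i.val = 0
    · rw [simpleRoot_zero i hi]
      simp [hi]
    · rw [simpleRoot_self i hi]
      simp [hi]
  · have hij' : i.val ≠ j.val := fun h => hij (Fin.ext h)
    by_cases h : Adjacent i j
    · rw [simpleRoot_adj i j h]
      rcases h with h | h <;> by_cases hi : i.val = 0 <;> split_ifs <;> (try omega) <;> simp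
    · rw [simpleRoot_far i j hij h]
      simp only [Adjacent, not_or] at h
      split_ifs <;> (try omega) <;> simp

theorem modelK_sub_rootShift (b : ℂ) (i j : Fin n) (m : ℕ → ℤ) :
    modelK ħ b i (m + -rootShift j) =
      qpow ħ (simpleRoot i ⬝ᵥ simpleRoot j) * modelK ħ b i m := by
  have h := modelK_add_rootShift (ħ := ħ) b i j (m + -rootShift j)
  rw [neg_add_cancel_right] at h
  rw [h, ← mul_assoc, mul_comm (qpow _ _), qpow_neg_mul, one_mul]

/-- The case `i = 0` is included: in the model the quadratic relation holds for the short root as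
well, so `ê_δ` acts by zero and the short Serre relation is immediate. -/
theorem modelE_hat (κ : ℂ) (i j : ℕ) (h : i + 1 = j ∨ j + 1 = i) (m : ℕ → ℤ) :
    modelE ħ κ i (m + -rootShift j + -rootShift i) * modelE ħ κ i (m + -rootShift j) *
        modelE ħ κ j m -
      (qpow ħ 1 + qpow ħ (-1)) * (modelE ħ κ i (m + -rootShift i + -rootShift j) *
        modelE ħ κ j (m + -rootShift i) * modelE ħ κ i m) +
      modelE ħ κ j (m + -rootShift i + -rootShift i) * modelE ħ κ i (m + -rootShift i) *
        modelE ħ κ i m = 0 := by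
  rcases h with rfl | rfl
  · have h := qint_sub_add ħ (m (i + 1) - 1)
    rw [sub_add_cancel, show m (i + 1) - 1 + 2 = m (i + 1) + 1 by ring] at h
    simp only [modelE]
    generalize (if i = 0 then κ else 1) = c
    simp [rootShift_apply, show ¬ i + 1 + 1 = i by omega]
    simp only [← sub_eq_add_neg]
    linear_combination (c * c * qint ħ (m (i + 1)) * qint ħ (m (i + 1 + 1))) * h
  · have h := qint_sub_add ħ (m (j + 1))
    simp only [modelE]
    generalize (if j = 0 then κ else 1) = c
    simp [rootShift_apply, show ¬ j + 1 + 1 = j by omega]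
    rw [show m (j + 1) + 1 + 1 = m (j + 1) + 2 by ring,
      show m (j + 1 + 1) + -1 = m (j + 1 + 1) - 1 by ring]
    linear_combination (c * qint ħ (m (j + 1 + 1) - 1) *
      qint ħ (m (j + 1 + 1))) * h

theorem modelF_hat (i j : ℕ) (h : i + 1 = j ∨ j + 1 = i) (m : ℕ → ℤ) :
    modelF ħ i (m + rootShift j + rootShift i) * modelF ħ i (m + rootShift j) * modelF ħ j m -
      (qpow ħ 1 + qpow ħ (-1)) * (modelF ħ i (m + rootShift i + rootShift j) *
        modelF ħ j (m + rootShift i) * modelF ħ i m) +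
      modelF ħ j (m + rootShift i + rootShift i) * modelF ħ i (m + rootShift i) *
        modelF ħ i m = 0 := by
  rcases h with rfl | rfl
  · have h := qint_sub_add ħ (m (i + 1))
    simp [modelF, rootShift_apply, show ¬ i = i + 1 + 1 by omega]
    rw [show m (i + 1) + 1 + 1 = m (i + 1) + 2 by ring]
    split_ifs with hi
    · linear_combination h
    · linear_combination qint ħ (m i + -1) * qint ħ (m i) * h
  · have h := qint_sub_add ħ (m (j + 1) - 1)
    rw [sub_add_cancel, show m (j + 1) - 1 + 2 = m (j + 1) + 1 by ring] at h
    simp [modelF, rootShift_apply, show ¬ j = j + 1 + 1 by omega]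
    simp only [← sub_eq_add_neg]
    split_ifs
    · linear_combination qint ħ (m (j + 1)) * h
    · linear_combination (qint ħ (m j) * qint ħ (m (j + 1))) * h

theorem modelE_modelF (κ : ℂ) {i j : ℕ} (h : i ≠ j) (m : ℕ → ℤ) :
    modelE ħ κ i (m + rootShift j) * modelF ħ j m =
      modelF ħ j (m + -rootShift i) * modelE ħ κ i m := by
  simp only [modelE, modelF, Pi.add_apply, Pi.neg_apply, rootShift_apply]
  by_cases hj : j = i + 1
  · subst hj
    simp [← sub_eq_add_neg]
    ring_nf
  · rw [if_neg (by omega : ¬ i + 1 = j + 1), if_neg (by omega : ¬ i + 1 = j),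
      if_neg (by omega : ¬ j = i + 1), if_neg (by omega : ¬ j = i)]
    simp [mul_comm]

theorem modelE_comm (κ : ℂ) {i j : ℕ} (h : ¬ (i + 1 = j ∨ j + 1 = i)) (m : ℕ → ℤ) :
    modelE ħ κ i (m + -rootShift j) * modelE ħ κ j m =
      modelE ħ κ j (m + -rootShift i) * modelE ħ κ i m := by
  rcases eq_or_ne i j with rfl | hij
  · rfl
  simp only [modelE, Pi.add_apply, Pi.neg_apply, rootShift_apply]
  rw [if_neg (by omega : ¬ i + 1 = j + 1), if_neg (by omega : ¬ i + 1 = j),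
    if_neg (by omega : ¬ j + 1 = i + 1), if_neg (by omega : ¬ j + 1 = i)]
  simp only [sub_zero, neg_zero, add_zero]
  ring

theorem modelF_comm {i j : ℕ} (h : ¬ (i + 1 = j ∨ j + 1 = i)) (m : ℕ → ℤ) :
    modelF ħ i (m + rootShift j) * modelF ħ j m = modelF ħ j (m + rootShift i) * modelF ħ i m := by
  rcases eq_or_ne i j with rfl | hij
  · rfl
  simp only [modelF, Pi.add_apply, rootShift_apply]
  rw [if_neg (by omega : ¬ i = j + 1), if_neg hij, if_neg (by omega : ¬ j = i + 1),
    if_neg hij.symm]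
  simp only [sub_zero, add_zero]
  ring

/-- The coefficient of `e_{α_1}` is `[m]_q` multiplied by this number. -/
def modelConst (ħ b : ℂ) : ℂ := b / (1 - qpow ħ (-1))

/-- For `α_1` the left side is `κ([m + 1] - [m])`, a multiple of `q^{m+1} + q^{-m}`. The right side
`b q^{-m} - b⁻¹ q^m` has this shape precisely because `b² = -q⁻¹`, and comparing the factors gives
`κ = b / (1 - q⁻¹)`. This is where the special value of `λ` enters. -/
theorem modelE_modelF_self (hq : NotRootOfUnity ħ) {b : ℂ} (hb : b * b = -qpow ħ (-1)) (i : ℕ)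
    (m : ℕ → ℤ) :
    modelE ħ (modelConst ħ b) i (m + rootShift i) * modelF ħ i m -
      modelF ħ i (m + -rootShift i) * modelE ħ (modelConst ħ b) i m =
    (qpow ħ 1 - qpow ħ (-1))⁻¹ * (modelK ħ b i m - (modelK ħ b i m)⁻¹) := by
  have hD := hq.sub_ne_zero
  have hq0 := qpow_ne_zero ħ 1
  have h1 : qpow ħ 1 - 1 ≠ 0 :=
    sub_ne_zero.mpr (by simpa using hq.qpow_ne_one (k := 1) one_ne_zero)
  rw [qpow_neg] at hD
  by_cases hi : i = 0
  · subst hi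
    have hb0 : b ≠ 0 := by
      rintro rfl
      simp [qpow_ne_zero] at hb
    have h2 : 1 - (qpow ħ 1)⁻¹ ≠ 0 := by
      intro h
      apply h1
      field_simp at h
      simpa using h
    have hbi : b⁻¹ = -(b * qpow ħ 1) := by
      rw [qpow_neg] at hb
      field_simp at hb ⊢
      linear_combination hb
    have hm := qpow_ne_zero ħ (m 1 : ℂ)
    simp only [modelE, modelF, modelK, modelConst, if_true, Pi.add_apply, rootShift_apply, qint,
      qnum, mul_inv, hbi]
    simp [qpow_add, qpow_neg]
    field_simp
    ring
  · have ha := qpow_ne_zero ħ (m i : ℂ)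
    have hc := qpow_ne_zero ħ (m (i + 1) : ℂ)
    simp only [modelE, modelF, modelK, if_neg hi, Pi.add_apply, Pi.neg_apply, rootShift_apply,
      qint, qnum]
    simp [sub_eq_add_neg, qpow_add, qpow_neg]
    have h3 : qpow ħ 1 ^ 2 - 1 ≠ 0 := by
      intro h
      apply hD
      field_simp
      simpa using h
    simp only [← sub_eq_add_neg]
    field_simp
    ring

theorem lift_modelGen_qcomm (κ b a : ℂ) (x y : FreeAlgebra ℂ (Gen n)) :
    FreeAlgebra.lift ℂ (modelGen ħ n κ b) (qcomm a x y) =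
      qcomm a (FreeAlgebra.lift ℂ (modelGen ħ n κ b) x)
        (FreeAlgebra.lift ℂ (modelGen ħ n κ b) y) := by
  simp [qcomm]

theorem modelGen_rel (hq : NotRootOfUnity ħ) {b : ℂ} (hb : b * b = -qpow ħ (-1))
    {x y : FreeAlgebra ℂ (Gen n)} (h : Rel n ħ x y) :
    FreeAlgebra.lift ℂ (modelGen ħ n (modelConst ħ b) b) x =
      FreeAlgebra.lift ℂ (modelGen ħ n (modelConst ħ b) b) y := by
  have hb0 : b ≠ 0 := by
    rintro rfl
    simp [qpow_ne_zero] at hb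
  cases h <;> simp only [map_mul, map_one, map_smul, map_sub, map_zero, lift_modelGen_qcomm,
    FreeAlgebra.lift_ι_apply, modelGen]
  case k_kinv i =>
    rw [shiftOp_mul, add_zero, shiftOp_eq_one]
    exact fun m => by simp [modelK_ne_zero hb0]
  case kinv_k i =>
    rw [shiftOp_mul, add_zero, shiftOp_eq_one]
    exact fun m => by simp [modelK_ne_zero hb0]
  case k_k i j => exact shiftOp_comm fun m => by simp [mul_comm]
  case k_e i j =>
    rw [shiftOp_mul, shiftOp_mul, smul_shiftOp, add_comm]
    congr 1
    funext m
    simp only [modelK_sub_rootShift, Pi.smul_apply, smul_eq_mul, add_zero]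
    ring
  case k_f i j =>
    rw [shiftOp_mul, shiftOp_mul, smul_shiftOp, add_comm]
    congr 1
    funext m
    simp only [modelK_add_rootShift, Pi.smul_apply, smul_eq_mul, add_zero]
    ring
  case e_f_same i =>
    rw [shiftOp_mul, shiftOp_mul, neg_add_cancel, add_neg_cancel, shiftOp_sub, shiftOp_sub,
      smul_shiftOp]
    congr 1
    exact funext fun m => modelE_modelF_self hq hb i m
  case e_f_ne i j hij =>
    rw [sub_eq_zero]
    exact shiftOp_comm (modelE_modelF _ fun h => hij (Fin.ext h))
  case serre_e i j hi hij => exact qcomm_qcomm_shiftOp (modelE_hat _ i j hij)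
  case serre_f i j hi hij => exact qcomm_qcomm_shiftOp (modelF_hat i j hij)
  case serre_e_far i j hij h =>
    rw [qcomm, one_smul, sub_eq_zero]
    exact shiftOp_comm (modelE_comm _ h)
  case serre_f_far i j hij h =>
    rw [qcomm, one_smul, sub_eq_zero]
    exact shiftOp_comm (modelF_comm h)
  case serre_e_short i j hi hj =>
    rw [qcomm_qcomm_shiftOp (modelE_hat _ i j (Or.inl (by omega))), qcomm, mul_zero, zero_mul,
      smul_zero]
    exact sub_self _
  case serre_f_short i j hi hj =>
    rw [qcomm_qcomm_shiftOp (modelF_hat i j (Or.inl (by omega))), qcomm, mul_zero, zero_mul,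
      smul_zero]
    exact sub_self _

/-- The representation of `U_q(𝔤)` in the polynomial model. -/
def modelRep (n : ℕ) (hq : NotRootOfUnity ħ) {b : ℂ} (hb : b * b = -qpow ħ (-1)) :
    Uq n ħ →ₐ[ℂ] Module.End ℂ ((ℕ → ℤ) →₀ ℂ) :=
  RingQuot.liftAlgHom ℂ
    ⟨FreeAlgebra.lift ℂ (modelGen ħ n (modelConst ħ b) b), fun _ _ h => modelGen_rel hq hb h⟩

theorem modelRep_mk (hq : NotRootOfUnity ħ) {b : ℂ} (hb : b * b = -qpow ħ (-1)) (g : Gen n) :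
    modelRep n hq hb (Uq.mk n ħ (gen g)) = modelGen ħ n (modelConst ħ b) b g :=
  (RingQuot.liftAlgHom_mkAlgHom_apply _ _ _ _).trans (FreeAlgebra.lift_ι_apply _ _)

/-- The polynomial model of the base module. -/
def Model (_ : ℕ) {ħ : ℂ} (_ : NotRootOfUnity ħ) {b : ℂ} (_ : b * b = -qpow ħ (-1)) : Type :=
  (ℕ → ℤ) →₀ ℂ

end Model

namespace Model

variable {n : ℕ} {ħ : ℂ} {hq : NotRootOfUnity ħ} {b : ℂ} {hb : b * b = -qpow ħ (-1)}

instance : AddCommGroup (Model n hq hb) := inferInstanceAs (AddCommGroup ((ℕ → ℤ) →₀ ℂ))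

instance : Module ℂ (Model n hq hb) := inferInstanceAs (Module ℂ ((ℕ → ℤ) →₀ ℂ))

instance : Module (Uq n ħ) (Model n hq hb) :=
  Module.compHom ((ℕ → ℤ) →₀ ℂ) (modelRep n hq hb).toRingHom

theorem smul_def (a : Uq n ħ) (u : Model n hq hb) : a • u = modelRep n hq hb a u := rfl

instance : IsScalarTower ℂ (Uq n ħ) (Model n hq hb) where
  smul_assoc c a u := by
    rw [smul_def, map_smul]
    rfl

/-- The monomials. -/
def basis : Module.Basis (ℕ → ℤ) ℂ (Model n hq hb) := Finsupp.basisSingleOne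

theorem basis_eq (m : ℕ → ℤ) :
    (basis m : Model n hq hb) = (Finsupp.single m 1 : (ℕ → ℤ) →₀ ℂ) := by
  simp [basis]
  rfl

theorem E_smul_basis (i : Fin n) (m : ℕ → ℤ) :
    Uq.E ħ i • (basis m : Model n hq hb) =
      modelE ħ (modelConst ħ b) i m • basis (m - rootShift i) := by
  rw [smul_def, Uq.E, modelRep_mk, basis_eq, basis_eq, sub_eq_add_neg]
  exact shiftOp_single _ _ _

theorem F_smul_basis (i : Fin n) (m : ℕ → ℤ) :
    Uq.F ħ i • (basis m : Model n hq hb) = modelF ħ i m • basis (m + rootShift i) := by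
  rw [smul_def, Uq.F, modelRep_mk, basis_eq, basis_eq]
  exact shiftOp_single _ _ _

theorem K_smul_basis (i : Fin n) (m : ℕ → ℤ) :
    Uq.K ħ i • (basis m : Model n hq hb) = modelK ħ b i m • basis m := by
  rw [smul_def, Uq.K, modelRep_mk, basis_eq]
  refine (shiftOp_single _ _ _).trans ?_
  rw [add_zero]
  rfl

end Model

/-! ### Weight vectors, highest weight modules and maps from Verma modules. -/

section WeightVectors

variable {n : ℕ} {ħ : ℂ} {W : Type*} [AddCommGroup W] [Module ℂ W] [Module (Uq n ħ) W]
  [IsScalarTower ℂ (Uq n ħ) W]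

theorem Uq.smul_mem_of_forall {S : Submodule ℂ W} (hE : ∀ i : Fin n, ∀ w ∈ S, Uq.E ħ i • w ∈ S)
    (hF : ∀ i : Fin n, ∀ w ∈ S, Uq.F ħ i • w ∈ S) (hK : ∀ i : Fin n, ∀ w ∈ S, Uq.K ħ i • w ∈ S)
    (hK' : ∀ i : Fin n, ∀ w ∈ S, Uq.Kinv ħ i • w ∈ S) (a : Uq n ħ) : ∀ w ∈ S, a • w ∈ S := by
  obtain ⟨a, rfl⟩ : ∃ x, Uq.mk n ħ x = a := RingQuot.mkAlgHom_surjective ℂ (Rel n ħ) a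
  induction a using FreeAlgebra.induction with
  | grade0 c =>
    intro w hw
    rw [AlgHom.commutes, algebraMap_smul]
    exact S.smul_mem c hw
  | grade1 g =>
    cases g with
    | e i => exact hE i
    | f i => exact hF i
    | k i => exact hK i
    | kinv i => exact hK' i
  | mul x y hx hy =>
    intro w hw
    rw [map_mul, mul_smul]
    exact hx _ (hy w hw)
  | add x y hx hy =>
    intro w hw
    rw [map_add, add_smul]
    exact S.add_mem (hx w hw) (hy w hw)

theorem Kinv_smul_of_mem_weightSpace {μ : Weight n} {w : W} (hw : w ∈ weightSpace ħ W μ)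
    (i : Fin n) : Uq.Kinv ħ i • w = qpow ħ (-(μ ⬝ᵥ simpleRoot i)) • w := by
  have h := congrArg (fun u => qpow ħ (-(μ ⬝ᵥ simpleRoot i)) • Uq.Kinv ħ i • u) (hw i)
  simp only [smul_comm (Uq.Kinv ħ i), smul_smul, qpow_neg_mul, one_smul, Uq.Kinv_mul_K] at h
  exact h.symm

theorem F_smul_mem_weightSpace {μ : Weight n} {w : W} (hw : w ∈ weightSpace ħ W μ) (j : Fin n) :
    Uq.F ħ j • w ∈ weightSpace ħ W (μ - simpleRoot j) := fun i => by
  rw [smul_smul, Uq.K_mul_F, smul_assoc, mul_smul, hw i, smul_comm (Uq.F ħ j), smul_smul,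
    ← qpow_add, sub_dotProduct, sub_eq_neg_add, dotProduct_comm (simpleRoot j)]

theorem E_smul_mem_weightSpace {μ : Weight n} {w : W} (hw : w ∈ weightSpace ħ W μ) (j : Fin n) :
    Uq.E ħ j • w ∈ weightSpace ħ W (μ + simpleRoot j) := fun i => by
  rw [smul_smul, Uq.K_mul_E, smul_assoc, mul_smul, hw i, smul_comm (Uq.E ħ j), smul_smul,
    ← qpow_add, add_dotProduct, add_comm, dotProduct_comm (simpleRoot j)]

theorem E_F_smul_same {μ : Weight n} {w : W} (hw : w ∈ weightSpace ħ W μ) (i : Fin n) :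
    Uq.E ħ i • Uq.F ħ i • w =
      Uq.F ħ i • Uq.E ħ i • w + qnum ħ (μ ⬝ᵥ simpleRoot i) • w := by
  have h := congrArg (· • w) (Uq.E_F_same (ħ := ħ) i)
  simp only [sub_smul, mul_smul, smul_assoc, hw i, Kinv_smul_of_mem_weightSpace hw] at h
  rw [sub_eq_iff_eq_add'] at h
  rw [h, qnum, div_eq_inv_mul, mul_smul, sub_smul]

theorem E_F_smul_of_ne {W : Type*} [AddCommGroup W] [Module (Uq n ħ) W] {i j : Fin n}
    (hij : i ≠ j) (w : W) :
    Uq.E ħ i • Uq.F ħ j • w = Uq.F ħ j • Uq.E ħ i • w := by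
  rw [smul_smul, sub_eq_zero.mp (Uq.E_F_ne i j hij), mul_smul]

/-- The vectors `f_{α_i} f_{α_j} ⋯ z`. -/
inductive FWord (n : ℕ) (ħ : ℂ) {W : Type*} [AddCommGroup W] [Module (Uq n ħ) W] (z : W) : W → Prop
  | one : FWord n ħ z z
  | smul (i : Fin n) (w : W) (hw : FWord n ħ z w) : FWord n ħ z (Uq.F ħ i • w)

/-- A substitute for the triangular decomposition: the span of the words in the `f_i` is stable
under the `f_i` and, by commuting `e_i` to the right, under all generators. -/
theorem eq_top_of_F_smul_mem {z : W} {μ : Weight n} (hE : ∀ i : Fin n, Uq.E ħ i • z = 0)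
    (hz : z ∈ weightSpace ħ W μ) (htop : ∀ w : W, ∃ a : Uq n ħ, w = a • z)
    {S : Submodule ℂ W} (hzS : z ∈ S) (hF : ∀ i : Fin n, ∀ w ∈ S, Uq.F ħ i • w ∈ S) : S = ⊤ := by
  have hwt : ∀ w, FWord n ħ z w → ∃ ν : Weight n, w ∈ weightSpace ħ W ν := fun w hw => by
    induction hw with
    | one => exact ⟨μ, hz⟩
    | smul i w _ ih => exact ih.elim fun ν hν => ⟨_, F_smul_mem_weightSpace hν i⟩
  set T : Submodule ℂ W := Submodule.span ℂ {w | FWord n ħ z w}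
  have hTF : ∀ i : Fin n, ∀ w ∈ T, Uq.F ħ i • w ∈ T := fun i w hw => by
    induction hw using Submodule.span_induction with
    | mem w hw => exact Submodule.subset_span (FWord.smul i w hw)
    | zero => simp
    | add x y _ _ hx hy => rw [smul_add]; exact T.add_mem hx hy
    | smul c x _ hx => rw [smul_comm]; exact T.smul_mem c hx
  have hEw : ∀ w, FWord n ħ z w → ∀ i : Fin n, Uq.E ħ i • w ∈ T := fun w hw => by
    induction hw with
    | one => exact fun i => by simp [hE]
    | smul j w hw ih =>
      intro i
      rcases eq_or_ne i j with rfl | hij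
      · obtain ⟨ν, hν⟩ := hwt w hw
        rw [E_F_smul_same hν]
        exact T.add_mem (hTF _ _ (ih i)) (T.smul_mem _ (Submodule.subset_span hw))
      · rw [E_F_smul_of_ne hij]
        exact hTF _ _ (ih i)
  have hext : ∀ a : Uq n ħ, (∀ w, FWord n ħ z w → a • w ∈ T) → ∀ w ∈ T, a • w ∈ T :=
    fun a ha w hw => by
      induction hw using Submodule.span_induction with
      | mem w hw => exact ha w hw
      | zero => simp
      | add x y _ _ hx hy => rw [smul_add]; exact T.add_mem hx hy
      | smul c x _ hx => rw [smul_comm]; exact T.smul_mem c hx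
  have hT : T = ⊤ := by
    refine Submodule.eq_top_iff'.mpr fun w => ?_
    obtain ⟨a, rfl⟩ := htop w
    refine Uq.smul_mem_of_forall (fun i => hext _ fun w hw => hEw w hw i) hTF
      (fun i => hext _ fun w hw => ?_) (fun i => hext _ fun w hw => ?_) a z
      (Submodule.subset_span FWord.one)
    · obtain ⟨ν, hν⟩ := hwt w hw
      rw [hν i]
      exact T.smul_mem _ (Submodule.subset_span hw)
    · obtain ⟨ν, hν⟩ := hwt w hw
      rw [Kinv_smul_of_mem_weightSpace hν i]
      exact T.smul_mem _ (Submodule.subset_span hw)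
  rw [eq_top_iff, ← hT, Submodule.span_le]
  intro w hw
  induction hw with
  | one => exact hzS
  | smul i w _ ih => exact hF i w ih

theorem Verma.exists_lift {μ : Weight n} {w : W} (hw : IsSingular n ħ w)
    (hμ : w ∈ weightSpace ħ W μ) :
    ∃ ψ : Verma ħ μ →ₗ[Uq n ħ] W, ψ (Verma.one ħ μ) = w := by
  refine ⟨Submodule.liftQ _ (LinearMap.toSpanSingleton (Uq n ħ) W w) ?_, ?_⟩
  · rw [Submodule.span_le]
    rintro _ (⟨i, rfl⟩ | ⟨i, rfl⟩)
    · simpa using hw i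
    · simp [sub_smul, hμ i]
  · simp [Verma.one]

theorem Verma.E_smul_one (μ : Weight n) (i : Fin n) : Uq.E ħ i • Verma.one ħ μ = 0 := by
  rw [Verma.one, ← Submodule.Quotient.mk_smul, Submodule.Quotient.mk_eq_zero, smul_eq_mul, mul_one]
  exact Submodule.subset_span (Or.inl ⟨i, rfl⟩)

theorem Verma.one_mem_weightSpace (μ : Weight n) :
    Verma.one ħ μ ∈ weightSpace ħ (Verma ħ μ) μ := fun i => by
  rw [← algebraMap_smul (Uq n ħ) (qpow _ _), ← sub_eq_zero, ← sub_smul, Verma.one,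
    ← Submodule.Quotient.mk_smul, Submodule.Quotient.mk_eq_zero, smul_eq_mul, mul_one]
  exact Submodule.subset_span (Or.inr ⟨i, rfl⟩)

theorem BaseModule.E_smul_one (lam : Weight n) (i : Fin n) :
    Uq.E ħ i • BaseModule.one ħ lam = 0 := by
  rw [BaseModule.one, ← Submodule.Quotient.mk_smul, Verma.E_smul_one, Submodule.Quotient.mk_zero]

theorem BaseModule.F_smul_one (lam : Weight n) (i : Fin n) (hi : 0 < i.val) :
    Uq.F ħ i • BaseModule.one ħ lam = 0 := by
  rw [BaseModule.one, ← Submodule.Quotient.mk_smul, Submodule.Quotient.mk_eq_zero]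
  exact Submodule.subset_span (Or.inl ⟨i, hi, rfl⟩)

theorem BaseModule.fHat_smul_one (lam : Weight n) (i j : Fin n) (hi : i.val = 0) (hj : j.val = 1) :
    fHat ħ i j • BaseModule.one ħ lam = 0 := by
  rw [BaseModule.one, ← Submodule.Quotient.mk_smul, Submodule.Quotient.mk_eq_zero]
  exact Submodule.subset_span (Or.inr ⟨i, j, hi, hj, rfl⟩)

theorem BaseModule.one_mem_weightSpace (lam : Weight n) :
    BaseModule.one ħ lam ∈ weightSpace ħ (BaseModule ħ lam) lam := fun i => by
  rw [BaseModule.one, ← Submodule.Quotient.mk_smul, Verma.one_mem_weightSpace lam i]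
  rfl

theorem BaseModule.exists_smul_one (lam : Weight n) (w : BaseModule ħ lam) :
    ∃ a : Uq n ħ, w = a • BaseModule.one ħ lam := by
  obtain ⟨w, rfl⟩ := Submodule.Quotient.mk_surjective _ w
  obtain ⟨a, rfl⟩ := Submodule.Quotient.mk_surjective _ w
  refine ⟨a, ?_⟩
  rw [BaseModule.one, Verma.one, ← Submodule.Quotient.mk_smul, ← Submodule.Quotient.mk_smul,
    smul_eq_mul, mul_one]

end WeightVectors

/-! ### The monomial basis of the base module. -/

section BaseModuleBasis

variable {n : ℕ} {ħ : ℂ}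

/-- The weight `m₁ ε₁ + ⋯ + mₙ εₙ`. -/
def expWeight (m : Fin n → ℕ) : Weight n := fun i => m i

theorem expWeight_add_single (m : Fin n → ℕ) (i : Fin n) :
    expWeight (m + Pi.single i 1) = expWeight m + eps i := by
  funext l
  rcases eq_or_ne l i with rfl | h
  · simp [expWeight, eps]
  · simp [expWeight, eps, h]

theorem simpleRoot_first {i : Fin n} (hi : i.val = 0) : simpleRoot i = eps i := by
  simp [simpleRoot, hi]

theorem simpleRoot_succ {i j : Fin n} (hij : i.val + 1 = j.val) :
    simpleRoot j = eps j - eps i := by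
  have h : j.val ≠ 0 := by omega
  have h2 : (⟨j.val - 1, by omega⟩ : Fin n) = i := Fin.ext (by simp; omega)
  rw [simpleRoot, if_neg h, h2]

theorem IsMonomialFamily.mem_weightSpace {W : Type*} [AddCommGroup W] [Module ℂ W]
    [Module (Uq n ħ) W] [IsScalarTower ℂ (Uq n ħ) W] {t : Fin n → Module.End ℂ W}
    {y : (Fin n → ℕ) → W} (hy : IsMonomialFamily ħ t y) (hq : NotRootOfUnity ħ) {s : ℂ}
    (ht : ∀ (i : Fin n) (μ : Weight n), ∀ w ∈ weightSpace ħ W μ,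
      t i w ∈ weightSpace ħ W (μ + s • simpleRoot i))
    {μ : Weight n} (h0 : y 0 ∈ weightSpace ħ W μ) (m : Fin n → ℕ) :
    y m ∈ weightSpace ħ W (μ + s • expWeight m) := by
  induction m using exponent_induction with
  | h0 =>
    convert h0
    simp [expWeight, funext_iff]
  | h1 i hi m ih =>
    rw [← hy.apply_first i hi, expWeight_add_single, smul_add, ← add_assoc, ← simpleRoot_first hi]
    exact ht i _ _ ih
  | h2 i j hij m ih =>
    have h := ht j _ _ ih
    rw [hy.apply_add i j hij] at h
    rw [← Submodule.smul_mem_iff _ (hq.qnum_succ_ne_zero (m i))]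
    convert h using 2
    rw [expWeight_add_single, expWeight_add_single, simpleRoot_succ hij]
    module

theorem IsMonomialFamily.span_apply_mem {W : Type*} [AddCommGroup W] [Module ℂ W]
    {t : Fin n → Module.End ℂ W} {y : (Fin n → ℕ) → W} (hy : IsMonomialFamily ħ t y) (i : Fin n)
    {w : W} (hw : w ∈ Submodule.span ℂ (Set.range y)) :
    t i w ∈ Submodule.span ℂ (Set.range y) := by
  have hmem : ∀ m, y m ∈ Submodule.span ℂ (Set.range y) := fun m => Submodule.subset_span ⟨m, rfl⟩
  induction hw using Submodule.span_induction with
  | mem w hw =>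
    obtain ⟨m, rfl⟩ := hw
    by_cases hi : i.val = 0
    · rw [hy.apply_first i hi]
      exact hmem _
    · have hij : (⟨i.val - 1, by omega⟩ : Fin n).val + 1 = i.val := by simp; omega
      by_cases hm : m ⟨i.val - 1, by omega⟩ = 0
      · rw [hy.apply_of_eq_zero _ i hij m hm]
        exact Submodule.zero_mem _
      · obtain ⟨m', rfl⟩ := exponent_eq_add_single hm
        rw [hy.apply_add _ i hij]
        exact Submodule.smul_mem _ _ (hmem _)
  | zero => simp
  | add x y _ _ hx hy => rw [map_add]; exact Submodule.add_mem _ hx hy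
  | smul c x _ hx => rw [map_smul]; exact Submodule.smul_mem _ c hx

/-- The exponents in the polynomial model. -/
def modelExp (m : Fin n → ℕ) : ℕ → ℤ :=
  ∑ i : Fin n, (m i : ℤ) • (Pi.single (i.val + 1) 1 - Pi.single 0 1 : ℕ → ℤ)

theorem modelExp_add_single (m : Fin n → ℕ) (j : Fin n) :
    modelExp (m + Pi.single j 1) =
      modelExp m + (Pi.single (j.val + 1) 1 - Pi.single 0 1 : ℕ → ℤ) := by
  simp only [modelExp, Pi.add_apply, Nat.cast_add, add_smul, Finset.sum_add_distrib]
  congr 1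
  rw [Finset.sum_eq_single j (fun i _ hi => by simp [hi]) (by simp)]
  simp

theorem modelExp_apply (m : Fin n → ℕ) (i : Fin n) : modelExp m (i.val + 1) = m i := by
  simp only [modelExp, Finset.sum_apply]
  rw [Finset.sum_eq_single i]
  · simp
  · intro j _ hj
    have : i.val ≠ j.val := fun h => hj (Fin.ext h.symm)
    simp [this]
  · simp

theorem modelExp_injective : Function.Injective (modelExp (n := n)) := fun m m' h =>
  funext fun i => by
    have := congrFun h (i.val + 1)
    rw [modelExp_apply, modelExp_apply] at this
    exact_mod_cast this

/-- Only the rules for the `f_i` are used, so the image of the family in the model is determined by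
the image of the highest vector; all structure constants agree. -/
theorem IsMonomialFamily.eq_model_basis {hq : NotRootOfUnity ħ} {b : ℂ} {hb : b * b = -qpow ħ (-1)}
    {y : (Fin n → ℕ) → Model n hq hb}
    (hy : IsMonomialFamily ħ (fun i => Algebra.lsmul ℂ ℂ _ (Uq.F ħ i)) y)
    (h0 : y 0 = Model.basis 0) (m : Fin n → ℕ) : y m = Model.basis (modelExp m) := by
  induction m using exponent_induction with
  | h0 => simpa [modelExp] using h0
  | h1 i hi m ih =>
    have h : Uq.F ħ i • y m = y (m + Pi.single i 1) := hy.apply_first i hi m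
    rw [← h, ih, Model.F_smul_basis, modelExp_add_single,
      modelF, if_pos hi, one_smul]
    simp [rootShift, hi]
  | h2 i j hij m ih =>
    have h : Uq.F ħ j • y (m + Pi.single i 1) = qnum ħ (m i + 1) • y (m + Pi.single j 1) :=
      hy.apply_add i j hij m
    rw [ih, Model.F_smul_basis, modelF, if_neg (by omega), ← hij,
      modelExp_apply, modelExp_add_single, rootShift] at h
    have h2 : qint ħ (((m + Pi.single i 1 : Fin n → ℕ) i : ℕ) : ℤ) = qnum ħ (m i + 1) := by
      simp [qint]
    rw [h2] at h
    rw [← smul_right_injective _ (hq.qnum_succ_ne_zero (m i)) h, modelExp_add_single, hij]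
    congr 1
    abel

/-- A basis of monomials in the base module, with the action of the generators `e_α`. -/
structure BaseBasis (ħ : ℂ) (lam : Weight n) (κ : ℂ) where
  basis : Module.Basis (Fin n → ℕ) ℂ (BaseModule ħ lam)
  basis_zero : basis 0 = BaseModule.one ħ lam
  mem_weightSpace : ∀ m, basis m ∈ weightSpace ħ (BaseModule ħ lam) (lam - expWeight m)
  E_of_eq_zero : ∀ (i : Fin n) (m : Fin n → ℕ), m i = 0 → Uq.E ħ i • basis m = 0
  E_first : ∀ i : Fin n, i.val = 0 → ∀ m : Fin n → ℕ,
    Uq.E ħ i • basis (m + Pi.single i 1) = (κ * qnum ħ (m i + 1)) • basis m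
  E_add : ∀ i j : Fin n, i.val + 1 = j.val → ∀ m : Fin n → ℕ,
    Uq.E ħ j • basis (m + Pi.single j 1) = qnum ħ (m j + 1) • basis (m + Pi.single i 1)

theorem IsBaseWeight.mul_self {lam : Weight n} (hlam : IsBaseWeight ħ lam) (i : Fin n) :
    qpow ħ (lam ⬝ᵥ eps i) * qpow ħ (lam ⬝ᵥ eps i) = -qpow ħ (-1) := by
  rw [← qpow_add, ← two_mul, hlam.1 i]

theorem fHat_smul {W : Type*} [AddCommGroup W] [Module ℂ W] [Module (Uq n ħ) W]
    [IsScalarTower ℂ (Uq n ħ) W] (i j : Fin n) (w : W) : fHat ħ i j • w =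
      Uq.F ħ i • Uq.F ħ i • Uq.F ħ j • w -
        (qpow ħ 1 + qpow ħ (-1)) • Uq.F ħ i • Uq.F ħ j • Uq.F ħ i • w +
        Uq.F ħ j • Uq.F ħ i • Uq.F ħ i • w :=
  qcomm_qcomm_smul _ _ _

theorem Model.fHat_smul_basis {hq : NotRootOfUnity ħ} {b : ℂ} {hb : b * b = -qpow ħ (-1)}
    {i j : Fin n} (hij : i.val + 1 = j.val) (m : ℕ → ℤ) :
    fHat ħ i j • (Model.basis m : Model n hq hb) = 0 := by
  have h := modelF_hat (ħ := ħ) i j (Or.inl hij) m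
  rw [fHat_smul]
  simp only [Model.F_smul_basis, smul_comm (Uq.F ħ _ : Uq n ħ) (_ : ℂ)]
  rw [show m + rootShift i + rootShift j + rootShift i =
    m + rootShift j + rootShift i + rootShift i by abel,
    show m + rootShift i + rootShift i + rootShift j =
    m + rootShift j + rootShift i + rootShift i by abel]
  match_scalars
  linear_combination h

/-- The monomial of exponent zero is singular of weight `λ`, and `f_i` for `i ≥ 2` and `f̂_δ` kill
it, so the map from the Verma module descends. -/
theorem BaseModule.exists_toModel (hq : NotRootOfUnity ħ) {lam : Weight n}
    (hlam : IsBaseWeight ħ lam) {i₀ : Fin n} (hi₀ : i₀.val = 0) :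
    ∃ π : BaseModule ħ lam →ₗ[Uq n ħ] Model n hq (hlam.mul_self i₀),
      π (BaseModule.one ħ lam) = Model.basis 0 := by
  have hs : IsSingular n ħ (Model.basis 0 : Model n hq (hlam.mul_self i₀)) := fun i => by
    rw [Model.E_smul_basis]
    simp [modelE, qint]
  have hw : (Model.basis 0 : Model n hq (hlam.mul_self i₀)) ∈
      weightSpace ħ (Model n hq (hlam.mul_self i₀)) lam := fun i => by
    rw [Model.K_smul_basis, modelK]
    by_cases hi : i.val = 0
    · obtain rfl : i = i₀ := Fin.ext (by omega)
      simp [hi, qpow_zero, simpleRoot_first hi]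
    · have hl : lam ⬝ᵥ simpleRoot i = 0 := by rw [dotProduct_comm, hlam.2 i (by omega)]
      rw [if_neg hi, hl]
      simp
  obtain ⟨ψ, hψ⟩ := Verma.exists_lift hs hw
  refine ⟨Submodule.liftQ _ ψ ?_, ?_⟩
  · rw [baseSubmodule, Submodule.span_le]
    rintro _ (⟨i, hi, rfl⟩ | ⟨i, j, hi, hj, rfl⟩)
    · simp only [SetLike.mem_coe, LinearMap.mem_ker, map_smul, hψ, Model.F_smul_basis]
      simp [modelF, hi.ne', qint]
    · rw [SetLike.mem_coe, LinearMap.mem_ker, map_smul, hψ,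
        Model.fHat_smul_basis (by omega : i.val + 1 = j.val)]
  · rw [BaseModule.one, Submodule.liftQ_apply, hψ]

theorem modelConst_ne_zero (hq : NotRootOfUnity ħ) {b : ℂ} (hb : b ≠ 0) : modelConst ħ b ≠ 0 := by
  refine div_ne_zero hb (sub_ne_zero.mpr fun h => ?_)
  refine hq.qpow_ne_one (k := -1) (by omega) ?_
  push_cast
  exact h.symm

/-- The family spans since its span is stable under the `f_i`, and it is independent since its
images are distinct monomials. Hence the map to the model is injective, and the formulas for `e_i`
are pulled back along it. -/
theorem exists_baseBasis (hq : NotRootOfUnity ħ) {lam : Weight n} (hlam : IsBaseWeight ħ lam)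
    {i₀ : Fin n} (hi₀ : i₀.val = 0) :
    Nonempty (BaseBasis ħ lam (modelConst ħ (qpow ħ (lam ⬝ᵥ eps i₀)))) := by
  obtain ⟨y, hy0, hy⟩ := serreRelations_F.exists_monomialFamily hq (BaseModule.F_smul_one lam)
    (BaseModule.fHat_smul_one (ħ := ħ) lam)
  obtain ⟨π, hπ⟩ := BaseModule.exists_toModel hq hlam hi₀
  set πℂ := π.restrictScalars ℂ
  have hπy : ∀ m, πℂ (y m) = Model.basis (modelExp m) := by
    refine IsMonomialFamily.eq_model_basis (y := fun m => πℂ (y m)) ⟨?_, ?_, ?_⟩ ?_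
    · intro i hi m
      rw [← hy.apply_first i hi]
      exact (map_smul π _ _).symm
    · intro i j hij m
      rw [← map_smul, ← hy.apply_add i j hij]
      exact (map_smul π _ _).symm
    · intro i j hij m hm
      rw [← map_zero πℂ, ← hy.apply_of_eq_zero i j hij m hm]
      exact (map_smul π _ _).symm
    · rw [hy0]
      exact hπ
  have hli' : LinearIndependent ℂ (πℂ ∘ y) := by
    rw [show πℂ ∘ y = Model.basis ∘ modelExp from funext hπy]
    exact Model.basis.linearIndependent.comp _ modelExp_injective
  have hspan : Submodule.span ℂ (Set.range y) = ⊤ :=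
    eq_top_of_F_smul_mem (BaseModule.E_smul_one lam) (BaseModule.one_mem_weightSpace lam)
      (BaseModule.exists_smul_one lam) (Submodule.subset_span ⟨0, hy0⟩)
      fun i w hw => hy.span_apply_mem i hw
  set B := Module.Basis.mk hli'.of_comp hspan.ge
  have hB : ∀ m, B m = y m := Module.Basis.mk_apply _ _
  have hinj : Function.Injective πℂ := by
    rw [← LinearMap.ker_eq_bot, LinearMap.ker_eq_bot']
    intro w hw
    rw [← B.linearCombination_repr w, Finsupp.apply_linearCombination,
      show πℂ ∘ B = πℂ ∘ y from funext fun m => congrArg πℂ (hB m)] at hw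
    exact B.repr.map_eq_zero_iff.mp (linearIndependent_iff.mp hli' _ hw)
  have hE : ∀ (i : Fin n) m, πℂ (Uq.E ħ i • y m) = _ := fun i m =>
    ((map_smul π _ _).trans (congrArg (Uq.E ħ i • ·) (hπy m))).trans (Model.E_smul_basis _ _)
  refine ⟨B, by rw [hB, hy0], fun m => ?_, fun i m hm => ?_, fun i hi m => ?_, fun i j hij m => ?_⟩
  · rw [hB, sub_eq_add_neg, ← neg_one_smul ℂ]
    refine hy.mem_weightSpace hq (fun i μ w hw => ?_) ?_ m
    · rw [neg_one_smul, ← sub_eq_add_neg]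
      exact F_smul_mem_weightSpace hw i
    · rw [hy0]
      exact BaseModule.one_mem_weightSpace lam
  · rw [hB]
    apply hinj
    rw [hE, modelE, modelExp_apply, hm]
    simp [qint]
  · rw [hB, hB]
    apply hinj
    rw [hE, modelE, modelExp_apply, map_smul, hπy, modelExp_add_single, rootShift, hi]
    simp [qint]
  · rw [hB, hB]
    apply hinj
    rw [hE, modelE, modelExp_apply, map_smul, hπy, modelExp_add_single, modelExp_add_single,
      rootShift, if_neg (by omega), one_mul, hij]
    congr 2
    · simp [qint]
    · abel

end BaseModuleBasis

/-! ### The action on pure tensors. -/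

namespace QTensor

variable {n : ℕ} {ħ : ℂ} {V W : Type*} [AddCommGroup V] [Module ℂ V] [AddCommGroup W] [Module ℂ W]

/-- Pure tensors. -/
def tmul (v : V) (w : W) : QTensor V W := (equiv V W).symm (v ⊗ₜ w)

theorem induction_on {P : QTensor V W → Prop} (u : QTensor V W) (h0 : P 0)
    (htmul : ∀ v w, P (tmul v w)) (hadd : ∀ u u', P u → P u' → P (u + u')) : P u :=
  TensorProduct.induction_on (motive := P) u h0 htmul hadd

variable [Module (Uq n ħ) V] [IsScalarTower ℂ (Uq n ħ) V]
  [Module (Uq n ħ) W] [IsScalarTower ℂ (Uq n ħ) W]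

theorem rep_mk (g : Gen n) : rep n ħ V W (Uq.mk n ħ (gen g)) =
    Module.endTensorEndAlgHom (R := ℂ) (A := ℂ) (S := ℂ) (M := V) (N := W)
      (Algebra.TensorProduct.map (Algebra.lsmul ℂ ℂ V) (Algebra.lsmul ℂ ℂ W)
        (Uq.comulGen n ħ g)) := by
  have h : Uq.comul n ħ (Uq.mk n ħ (gen g)) = Uq.comulGen n ħ g :=
    (RingQuot.liftAlgHom_mkAlgHom_apply _ _ _ _).trans (FreeAlgebra.lift_ι_apply _ _)
  rw [rep, AlgHom.comp_apply, h, AlgHom.comp_apply]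

theorem E_smul_tmul (i : Fin n) (v : V) (w : W) :
    Uq.E ħ i • tmul v w = tmul (Uq.E ħ i • v) (Uq.K ħ i • w) + tmul v (Uq.E ħ i • w) := by
  apply (equiv V W).injective
  rw [equiv_smul, Uq.E, rep_mk]
  simp [Uq.comulGen, tmul, Module.endTensorEndAlgHom_apply, Uq.E]

theorem K_smul_tmul (i : Fin n) (v : V) (w : W) :
    Uq.K ħ i • tmul v w = tmul (Uq.K ħ i • v) (Uq.K ħ i • w) := by
  apply (equiv V W).injective
  rw [equiv_smul, Uq.K, rep_mk]
  simp [Uq.comulGen, tmul, Module.endTensorEndAlgHom_apply, Uq.K]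

end QTensor

/-! ### Coefficients of tensors in the monomial basis; uniqueness of the singular vector. -/

namespace BaseBasis

variable {n : ℕ} {ħ : ℂ} {lam : Weight n} {κ : ℂ} (B : BaseBasis ħ lam κ)

theorem coord_basis (m l : Fin n → ℕ) : B.basis.coord m (B.basis l) = if l = m then 1 else 0 := by
  rw [Module.Basis.coord_apply, Module.Basis.repr_self, Finsupp.single_apply]

theorem coord_K (m : Fin n → ℕ) (i : Fin n) (w : BaseModule ħ lam) :
    B.basis.coord m (Uq.K ħ i • w) =
      qpow ħ ((lam - expWeight m) ⬝ᵥ simpleRoot i) * B.basis.coord m w := by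
  refine LinearMap.congr_fun (f := B.basis.coord m ∘ₗ Algebra.lsmul ℂ ℂ _ (Uq.K ħ i))
    (g := qpow ħ ((lam - expWeight m) ⬝ᵥ simpleRoot i) • B.basis.coord m)
    (B.basis.ext fun l => ?_) w
  change B.basis.coord m (Uq.K ħ i • B.basis l) = _ * B.basis.coord m (B.basis l)
  rw [B.mem_weightSpace l i, map_smul, coord_basis, smul_eq_mul]
  by_cases h : l = m <;> simp [h]

theorem coord_E {i : Fin n} {m m' : Fin n → ℕ} {c : ℂ} (hm : m' i ≠ 0)
    (h : ∀ l : Fin n → ℕ, B.basis.coord m (Uq.E ħ i • B.basis (l + Pi.single i 1)) =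
      c * if l + Pi.single i 1 = m' then 1 else 0) (w : BaseModule ħ lam) :
    B.basis.coord m (Uq.E ħ i • w) = c * B.basis.coord m' w := by
  refine LinearMap.congr_fun (f := B.basis.coord m ∘ₗ Algebra.lsmul ℂ ℂ _ (Uq.E ħ i))
    (g := c • B.basis.coord m') (B.basis.ext fun l => ?_) w
  change B.basis.coord m (Uq.E ħ i • B.basis l) = c * B.basis.coord m' (B.basis l)
  rw [coord_basis]
  by_cases hl : l i = 0
  · rw [B.E_of_eq_zero i l hl, map_zero, if_neg (fun h => hm (by rw [← h]; exact hl)), mul_zero]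
  · obtain ⟨l, rfl⟩ := exponent_eq_add_single hl
    exact h l

theorem coord_E_first {i : Fin n} (hi : i.val = 0) (m : Fin n → ℕ) (w : BaseModule ħ lam) :
    B.basis.coord m (Uq.E ħ i • w) =
      κ * qnum ħ (m i + 1) * B.basis.coord (m + Pi.single i 1) w := by
  refine B.coord_E (by simp) (fun l => ?_) w
  rw [B.E_first i hi, map_smul, coord_basis, smul_eq_mul]
  simp only [add_left_inj]
  by_cases h : l = m <;> simp [h]

theorem coord_E_add {i j : Fin n} (hij : i.val + 1 = j.val) (m : Fin n → ℕ)
    (w : BaseModule ħ lam) : B.basis.coord (m + Pi.single i 1) (Uq.E ħ j • w) =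
      qnum ħ (m j + 1) * B.basis.coord (m + Pi.single j 1) w := by
  refine B.coord_E (by simp) (fun l => ?_) w
  rw [B.E_add i j hij, map_smul, coord_basis, smul_eq_mul]
  simp only [add_left_inj]
  by_cases h : l = m <;> simp [h]

theorem coord_E_of_eq_zero {i j : Fin n} (hij : i.val + 1 = j.val) {m : Fin n → ℕ} (hm : m i = 0)
    (w : BaseModule ħ lam) : B.basis.coord m (Uq.E ħ j • w) = 0 := by
  rw [B.coord_E (m' := Pi.single j 1) (c := 0) (by simp) (fun l => ?_), zero_mul]
  rw [B.E_add i j hij, map_smul, coord_basis, if_neg, smul_zero, zero_mul]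
  rintro rfl
  simp at hm

variable {V : Type*} [AddCommGroup V] [Module ℂ V]

/-- The coefficients of the elements of `V ⊗ M` in the basis of monomials of `M`. -/
def coeff (m : Fin n → ℕ) : QTensor V (BaseModule ħ lam) →ₗ[ℂ] V :=
  (TensorProduct.rid ℂ V).toLinearMap ∘ₗ (B.basis.coord m).lTensor V ∘ₗ
    (QTensor.equiv V (BaseModule ħ lam)).toLinearMap

theorem coeff_tmul (m : Fin n → ℕ) (v : V) (w : BaseModule ħ lam) :
    B.coeff m (QTensor.tmul v w) = B.basis.coord m w • v := by
  simp [coeff, QTensor.tmul]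

theorem coeff_eq_equivFinsupp (m : Fin n → ℕ) (u : QTensor V (BaseModule ħ lam)) :
    B.coeff m u = TensorProduct.equivFinsuppOfBasisRight B.basis
      (QTensor.equiv V (BaseModule ħ lam) u) m := by
  induction u using QTensor.induction_on with
  | h0 => simp
  | htmul v w =>
    rw [coeff_tmul, QTensor.tmul, LinearEquiv.apply_symm_apply,
      TensorProduct.equivFinsuppOfBasisRight_apply_tmul_apply, Module.Basis.coord_apply]
  | hadd x y hx hy => rw [map_add, map_add, map_add, hx, hy, Finsupp.add_apply]

theorem eq_zero_of_coeff {u : QTensor V (BaseModule ħ lam)} (h : ∀ m, B.coeff m u = 0) :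
    u = 0 := by
  apply (QTensor.equiv V (BaseModule ħ lam)).injective
  apply (TensorProduct.equivFinsuppOfBasisRight B.basis).injective
  ext m
  rw [← coeff_eq_equivFinsupp, h]
  simp

/-- The coordinate at `1_λ` is an eigenfunctional of every `q^{h_i}` with the character of `λ`, so
it vanishes on vectors with a different character. -/
theorem coeff_zero_of_mem_lowerTerms {t : V ⊗[ℂ] BaseModule ħ lam} (ht : t ∈ lowerTerms ħ lam V) :
    B.coeff 0 ((QTensor.equiv V (BaseModule ħ lam)).symm t) = 0 := by
  induction ht using Submodule.span_induction with
  | mem t ht =>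
    obtain ⟨μ, v, w, ⟨i, hi⟩, hw, rfl⟩ := ht
    have h := B.coord_K 0 i w
    rw [hw i, map_smul, smul_eq_mul, show expWeight (0 : Fin n → ℕ) = 0 by
      simp [expWeight, funext_iff], sub_zero, ← sub_eq_zero, ← sub_mul] at h
    change B.coeff 0 (QTensor.tmul v w) = 0
    rw [coeff_tmul, (mul_eq_zero.mp h).resolve_left (sub_ne_zero.mpr hi), zero_smul]
  | zero => simp
  | add x y _ _ hx hy => rw [map_add, map_add, hx, hy, add_zero]
  | smul c x _ hx => rw [map_smul, map_smul, hx, smul_zero]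

variable [Module (Uq n ħ) V] [IsScalarTower ℂ (Uq n ħ) V]

theorem coeff_K (m : Fin n → ℕ) (i : Fin n) (u : QTensor V (BaseModule ħ lam)) :
    B.coeff m (Uq.K ħ i • u) =
      qpow ħ ((lam - expWeight m) ⬝ᵥ simpleRoot i) • Uq.K ħ i • B.coeff m u := by
  induction u using QTensor.induction_on with
  | h0 => simp
  | htmul v w =>
    rw [QTensor.K_smul_tmul, coeff_tmul, coeff_tmul, coord_K, mul_smul, smul_comm (Uq.K ħ i)]
  | hadd x y hx hy => simp only [smul_add, map_add, hx, hy]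

theorem coeff_E {i : Fin n} {m m' : Fin n → ℕ} {c : ℂ}
    (h : ∀ w, B.basis.coord m (Uq.E ħ i • w) = c * B.basis.coord m' w)
    (u : QTensor V (BaseModule ħ lam)) :
    B.coeff m (Uq.E ħ i • u) =
      qpow ħ ((lam - expWeight m) ⬝ᵥ simpleRoot i) • Uq.E ħ i • B.coeff m u +
        c • B.coeff m' u := by
  induction u using QTensor.induction_on with
  | h0 => simp
  | htmul v w =>
    rw [QTensor.E_smul_tmul, map_add, coeff_tmul, coeff_tmul, coeff_tmul, coeff_tmul, coord_K, h,
      mul_smul, mul_smul, smul_comm (Uq.E ħ i)]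
  | hadd x y hx hy =>
    simp only [smul_add, map_add, hx, hy]
    abel

theorem coeff_E_first {i : Fin n} (hi : i.val = 0) (m : Fin n → ℕ)
    (u : QTensor V (BaseModule ħ lam)) :
    B.coeff m (Uq.E ħ i • u) =
      qpow ħ ((lam - expWeight m) ⬝ᵥ simpleRoot i) • Uq.E ħ i • B.coeff m u +
        (κ * qnum ħ (m i + 1)) • B.coeff (m + Pi.single i 1) u :=
  B.coeff_E (B.coord_E_first hi m) u

theorem coeff_E_add {i j : Fin n} (hij : i.val + 1 = j.val) (m : Fin n → ℕ)
    (u : QTensor V (BaseModule ħ lam)) :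
    B.coeff (m + Pi.single i 1) (Uq.E ħ j • u) =
      qpow ħ ((lam - expWeight (m + Pi.single i 1)) ⬝ᵥ simpleRoot j) •
        Uq.E ħ j • B.coeff (m + Pi.single i 1) u +
        qnum ħ (m j + 1) • B.coeff (m + Pi.single j 1) u :=
  B.coeff_E (B.coord_E_add hij m) u

theorem coeff_E_of_eq_zero {i j : Fin n} (hij : i.val + 1 = j.val) {m : Fin n → ℕ} (hm : m i = 0)
    (u : QTensor V (BaseModule ħ lam)) :
    B.coeff m (Uq.E ħ j • u) =
      qpow ħ ((lam - expWeight m) ⬝ᵥ simpleRoot j) • Uq.E ħ j • B.coeff m u := by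
  rw [B.coeff_E (m' := m) (c := 0) fun w => by rw [B.coord_E_of_eq_zero hij hm, zero_mul]]
  rw [zero_smul, add_zero]

theorem coeff_mem_weightSpace {ν : Weight n} {u : QTensor V (BaseModule ħ lam)}
    (hu : u ∈ weightSpace ħ (QTensor V (BaseModule ħ lam)) ν) (m : Fin n → ℕ) :
    B.coeff m u ∈ weightSpace ħ V (ν - lam + expWeight m) := fun i => by
  have h := B.coeff_K m i u
  rw [hu i, map_smul] at h
  have h2 := congrArg (qpow ħ (-((lam - expWeight m) ⬝ᵥ simpleRoot i)) • ·) h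
  simp only [smul_smul, qpow_neg_mul, one_smul] at h2
  rw [← h2, ← qpow_add]
  congr 2
  simp only [add_dotProduct, sub_dotProduct]
  ring

/-- A singular vector in `V ⊗ M` is determined by its leading coefficient. -/
theorem eq_zero_of_isSingular (hq : NotRootOfUnity ħ) (hκ : κ ≠ 0)
    {u : QTensor V (BaseModule ħ lam)} (hu : IsSingular n ħ u) (h0 : B.coeff 0 u = 0) : u = 0 := by
  refine B.eq_zero_of_coeff fun m => ?_
  induction m using exponent_induction with
  | h0 => exact h0
  | h1 i hi m ih =>
    have h := B.coeff_E_first hi m u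
    rw [hu i, map_zero, ih, smul_zero, smul_zero, zero_add] at h
    exact (smul_eq_zero.mp h.symm).resolve_left (mul_ne_zero hκ (hq.qnum_succ_ne_zero _))
  | h2 i j hij m ih =>
    have h := B.coeff_E_add hij m u
    rw [hu j, map_zero, ih, smul_zero, smul_zero, zero_add] at h
    exact (smul_eq_zero.mp h.symm).resolve_left (hq.qnum_succ_ne_zero _)

/-- For `j ≥ 2` no basis vector is mapped by `e_j` to a multiple of `1_λ`, so the coefficient of
`e_j u` at `1_λ` sees only the first tensor factor. -/
theorem E_smul_coeff_zero {u : QTensor V (BaseModule ħ lam)} (hu : IsSingular n ħ u) {j : Fin n}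
    (hj : 0 < j.val) : Uq.E ħ j • B.coeff 0 u = 0 := by
  have h := B.coeff_E_of_eq_zero (i := ⟨j.val - 1, by omega⟩) (j := j) (m := 0)
    (by simp; omega) rfl u
  rw [hu j, map_zero] at h
  exact (smul_eq_zero.mp h.symm).resolve_left (qpow_ne_zero _ _)

theorem coeff_zero_of_isDelta {v : V} {u : QTensor V (BaseModule ħ lam)} (hu : IsDelta ħ lam v u) :
    B.coeff 0 u = v := by
  have h := B.coeff_zero_of_mem_lowerTerms hu.2
  rw [map_sub, LinearEquiv.symm_apply_apply, map_sub, sub_eq_zero] at h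
  rw [h]
  change B.coeff 0 (QTensor.tmul v _) = v
  rw [coeff_tmul, ← B.basis_zero, coord_basis, if_pos rfl, one_smul]

theorem isDelta_unique (B : BaseBasis ħ lam κ) (hq : NotRootOfUnity ħ) (hκ : κ ≠ 0) {v : V}
    {u u' : QTensor V (BaseModule ħ lam)} (hu : IsDelta ħ lam v u) (hu' : IsDelta ħ lam v u') :
    u' = u := by
  rw [← sub_eq_zero]
  refine B.eq_zero_of_isSingular hq hκ (fun i => ?_) ?_
  · rw [smul_sub, hu.1 i, hu'.1 i, sub_zero]
  · rw [map_sub, B.coeff_zero_of_isDelta hu, B.coeff_zero_of_isDelta hu', sub_self]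

end BaseBasis

/-! ### Existence of the singular vector. -/

section Existence

variable {n : ℕ} {ħ : ℂ}

theorem eps_dotProduct (μ : Weight n) (i : Fin n) : μ ⬝ᵥ eps i = μ i := by
  simp [eps]

/-- The exponents of the characters are integers, so they can be recovered from powers of `q`: the
first directly, the others from successive differences. -/
theorem expWeight_eq_of_qpow_eq (hq : NotRootOfUnity ħ) {m m' : Fin n → ℕ}
    (h : ∀ i : Fin n, qpow ħ (expWeight m ⬝ᵥ simpleRoot i) =
      qpow ħ (expWeight m' ⬝ᵥ simpleRoot i)) : m = m' := by
  have key : ∀ N, ∀ i : Fin n, i.val = N → m i = m' i := by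
    intro N
    induction N with
    | zero =>
      intro i hi
      have h1 := h i
      rw [simpleRoot_first hi, eps_dotProduct, eps_dotProduct] at h1
      have h2 := hq.qpow_injective (k := m i) (l := m' i) (by exact_mod_cast h1)
      exact_mod_cast h2
    | succ N ih =>
      intro j hj
      have hi := ih ⟨N, by omega⟩ rfl
      have h1 := h j
      rw [simpleRoot_succ (i := ⟨N, by omega⟩) (j := j) hj.symm, dotProduct_sub, dotProduct_sub,
        eps_dotProduct, eps_dotProduct, eps_dotProduct, eps_dotProduct] at h1
      have h2 := hq.qpow_injective (k := m j - m ⟨N, by omega⟩) (l := m' j - m' ⟨N, by omega⟩)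
        (by push_cast; exact h1)
      omega
  exact funext fun i => key _ i rfl

/-- Non-zero `Y m` give distinct tuples of eigenvalues of the `q^{h_i}`, and there are finitely many
of these on `V`. -/
theorem finite_setOf_ne_zero (hq : NotRootOfUnity ħ) {V : Type*} [AddCommGroup V] [Module ℂ V]
    [Module (Uq n ħ) V] [IsScalarTower ℂ (Uq n ħ) V] [FiniteDimensional ℂ V] {ξ : Weight n}
    {Y : (Fin n → ℕ) → V} (hY : ∀ m, Y m ∈ weightSpace ħ V (ξ + expWeight m)) :
    {m | Y m ≠ 0}.Finite := by
  have hfin : (Set.univ.pi fun i : Fin n =>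
      {c | (Algebra.lsmul ℂ ℂ V (Uq.K ħ i)).HasEigenvalue c}).Finite :=
    Set.Finite.pi fun i => Module.End.finite_hasEigenvalue _
  refine Set.Finite.of_injOn
    (f := fun m i => qpow ħ ((ξ + expWeight m) ⬝ᵥ simpleRoot i)) ?_ ?_ hfin
  · intro m hm i _
    exact Module.End.hasEigenvalue_of_hasEigenvector (x := Y m)
      (Module.End.hasEigenvector_iff.mpr ⟨Module.End.mem_eigenspace_iff.mpr (hY m i), hm⟩)
  · intro m _ m' _ h
    refine expWeight_eq_of_qpow_eq hq fun i => ?_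
    have h1 := congrFun h i
    simp only [add_dotProduct, qpow_add] at h1
    exact mul_left_cancel₀ (qpow_ne_zero _ _) h1

/-- The coefficients of the canonical element of the tensor square of the base module. -/
def deltaCoeff (ħ b κ : ℂ) (j k : ℕ) : ℂ :=
  ∏ l ∈ Finset.range k, (-b / κ * (-qpow ħ 1) ^ j * qpow ħ (-l) / qnum ħ (l + 1))

theorem prod_deltaCoeff_add_single (b κ : ℂ) (m : Fin n → ℕ) (j : Fin n) :
    ∏ i : Fin n, deltaCoeff ħ b κ i ((m + Pi.single j 1 : Fin n → ℕ) i) =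
      (∏ i : Fin n, deltaCoeff ħ b κ i (m i)) *
        (-b / κ * (-qpow ħ 1) ^ j.val * qpow ħ (-(m j : ℂ)) / qnum ħ (m j + 1)) := by
  rw [← Finset.mul_prod_erase _ _ (Finset.mem_univ j),
    ← Finset.mul_prod_erase _ _ (Finset.mem_univ j)]
  have h : ∀ i ∈ Finset.univ.erase j, deltaCoeff ħ b κ i ((m + Pi.single j 1 : Fin n → ℕ) i) =
      deltaCoeff ħ b κ i (m i) := fun i hi => by simp [Finset.ne_of_mem_erase hi]
  rw [Finset.prod_congr rfl h]
  simp only [Pi.add_apply, Pi.single_eq_same]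
  rw [deltaCoeff, Finset.prod_range_succ, ← deltaCoeff]
  ring

variable {lam : Weight n} {κ : ℂ} (B : BaseBasis ħ lam κ)
variable {V : Type*} [AddCommGroup V] [Module ℂ V]

theorem BaseBasis.exists_coeff_eq {c : (Fin n → ℕ) → V} (hc : {m | c m ≠ 0}.Finite) :
    ∃ u : QTensor V (BaseModule ħ lam), ∀ m, B.coeff m u = c m := by
  refine ⟨∑ m ∈ hc.toFinset, QTensor.tmul (c m) (B.basis m), fun m => ?_⟩
  simp only [map_sum, B.coeff_tmul, B.coord_basis, ite_smul, one_smul, zero_smul]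
  rw [Finset.sum_ite_eq']
  split_ifs with h
  · rfl
  · simpa [eq_comm] using h

theorem BaseBasis.sub_mem_lowerTerms (hq : NotRootOfUnity ħ) (u : QTensor V (BaseModule ħ lam)) :
    QTensor.equiv V (BaseModule ħ lam) u - B.coeff 0 u ⊗ₜ[ℂ] BaseModule.one ħ lam ∈
      lowerTerms ħ lam V := by
  have hb : ∀ (v : V) m, v ⊗ₜ[ℂ] B.basis m - B.coeff 0 (QTensor.tmul v (B.basis m)) ⊗ₜ[ℂ]
      BaseModule.one ħ lam ∈ lowerTerms ħ lam V := fun v m => by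
    rw [B.coeff_tmul, B.coord_basis]
    by_cases hm : m = 0
    · rw [if_pos hm, one_smul, hm, B.basis_zero, sub_self]
      exact Submodule.zero_mem _
    · rw [if_neg hm, zero_smul, TensorProduct.zero_tmul, sub_zero]
      refine Submodule.subset_span ⟨_, v, _, ?_, B.mem_weightSpace m, rfl⟩
      by_contra! h
      refine hm (expWeight_eq_of_qpow_eq hq fun i => ?_)
      have h1 := h i
      rw [sub_dotProduct, sub_eq_add_neg, qpow_add, mul_eq_left₀ (qpow_ne_zero _ _), qpow_neg,
        inv_eq_one] at h1
      rw [h1]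
      simp [expWeight, dotProduct, qpow_zero]
  induction u using QTensor.induction_on with
  | h0 => simp
  | htmul v w =>
    rw [show QTensor.equiv V (BaseModule ħ lam) (QTensor.tmul v w) = v ⊗ₜ w from rfl,
      B.coeff_tmul]
    have hw : w ∈ Submodule.span ℂ (Set.range B.basis) := B.basis.mem_span w
    induction hw using Submodule.span_induction with
    | mem w hw =>
      obtain ⟨m, rfl⟩ := hw
      simpa only [B.coeff_tmul] using hb v m
    | zero => simp
    | add x y _ _ hx hy =>
      rw [map_add, TensorProduct.tmul_add, add_smul, TensorProduct.add_tmul, add_sub_add_comm]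
      exact Submodule.add_mem _ hx hy
    | smul c x _ hx =>
      rw [map_smul, TensorProduct.tmul_smul, smul_assoc, ← TensorProduct.smul_tmul', ← smul_sub]
      exact Submodule.smul_mem _ _ hx
  | hadd x y hx hy =>
    rw [map_add, map_add, TensorProduct.add_tmul, add_sub_add_comm]
    exact Submodule.add_mem _ hx hy

variable [Module (Uq n ħ) V] [IsScalarTower ℂ (Uq n ħ) V]

/-- Existence of the singular vector `δ_l(v)`. -/
theorem BaseBasis.exists_isDelta (B : BaseBasis ħ lam κ) (hq : NotRootOfUnity ħ)
    [FiniteDimensional ℂ V] {i₀ : Fin n}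
    (hi₀ : i₀.val = 0) (hκ : κ ≠ 0) (hlam : IsBaseWeight ħ lam) {ξ : Weight n} {v : V}
    (hvξ : v ∈ weightSpace ħ V ξ) (hv : v ∈ VPlus n ħ V) :
    ∃ u : QTensor V (BaseModule ħ lam), IsDelta ħ lam v u ∧
      u ∈ weightSpace ħ (QTensor V (BaseModule ħ lam)) (ξ + lam) := by
  set b := qpow ħ (lam ⬝ᵥ eps i₀) with hb
  obtain ⟨Y, hY0, hY⟩ := serreRelations_E.exists_monomialFamily hq hv.1 hv.2
  have hYw : ∀ m, Y m ∈ weightSpace ħ V (ξ + expWeight m) := fun m => by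
    have := hY.mem_weightSpace hq (s := 1) (μ := ξ) (fun i μ w hw => by
      rw [one_smul]
      exact E_smul_mem_weightSpace hw i) (by rwa [hY0]) m
    rwa [one_smul] at this
  set s : (Fin n → ℕ) → ℂ := fun m => ∏ i : Fin n, deltaCoeff ħ b κ i (m i) with hs
  -- With `Y m` in place, `e_i u = 0` reduces to scalar recursions for `s m`. The equation for `e_1`
  -- fixes the ratio in the first place; the one for `e_j` multiplies it by `-q` for each step along
  -- the diagram, whence `deltaCoeff`.
  obtain ⟨u, hu⟩ := B.exists_coeff_eq (c := fun m => s m • Y m)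
    ((finite_setOf_ne_zero hq hYw).subset fun m hm => (smul_ne_zero_iff.mp hm).2)
  have hu0 : B.coeff 0 u = v := by
    rw [hu, hY0]
    simp [hs, deltaCoeff]
  refine ⟨u, ⟨fun j => B.eq_zero_of_coeff fun m => ?_, ?_⟩, fun i => ?_⟩
  · by_cases hj : j.val = 0
    · have h1 : Uq.E ħ j • Y m = Y (m + Pi.single j 1) := hY.apply_first j hj m
      obtain rfl : j = i₀ := Fin.ext (by omega)
      rw [B.coeff_E_first hj, hu, hu, smul_comm (Uq.E ħ j), h1, smul_smul, smul_smul, ← add_smul]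
      convert zero_smul ℂ _
      have hne := hq.qnum_succ_ne_zero (m j)
      simp only [hs]
      rw [prod_deltaCoeff_add_single, sub_dotProduct, simpleRoot_first hj,
        eps_dotProduct (expWeight m), expWeight, sub_eq_add_neg, qpow_add, ← hb, hj]
      field_simp
      ring
    · have hij : (⟨j.val - 1, by omega⟩ : Fin n).val + 1 = j.val := by simp; omega
      generalize (⟨j.val - 1, by omega⟩ : Fin n) = i at hij
      by_cases hm : m i = 0
      · have h1 : Uq.E ħ j • Y m = 0 := hY.apply_of_eq_zero i j hij m hm
        rw [B.coeff_E_of_eq_zero hij hm, hu, smul_comm (Uq.E ħ j), h1, smul_zero, smul_zero]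
      · obtain ⟨m, rfl⟩ := exponent_eq_add_single hm
        have h1 : Uq.E ħ j • Y (m + Pi.single i 1) = qnum ħ (m i + 1) • Y (m + Pi.single j 1) :=
          hY.apply_add i j hij m
        rw [B.coeff_E_add hij, hu, hu, smul_comm (Uq.E ħ j), h1, smul_smul, smul_smul, smul_smul,
          ← add_smul]
        convert zero_smul ℂ _
        have hne := hq.qnum_succ_ne_zero (m i)
        have hne' := hq.qnum_succ_ne_zero (m j)
        have hji : j ≠ i := fun h => by rw [h] at hij; omega
        have h2 : lam ⬝ᵥ simpleRoot j = 0 := by rw [dotProduct_comm, hlam.2 j (by omega)]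
        have h3 : (-qpow ħ 1) ^ j.val = (-qpow ħ 1) ^ i.val * -qpow ħ 1 := by rw [← hij, pow_succ]
        -- Here `(λ, α_j) = 0` is used. The powers of `q` depending on `m i` cancel, which is why
        -- `s` can be a product of functions of the single `m i`.
        have h4 : qpow ħ ((lam - expWeight (m + Pi.single i 1)) ⬝ᵥ simpleRoot j) *
            qpow ħ (-(m i : ℂ)) = qpow ħ 1 * qpow ħ (-(m j : ℂ)) := by
          rw [← qpow_add, ← qpow_add, sub_dotProduct, h2, simpleRoot_succ hij, dotProduct_sub,
            eps_dotProduct, eps_dotProduct]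
          simp [expWeight, hji]
          congr 1
          ring
        simp only [hs]
        rw [prod_deltaCoeff_add_single, prod_deltaCoeff_add_single, h3]
        field_simp
        linear_combination
          (-(∏ l : Fin n, deltaCoeff ħ b κ l (m l)) * b * (-qpow ħ 1) ^ i.val) * h4
  · rw [← hu0]
    exact B.sub_mem_lowerTerms hq u
  · rw [← sub_eq_zero]
    refine B.eq_zero_of_coeff fun m => ?_
    rw [map_sub, B.coeff_K, map_smul, hu, smul_comm (Uq.K ħ i), hYw m i, sub_eq_zero,
      smul_comm (s m), smul_smul, ← qpow_add, ← add_dotProduct]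
    congr 3
    abel

end Existence

/-! ### The dynamical root vector and the generators `e_1`, `e_2`, `f_1`. -/

section DynamicalRootVector

variable {n : ℕ} {ħ : ℂ}

theorem qpow_half (z : ℂ) : qpow ħ z = qpow (ħ / 2) z ^ 2 := by
  rw [sq, ← qpow_add, qpow, qpow]
  ring_nf

theorem qpow_half_sub_ne_zero (hq : NotRootOfUnity ħ) :
    qpow (ħ / 2) 1 ^ 2 - 1 ≠ 0 ∧ qpow (ħ / 2) 1 ^ 2 + 1 ≠ 0 := by
  have h := hq.qpow_ne_one (k := 2) (by omega)
  push_cast at h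
  rw [qpow_two, qpow_half] at h
  constructor <;> intro h' <;> apply h
  · linear_combination (qpow (ħ / 2) 1 ^ 2 + 1) * h'
  · linear_combination (qpow (ħ / 2) 1 ^ 2 - 1) * h'

theorem qnum_eq_half (hq : NotRootOfUnity ħ) (z : ℂ) :
    qnum ħ z = qnum (ħ / 2) (2 * z) / qnum (ħ / 2) 2 := by
  obtain ⟨h1, h2⟩ := qpow_half_sub_ne_zero hq
  have h3 := qpow_ne_zero (ħ / 2) 1
  have h4 := qpow_ne_zero (ħ / 2) z
  simp only [qnum, qpow_neg, two_mul, qpow_add, qpow_half (ħ := ħ), qpow_two]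
  have h5 : qpow (ħ / 2) 1 ^ 4 - 1 ≠ 0 := by
    rw [show qpow (ħ / 2) 1 ^ 4 - 1 = (qpow (ħ / 2) 1 ^ 2 - 1) * (qpow (ħ / 2) 1 ^ 2 + 1) by ring]
    exact mul_ne_zero h1 h2
  field_simp

theorem qnum_half_two (hq : NotRootOfUnity ħ) :
    qnum (ħ / 2) 2 = qpow (ħ / 2) 1 + qpow (ħ / 2) (-1) := by
  obtain ⟨h1, h2⟩ := qpow_half_sub_ne_zero hq
  have h3 := qpow_ne_zero (ħ / 2) 1
  simp only [qnum, qpow_neg, qpow_two]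
  field_simp
  ring

theorem qnum_half_two_ne_zero (hq : NotRootOfUnity ħ) : qnum (ħ / 2) 2 ≠ 0 := by
  have h2 := (qpow_half_sub_ne_zero hq).2
  have h3 := qpow_ne_zero (ħ / 2) 1
  rw [qnum_half_two hq, qpow_neg]
  intro h
  apply h2
  field_simp at h
  simpa using h

/-- This is where half-integral powers of `q` come from: two applications of `f_1` along the short
root produce sums of neighbouring quantum numbers. -/
theorem qnum_add_qnum_add_one (hq : NotRootOfUnity ħ) (z : ℂ) :
    qnum ħ z + qnum ħ (z + 1) = qnum (ħ / 2) (2 * z + 1) := by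
  have h := qnum_half_two_ne_zero hq
  have h1 := qnum_add_one (ħ / 2) (2 * z + 1)
  rw [← qnum_half_two hq, add_sub_cancel_right] at h1
  rw [qnum_eq_half hq, qnum_eq_half hq, show 2 * (z + 1) = 2 * z + 1 + 1 by ring, h1]
  field_simp
  ring

variable {W : Type*} [AddCommGroup W] [Module ℂ W] [Module (Uq n ħ) W]
  [IsScalarTower ℂ (Uq n ħ) W]

theorem fHatDyn_smul (i j : Fin n) (s : ℂ) (w : W) : fHatDyn ħ i j s • w =
    qpow (ħ / 2) (-2) •
      ((qnum (ħ / 2) s / qnum (ħ / 2) (s + 2)) • Uq.F ħ i • Uq.F ħ i • Uq.F ħ j • w -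
        (qnum (ħ / 2) 2 * (qnum (ħ / 2) s / qnum (ħ / 2) (s + 1))) •
          Uq.F ħ i • Uq.F ħ j • Uq.F ħ i • w +
        Uq.F ħ j • Uq.F ħ i • Uq.F ħ i • w) := by
  simp only [fHatDyn, smul_assoc, add_smul, sub_smul, mul_smul, sq]

theorem fHatDyn_smul_mem_weightSpace {i j : Fin n} (hi : i.val = 0) (hj : j.val = 1) (s : ℂ)
    {μ : Weight n} {w : W} (hw : w ∈ weightSpace ħ W μ) :
    fHatDyn ħ i j s • w ∈ weightSpace ħ W (μ - (eps i + eps j)) := by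
  have hδ : (eps i + eps j : Weight n) = simpleRoot i + simpleRoot i + simpleRoot j := by
    rw [simpleRoot_succ (by omega : i.val + 1 = j.val), simpleRoot_first hi]
    abel
  rw [fHatDyn_smul, hδ]
  have h1 := F_smul_mem_weightSpace (F_smul_mem_weightSpace (F_smul_mem_weightSpace hw j) i) i
  have h2 := F_smul_mem_weightSpace (F_smul_mem_weightSpace (F_smul_mem_weightSpace hw i) j) i
  have h3 := F_smul_mem_weightSpace (F_smul_mem_weightSpace (F_smul_mem_weightSpace hw i) i) j
  refine Submodule.smul_mem _ _ (Submodule.add_mem _ (Submodule.sub_mem _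
    (Submodule.smul_mem _ _ ?_) (Submodule.smul_mem _ _ ?_)) ?_)
  · convert h1 using 1; congr 1; abel
  · convert h2 using 1; congr 1; abel
  · convert h3 using 1; congr 1; abel

/-- On a vector killed by `e_1`, the result is a combination of `f_1 f_2 w` and `f_2 f_1 w`. With
`[z]_q = [2z]_p / [2]_p` and `[z]_q + [z+1]_q = [2z+1]_p` both coefficients cancel exactly for `s =
2h - 1`; this explains the shape of `fHatDyn`. -/
theorem E_first_fHatDyn_smul (hq : NotRootOfUnity ħ) {i j : Fin n} (hi : i.val = 0)
    (hj : j.val = 1) {μ : Weight n} {w : W} (hw : w ∈ weightSpace ħ W μ)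
    (hE : Uq.E ħ i • w = 0) {h : ℂ} (hh : μ ⬝ᵥ simpleRoot i = h)
    (h1 : qnum (ħ / 2) (2 * h) ≠ 0) (h2 : qnum (ħ / 2) (2 * h + 1) ≠ 0) :
    Uq.E ħ i • fHatDyn ħ i j (2 * h - 1) • w = 0 := by
  have hij : i ≠ j := fun h => by rw [h] at hi; omega
  have hii := simpleRoot_zero i hi
  have hji := simpleRoot_adj j i (Or.inr (by omega))
  have hy := F_smul_mem_weightSpace hw j
  have hx := F_smul_mem_weightSpace hw i
  have hxy := F_smul_mem_weightSpace hy i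
  have hyx := F_smul_mem_weightSpace hx j
  rw [fHatDyn_smul, smul_comm _ (_ : ℂ), smul_add, smul_sub, smul_comm (Uq.E ħ i) (_ : ℂ),
    smul_comm (Uq.E ħ i) (_ : ℂ),
    E_F_smul_same hxy, E_F_smul_same hy, E_F_smul_same hyx, E_F_smul_of_ne hij, E_F_smul_of_ne hij,
    E_F_smul_of_ne hij, E_F_smul_same hx, E_F_smul_same hw, hE]
  simp only [sub_dotProduct, hii, hji, hh, smul_zero, zero_add, smul_add,
    smul_comm (Uq.F ħ _ : Uq n ħ) (_ : ℂ)]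
  have e1 := qnum_add_qnum_add_one hq h
  have e2 := qnum_add_qnum_add_one hq (h - 1)
  rw [show 2 * (h - 1) + 1 = 2 * h - 1 by ring, sub_add_cancel] at e2
  have e3 := qnum_eq_half hq h
  have hp := qnum_half_two_ne_zero hq
  rw [show 2 * h - 1 + 2 = 2 * h + 1 by ring, show 2 * h - 1 + 1 = 2 * h by ring,
    show h - -1 = h + 1 by ring, show h + 1 - 1 = h by ring, show h - 1 - -1 = h by ring]
  generalize Uq.F ħ i • Uq.F ħ j • w = a
  generalize Uq.F ħ j • Uq.F ħ i • w = c
  match_scalars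
  · field_simp at e3 ⊢
    linear_combination qpow (ħ / 2) (-2) * qnum (ħ / 2) (2 * h - 1) *
      (qnum (ħ / 2) (2 * h) * e1 - qnum (ħ / 2) (2 * h + 1) * e3)
  · field_simp at e3 ⊢
    linear_combination qpow (ħ / 2) (-2) *
      (qnum (ħ / 2) (2 * h) * e2 - qnum (ħ / 2) (2 * h - 1) * e3)

/-- In the three words `f_2` stands after zero, one or two letters `f_1`, which shifts the weight
seen by the commutator to `g`, `g + 1`, `g + 2`. -/
theorem E_second_fHatDyn_smul {i j : Fin n} (hi : i.val = 0) (hj : j.val = 1) {μ : Weight n}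
    {w : W} (hw : w ∈ weightSpace ħ W μ) {g : ℂ} (hg : μ ⬝ᵥ simpleRoot j = g) (s : ℂ) :
    Uq.E ħ j • fHatDyn ħ i j s • w = fHatDyn ħ i j s • Uq.E ħ j • w +
      (qpow (ħ / 2) (-2) * (qnum (ħ / 2) s / qnum (ħ / 2) (s + 2) * qnum ħ g -
        qnum (ħ / 2) 2 * (qnum (ħ / 2) s / qnum (ħ / 2) (s + 1)) * qnum ħ (g + 1) +
        qnum ħ (g + 2))) • Uq.F ħ i • Uq.F ħ i • w := by
  have hij : j ≠ i := fun h => by rw [h] at hj; omega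
  have hij' := simpleRoot_adj i j (Or.inl (by omega))
  have hx := F_smul_mem_weightSpace hw i
  have hxx := F_smul_mem_weightSpace hx i
  rw [fHatDyn_smul, smul_comm _ (_ : ℂ), smul_add, smul_sub, smul_comm (Uq.E ħ j) (_ : ℂ),
    smul_comm (Uq.E ħ j) (_ : ℂ),
    E_F_smul_of_ne hij, E_F_smul_of_ne hij, E_F_smul_same hw, E_F_smul_of_ne hij, E_F_smul_same hx,
    E_F_smul_same hxx, E_F_smul_of_ne hij, E_F_smul_of_ne hij, E_F_smul_of_ne hij, fHatDyn_smul]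
  simp only [sub_dotProduct, hij', hg, smul_add, smul_comm (Uq.F ħ _ : Uq n ħ) (_ : ℂ)]
  rw [show g - -1 = g + 1 by ring, show g + 1 - -1 = g + 2 by ring]
  generalize Uq.F ħ i • Uq.F ħ i • Uq.F ħ j • Uq.E ħ j • w = a
  generalize Uq.F ħ i • Uq.F ħ j • Uq.F ħ i • Uq.E ħ j • w = b
  generalize Uq.F ħ j • Uq.F ħ i • Uq.F ħ i • Uq.E ħ j • w = c
  generalize Uq.F ħ i • Uq.F ħ i • w = d
  module

theorem short_serre_F_smul {i j : Fin n} (hi : i.val = 0) (hj : j.val = 1) (w : W) :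
    Uq.F ħ i • Uq.F ħ i • Uq.F ħ i • Uq.F ħ j • w -
      (1 + qpow ħ 1 + qpow ħ (-1)) • Uq.F ħ i • Uq.F ħ i • Uq.F ħ j • Uq.F ħ i • w +
      (1 + qpow ħ 1 + qpow ħ (-1)) • Uq.F ħ i • Uq.F ħ j • Uq.F ħ i • Uq.F ħ i • w -
      Uq.F ħ j • Uq.F ħ i • Uq.F ħ i • Uq.F ħ i • w = 0 := by
  have h := congrArg (· • w) (Uq.serre_F_short (ħ := ħ) i j hi hj)
  rw [qcomm] at h
  simp only [one_smul, sub_smul, zero_smul, mul_smul, qcomm_qcomm_smul] at h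
  rw [← h]
  simp only [smul_add, smul_sub, smul_comm (Uq.F ħ _ : Uq n ħ) (_ : ℂ)]
  generalize Uq.F ħ i • Uq.F ħ i • Uq.F ħ i • Uq.F ħ j • w = a
  generalize Uq.F ħ i • Uq.F ħ i • Uq.F ħ j • Uq.F ħ i • w = b
  generalize Uq.F ħ i • Uq.F ħ j • Uq.F ħ i • Uq.F ħ i • w = c
  generalize Uq.F ħ j • Uq.F ħ i • Uq.F ħ i • Uq.F ħ i • w = d
  module

theorem qnum_half_serre (hq : NotRootOfUnity ħ) (s : ℂ) :
    qnum (ħ / 2) s + qnum (ħ / 2) 2 * qnum (ħ / 2) (s + 3) =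
      (1 + qpow ħ 1 + qpow ħ (-1)) * qnum (ħ / 2) (s + 2) := by
  rw [qnum_half_two hq, qpow_half (ħ := ħ) 1, qpow_half (ħ := ħ) (-1), qpow_neg]
  have h3 := qpow_ne_zero (ħ / 2) 1
  have h4 := qpow_ne_zero (ħ / 2) s
  simp only [qnum, show s + 3 = s + 2 + 1 by ring, qpow_neg, qpow_add, qpow_two]
  field_simp
  ring

theorem qnum_half_serre' (hq : NotRootOfUnity ħ) (s : ℂ) :
    qnum (ħ / 2) 2 * qnum (ħ / 2) s + qnum (ħ / 2) (s + 3) =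
      (1 + qpow ħ 1 + qpow ħ (-1)) * qnum (ħ / 2) (s + 1) := by
  rw [qnum_half_two hq, qpow_half (ħ := ħ) 1, qpow_half (ħ := ħ) (-1), qpow_neg]
  have h3 := qpow_ne_zero (ħ / 2) 1
  have h4 := qpow_ne_zero (ħ / 2) s
  simp only [qnum, show s + 3 = s + 2 + 1 by ring, qpow_neg, qpow_add, qpow_two]
  field_simp
  ring

/-- The difference of the two sides is `-p⁻²` times the short Serre relation; the two preceding
identities match the middle coefficients. Moving past `f_1` shifts the dynamical parameter by one.
-/
theorem fHatDyn_F_smul (hq : NotRootOfUnity ħ) {i j : Fin n} (hi : i.val = 0) (hj : j.val = 1)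
    {s : ℂ} (h1 : qnum (ħ / 2) (s + 1) ≠ 0) (h2 : qnum (ħ / 2) (s + 2) ≠ 0)
    (h3 : qnum (ħ / 2) (s + 3) ≠ 0) (w : W) :
    fHatDyn ħ i j s • Uq.F ħ i • w =
      (qnum (ħ / 2) (s + 3) / qnum (ħ / 2) (s + 1)) • Uq.F ħ i • fHatDyn ħ i j (s + 1) • w := by
  have h := short_serre_F_smul (ħ := ħ) hi hj w
  have e1 := qnum_half_serre hq s
  have e2 := qnum_half_serre' hq s
  rw [fHatDyn_smul, fHatDyn_smul, show s + 1 + 2 = s + 3 by ring, show s + 1 + 1 = s + 2 by ring]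
  simp only [smul_add, smul_sub, smul_comm (Uq.F ħ _ : Uq n ħ) (_ : ℂ)]
  have h' := congrArg (qpow (ħ / 2) (-2) • ·) h
  simp only [smul_zero] at h'
  rw [← sub_eq_zero, ← neg_eq_zero, ← h']
  generalize Uq.F ħ i • Uq.F ħ i • Uq.F ħ i • Uq.F ħ j • w = a
  generalize Uq.F ħ i • Uq.F ħ i • Uq.F ħ j • Uq.F ħ i • w = b
  generalize Uq.F ħ i • Uq.F ħ j • Uq.F ħ i • Uq.F ħ i • w = c
  generalize Uq.F ħ j • Uq.F ħ i • Uq.F ħ i • Uq.F ħ i • w = d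
  match_scalars
  all_goals field_simp
  · linear_combination -qpow (ħ / 2) (-2) * e1
  · linear_combination qpow (ħ / 2) (-2) * e2

/-- The left side is the scalar of `E_second_fHatDyn_smul` with its denominators cleared. Its
collapse to a single quantum number in `2h + g + 1`, the pairing of the weight with `δ = 2α_1 + α_2`
plus one, is what makes `δ` behave like a simple root. -/
theorem qnum_telescope (hq : NotRootOfUnity ħ) (h g : ℂ) :
    qnum (ħ / 2) (2 * h - 1) * qnum (ħ / 2) (2 * h) * qnum ħ g -
      qnum (ħ / 2) 2 * qnum (ħ / 2) (2 * h - 1) * qnum (ħ / 2) (2 * h + 1) * qnum ħ (g + 1) +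
      qnum (ħ / 2) (2 * h) * qnum (ħ / 2) (2 * h + 1) * qnum ħ (g + 2) =
    qnum (ħ / 2) 2 * qnum ħ (2 * h + g + 1) := by
  obtain ⟨h1, h2⟩ := qpow_half_sub_ne_zero hq
  have h3 := qpow_ne_zero (ħ / 2) 1
  have h4 := qpow_ne_zero (ħ / 2) h
  have h5 := qpow_ne_zero (ħ / 2) g
  have h6 : qpow (ħ / 2) 1 ^ 4 - 1 ≠ 0 := by
    rw [show qpow (ħ / 2) 1 ^ 4 - 1 = (qpow (ħ / 2) 1 ^ 2 - 1) * (qpow (ħ / 2) 1 ^ 2 + 1) by ring]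
    exact mul_ne_zero h1 h2
  rw [qnum_half_two hq]
  simp only [qnum, qpow_half (ħ := ħ), sub_eq_add_neg, two_mul, qpow_neg, qpow_add, qpow_two]
  generalize qpow (ħ / 2) 1 = p at *
  generalize qpow (ħ / 2) h = a at *
  generalize qpow (ħ / 2) g = b at *
  simp only [← sub_eq_add_neg]
  field_simp
  ring

/-- The induction step of the usual `sl(2)` formula for `e f^{k+1}` on a highest vector; it serves
both the long simple roots and `δ`. -/
theorem qnum_sum_step (hq : NotRootOfUnity ħ) (k L : ℂ) :
    qnum ħ k * qnum ħ (L - k + 1) + qnum ħ (L - 2 * k) = qnum ħ (k + 1) * qnum ħ (L - k) := by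
  have h := hq.sub_ne_zero
  have h3 := qpow_ne_zero ħ 1
  have h4 := qpow_ne_zero ħ k
  have h5 := qpow_ne_zero ħ L
  rw [qpow_neg] at h
  have h6 : qpow ħ 1 ^ 2 - 1 ≠ 0 := by
    intro h'
    apply h
    field_simp
    simpa using h'
  simp only [qnum, sub_eq_add_neg, two_mul, qpow_neg, qpow_add]
  field_simp
  ring

end DynamicalRootVector

/-! ### Strings of the long simple roots. -/

section LongRootStrings

variable {n : ℕ} {ħ : ℂ} {W : Type*} [AddCommGroup W] [Module ℂ W] [Module (Uq n ħ) W]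
  [IsScalarTower ℂ (Uq n ħ) W]

theorem false_of_eigenvectors [FiniteDimensional ℂ W] (T : Module.End ℂ W) {f : ℕ → ℂ}
    (hf : f.Injective) (h : ∀ k, ∃ w, w ≠ 0 ∧ T w = f k • w) : False := by
  refine Set.infinite_range_of_injective hf ((Module.End.finite_hasEigenvalue T).subset ?_)
  rintro _ ⟨k, rfl⟩
  obtain ⟨w, hw, hTw⟩ := h k
  exact Module.End.hasEigenvalue_of_hasEigenvector ⟨Module.End.mem_eigenspace_iff.mpr hTw, hw⟩

theorem NotRootOfUnity.qpow_sub_mul_injective (hq : NotRootOfUnity ħ) (z : ℂ) {d : ℤ} (hd : d ≠ 0) :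
    (fun k : ℕ => qpow ħ (z - d * k)).Injective := by
  intro k l h
  simp only [sub_eq_add_neg, qpow_add] at h
  have h1 := hq.qpow_injective (k := -(d * k)) (l := -(d * l)) (by
    push_cast
    exact mul_left_cancel₀ (qpow_ne_zero ħ z) h)
  simpa [hd] using h1

theorem F_pow_smul_mem_weightSpace {μ : Weight n} {w : W} (hw : w ∈ weightSpace ħ W μ) (i : Fin n)
    (k : ℕ) : Uq.F ħ i ^ k • w ∈ weightSpace ħ W (μ - (k : ℂ) • simpleRoot i) := by
  induction k with
  | zero => simpa using hw
  | succ k ih =>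
    rw [pow_succ', mul_smul]
    convert F_smul_mem_weightSpace ih i using 1
    push_cast
    congr 1
    module

theorem E_F_pow_smul (hq : NotRootOfUnity ħ) {μ : Weight n} {w : W} (hw : w ∈ weightSpace ħ W μ)
    {i : Fin n} (hi : 0 < i.val) (hE : Uq.E ħ i • w = 0) (k : ℕ) :
    Uq.E ħ i • Uq.F ħ i ^ (k + 1) • w =
      (qnum ħ (k + 1) * qnum ħ (μ ⬝ᵥ simpleRoot i - k)) • Uq.F ħ i ^ k • w := by
  induction k with
  | zero => simp [E_F_smul_same hw, hE, hq.qnum_one]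
  | succ k ih =>
    have h := qnum_sum_step hq (k + 1) (μ ⬝ᵥ simpleRoot i)
    rw [show μ ⬝ᵥ simpleRoot i - (k + 1) + 1 = μ ⬝ᵥ simpleRoot i - k by ring] at h
    rw [pow_succ', mul_smul, E_F_smul_same (F_pow_smul_mem_weightSpace hw i (k + 1)), ih,
      smul_comm (Uq.F ħ i) (_ : ℂ), smul_smul, ← pow_succ', sub_dotProduct, smul_dotProduct,
      simpleRoot_self i (by omega), ← add_smul, smul_eq_mul]
    push_cast
    rw [← h]
    congr 3
    ring

/-- With `N < 0` no factor `[k + 1][N - k]` vanishes, so a non-zero `w` would give an infinite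
string and infinitely many eigenvalues of `q^{h_i}`. -/
theorem eq_zero_of_E_smul_eq_zero [FiniteDimensional ℂ W] (hq : NotRootOfUnity ħ) {μ : Weight n}
    {w : W} (hw : w ∈ weightSpace ħ W μ) {i : Fin n} (hi : 0 < i.val) (hE : Uq.E ħ i • w = 0)
    {N : ℤ} (hN : μ ⬝ᵥ simpleRoot i = N) (hN0 : N < 0) : w = 0 := by
  by_contra hw0
  have hne : ∀ k : ℕ, Uq.F ħ i ^ k • w ≠ 0 := fun k => by
    induction k with
    | zero => simpa using hw0
    | succ k ih =>
      intro h
      have h1 := E_F_pow_smul hq hw hi hE k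
      have h2 := hq.qnum_ne_zero (k := N - k) (by omega)
      push_cast at h2
      rw [h, smul_zero, hN] at h1
      exact smul_ne_zero (mul_ne_zero (hq.qnum_succ_ne_zero k) h2) ih h1.symm
  refine false_of_eigenvectors (Algebra.lsmul ℂ ℂ W (Uq.K ħ i))
    (hq.qpow_sub_mul_injective (μ ⬝ᵥ simpleRoot i) (d := 2) (by decide))
    fun k => ⟨_, hne k, (F_pow_smul_mem_weightSpace hw i k i).trans ?_⟩
  rw [sub_dotProduct, smul_dotProduct, simpleRoot_self i (by omega), smul_eq_mul, mul_comm]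
  norm_num

end LongRootStrings

/-! ### Strings of the root `δ`. -/

section DynamicalSequence

variable {n : ℕ} {ħ : ℂ} {W : Type*} [AddCommGroup W] [Module ℂ W] [Module (Uq n ħ) W]
  [IsScalarTower ℂ (Uq n ħ) W]

/-- The vectors `f̂_δ(2h - 2k + 1) ⋯ f̂_δ(2h - 3) f̂_δ(2h - 1) u`. -/
def dynSeq (ħ : ℂ) (i j : Fin n) (h : ℂ) {W : Type*} [AddCommGroup W] [Module (Uq n ħ) W] (u : W) :
    ℕ → W
  | 0 => u
  | k + 1 => fHatDyn ħ i j (2 * (h - k) - 1) • dynSeq ħ i j h u k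

theorem fHatDynProd_smul {W : Type*} [AddCommGroup W] [Module (Uq n ħ) W]
    (i j : Fin n) (h : ℂ) (u : W) (m : ℕ) :
    fHatDynProd ħ i j (2 * h - 2 * m + 1) m • u = dynSeq ħ i j h u m := by
  induction m with
  | zero => simp [fHatDynProd, dynSeq]
  | succ m ih =>
    rw [dynSeq, ← ih, fHatDynProd, List.ofFn_succ, List.prod_cons, mul_smul, fHatDynProd]
    congr 2
    · simp
      ring
    · congr 2
      ext k
      congr 1
      simp
      ring

theorem E_smul_fHatDyn_of_ne {i j l : Fin n} (hi : l ≠ i) (hj : l ≠ j) (s : ℂ) (w : W) :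
    Uq.E ħ l • fHatDyn ħ i j s • w = fHatDyn ħ i j s • Uq.E ħ l • w := by
  rw [fHatDyn_smul, fHatDyn_smul]
  simp only [smul_add, smul_sub, smul_comm (Uq.E ħ l) (_ : ℂ), E_F_smul_of_ne hi, E_F_smul_of_ne hj]

theorem E_second_fHatDyn_smul' (hq : NotRootOfUnity ħ) {i j : Fin n} (hi : i.val = 0)
    (hj : j.val = 1) {μ : Weight n} {w : W} (hw : w ∈ weightSpace ħ W μ) {h g : ℂ}
    (hg : μ ⬝ᵥ simpleRoot j = g) (h1 : qnum (ħ / 2) (2 * h) ≠ 0)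
    (h2 : qnum (ħ / 2) (2 * h + 1) ≠ 0) :
    Uq.E ħ j • fHatDyn ħ i j (2 * h - 1) • w = fHatDyn ħ i j (2 * h - 1) • Uq.E ħ j • w +
      (qpow (ħ / 2) (-2) * qnum (ħ / 2) 2 * qnum ħ (2 * h + g + 1) /
        (qnum (ħ / 2) (2 * h) * qnum (ħ / 2) (2 * h + 1))) • Uq.F ħ i • Uq.F ħ i • w := by
  rw [E_second_fHatDyn_smul hi hj hw hg, mul_assoc (qpow _ _), ← qnum_telescope hq,
    show 2 * h - 1 + 2 = 2 * h + 1 by ring, show 2 * h - 1 + 1 = 2 * h by ring]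
  congr 2
  field_simp

theorem dynSeq_mem_weightSpace {i j : Fin n} (hi : i.val = 0) (hj : j.val = 1) (h : ℂ)
    {μ : Weight n} {u : W} (hu : u ∈ weightSpace ħ W μ) (k : ℕ) :
    dynSeq ħ i j h u k ∈ weightSpace ħ W (μ - (k : ℂ) • (eps i + eps j)) := by
  induction k with
  | zero => simpa [dynSeq] using hu
  | succ k ih =>
    rw [dynSeq]
    convert fHatDyn_smul_mem_weightSpace hi hj (2 * (h - k) - 1) ih using 1
    push_cast
    congr 1
    module

theorem eps_add_eps_dotProduct_first {i j : Fin n} (hi : i.val = 0) (hj : j.val = 1) :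
    (eps i + eps j) ⬝ᵥ simpleRoot i = 1 := by
  have hij : i ≠ j := fun h => by rw [h] at hi; omega
  rw [simpleRoot_first hi, eps_dotProduct]
  simp [eps, hij]

theorem eps_add_eps_dotProduct_second {i j : Fin n} (hi : i.val = 0) (hj : j.val = 1) :
    (eps i + eps j) ⬝ᵥ simpleRoot j = 0 := by
  have hij : i ≠ j := fun h => by rw [h] at hi; omega
  rw [simpleRoot_succ (by omega : i.val + 1 = j.val), dotProduct_sub, eps_dotProduct,
    eps_dotProduct]
  simp [eps, hij, hij.symm]

section Singular

variable {i j : Fin n} {μ : Weight n} {u : W} {h g : ℂ}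

theorem E_first_dynSeq (hq : NotRootOfUnity ħ) (hi : i.val = 0) (hj : j.val = 1)
    (hu : u ∈ weightSpace ħ W μ) (hE : Uq.E ħ i • u = 0) (hh : μ ⬝ᵥ simpleRoot i = h)
    (hne : ∀ k : ℤ, qnum (ħ / 2) (2 * h + k) ≠ 0) (k : ℕ) :
    Uq.E ħ i • dynSeq ħ i j h u k = 0 := by
  induction k with
  | zero => exact hE
  | succ k ih =>
    have h1 := hne (-2 * k)
    have h2 := hne (-2 * k + 1)
    refine E_first_fHatDyn_smul hq hi hj (dynSeq_mem_weightSpace hi hj h hu k) ih ?_ ?_ ?_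
    · rw [sub_dotProduct, smul_dotProduct, eps_add_eps_dotProduct_first hi hj, hh, smul_eq_mul,
        mul_one]
    · convert h1 using 2
      push_cast
      ring
    · convert h2 using 2
      push_cast
      ring

theorem E_dynSeq_of_ne {l : Fin n} (hli : l ≠ i) (hlj : l ≠ j) (hE : Uq.E ħ l • u = 0) (k : ℕ) :
    Uq.E ħ l • dynSeq ħ i j h u k = 0 := by
  induction k with
  | zero => exact hE
  | succ k ih => rw [dynSeq, E_smul_fHatDyn_of_ne hli hlj, ih, smul_zero]

/-- The analogue of the `sl(2)` formula, with `f_1²` applied to the previous vector. All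
denominators are non-zero by `hne`. -/
theorem E_second_dynSeq (hq : NotRootOfUnity ħ) (hi : i.val = 0) (hj : j.val = 1)
    (hu : u ∈ weightSpace ħ W μ) (hE : Uq.E ħ j • u = 0) (hg : μ ⬝ᵥ simpleRoot j = g)
    (hne : ∀ k : ℤ, qnum (ħ / 2) (2 * h + k) ≠ 0) (k : ℕ) :
    Uq.E ħ j • dynSeq ħ i j h u (k + 1) =
      (qpow (ħ / 2) (-2) * qnum (ħ / 2) 2 * (qnum ħ (k + 1) * qnum ħ (2 * h + g + 1 - k)) /
        (qnum (ħ / 2) (2 * (h - k)) * qnum (ħ / 2) (2 * (h - k) + 1))) •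
          Uq.F ħ i • Uq.F ħ i • dynSeq ħ i j h u k := by
  have hne1 : ∀ k : ℕ, qnum (ħ / 2) (2 * (h - k)) ≠ 0 := fun k => by
    convert hne (-2 * k) using 2
    push_cast
    ring
  have hne2 : ∀ k : ℕ, qnum (ħ / 2) (2 * (h - k) + 1) ≠ 0 := fun k => by
    convert hne (-2 * k + 1) using 2
    push_cast
    ring
  have hwt : ∀ k : ℕ, (μ - (k : ℂ) • (eps i + eps j)) ⬝ᵥ simpleRoot j = g := fun k => by
    rw [sub_dotProduct, smul_dotProduct, eps_add_eps_dotProduct_second hi hj, hg, smul_zero,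
      sub_zero]
  have step := fun k => E_second_fHatDyn_smul' hq hi hj (dynSeq_mem_weightSpace hi hj h hu k)
    (hwt k) (hne1 k) (hne2 k)
  induction k with
  | zero =>
    rw [show dynSeq ħ i j h u (0 + 1) = fHatDyn ħ i j (2 * (h - (0 : ℕ)) - 1) •
      dynSeq ħ i j h u 0 from rfl, step, dynSeq, hE, smul_zero, zero_add]
    simp [hq.qnum_one]
  | succ k ih =>
    rw [dynSeq, step, ih]
    have h1 := hne1 k
    have h2 := hne2 k
    have h3 := hne1 (k + 1)
    have h4 := hne2 (k + 1)
    have h5 := qnum_sum_step hq (k + 1) (2 * h + g + 1)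
    set s : ℂ := 2 * (h - (k + 1 : ℕ)) - 1 with hs
    have e1 : s + 1 = 2 * (h - (k + 1 : ℕ)) := by rw [hs]; ring
    have e2 : s + 2 = 2 * (h - (k + 1 : ℕ)) + 1 := by rw [hs]; ring
    have e3 : s + 3 = 2 * (h - k) := by rw [hs]; push_cast; ring
    have e4 : s + 1 + 3 = 2 * (h - k) + 1 := by rw [hs]; push_cast; ring
    have e5 : s + 1 + 1 = 2 * (h - (k + 1 : ℕ)) + 1 := by rw [hs]; ring
    have e6 : s + 1 + 2 = 2 * (h - k) := by rw [hs]; push_cast; ring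
    have e7 : s + 1 + 1 = 2 * (h - k) - 1 := by rw [hs]; push_cast; ring
    -- Passing both letters `f_1` raises the parameter from `s` to `s + 2`, which is the one that
    -- turns the vector of index `k` into the next. Both terms become multiples of the same vector.
    rw [smul_comm (fHatDyn ħ i j s) (_ : ℂ), fHatDyn_F_smul hq hi hj (by rwa [e1]) (by rwa [e2])
      (by rwa [e3]), fHatDyn_F_smul hq hi hj (by rwa [e5]) (by rwa [e6]) (by rwa [e4]),
      smul_comm (Uq.F ħ i) (_ : ℂ), e4, e3, e5, e1, ← e5, e7, ← dynSeq, smul_smul, smul_smul,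
      ← add_smul]
    congr 1
    rw [show 2 * h + g + 1 - ((k : ℂ) + 1) + 1 = 2 * h + g + 1 - k by ring,
      show 2 * h + g + 1 - 2 * ((k : ℂ) + 1) = 2 * (h - (k + 1 : ℕ)) + g + 1 by
        push_cast; ring] at h5
    rw [show (((k + 1 : ℕ) : ℂ) + 1) = k + 1 + 1 by push_cast; ring,
      show 2 * h + g + 1 - ((k + 1 : ℕ) : ℂ) = 2 * h + g + 1 - (k + 1) by push_cast; ring, ← h5,
      ← e7, e5]
    field_simp

/-- Applying `e_1` twice returns `u` with the factor `[2h - 1]_p [h]_q`. -/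
theorem F_first_F_first_smul_ne_zero (hq : NotRootOfUnity ħ) (hi : i.val = 0)
    (hu : u ∈ weightSpace ħ W μ) (hE : Uq.E ħ i • u = 0) (hh : μ ⬝ᵥ simpleRoot i = h)
    (h1 : qnum (ħ / 2) (2 * h) ≠ 0) (h2 : qnum (ħ / 2) (2 * h - 1) ≠ 0) (hu0 : u ≠ 0) :
    Uq.F ħ i • Uq.F ħ i • u ≠ 0 := by
  have h3 : Uq.E ħ i • Uq.F ħ i • u = qnum ħ h • u := by
    rw [E_F_smul_same hu, hE, smul_zero, zero_add, hh]
  have h4 : Uq.E ħ i • Uq.F ħ i • Uq.F ħ i • u = qnum (ħ / 2) (2 * h - 1) • Uq.F ħ i • u := by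
    rw [E_F_smul_same (F_smul_mem_weightSpace hu i), h3, smul_comm (Uq.F ħ i) (_ : ℂ), ← add_smul,
      sub_dotProduct, hh, simpleRoot_zero i hi,
      show 2 * h - 1 = 2 * (h - 1) + 1 by ring, ← qnum_add_qnum_add_one hq, sub_add_cancel,
      add_comm]
  have h5 : qnum ħ h ≠ 0 := by
    rw [qnum_eq_half hq]
    exact div_ne_zero h1 (qnum_half_two_ne_zero hq)
  intro h0
  rw [h0, smul_zero] at h4
  have h6 := (smul_eq_zero.mp h4.symm).resolve_left h2
  rw [h6, smul_zero] at h3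
  exact smul_ne_zero h5 hu0 h3.symm

end Singular

end DynamicalSequence

/-! ### Arithmetic of the base weight. -/

section Pairings

variable {n : ℕ} {ħ : ℂ} {lam : Weight n}

theorem eps_add_eps_dotProduct_self {i j : Fin n} (hi : i.val = 0) (hj : j.val = 1) :
    (eps i + eps j : Weight n) ⬝ᵥ (eps i + eps j) = 2 := by
  have hij : i ≠ j := fun h => by rw [h] at hi; omega
  rw [dotProduct_add, eps_dotProduct, eps_dotProduct]
  simp [eps, hij, hij.symm]
  norm_num

theorem corootPairing_of_dotProduct_self {α : Weight n} (hα : α ⬝ᵥ α = 2) (ξ : Weight n) :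
    corootPairing ξ α = ξ ⬝ᵥ α := by
  rw [corootPairing, hα, mul_div_cancel_left₀ _ two_ne_zero]

theorem corootPairing_simpleRoot {i : Fin n} (hi : 0 < i.val) (ξ : Weight n) :
    corootPairing ξ (simpleRoot i) = ξ ⬝ᵥ simpleRoot i :=
  corootPairing_of_dotProduct_self (simpleRoot_self i (by omega)) ξ

theorem corootPairing_eps_add_eps {i j : Fin n} (hi : i.val = 0) (hj : j.val = 1) (ξ : Weight n) :
    corootPairing ξ (eps i + eps j) = ξ ⬝ᵥ (eps i + eps j) :=
  corootPairing_of_dotProduct_self (eps_add_eps_dotProduct_self hi hj) ξ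

theorem IsBaseWeight.dotProduct_simpleRoot (hlam : IsBaseWeight ħ lam) {i : Fin n}
    (hi : 0 < i.val) : lam ⬝ᵥ simpleRoot i = 0 := by
  rw [dotProduct_comm, hlam.2 i hi]

/-- A zero would require `q^{2(λ, ε_i) + N} = -q^{N-1}` to be one. For `N = 1` this reads `-1 = 1`;
otherwise its square contradicts that `q` is not a root of unity. -/
theorem IsBaseWeight.qnum_half_ne_zero (hlam : IsBaseWeight ħ lam) (hq : NotRootOfUnity ħ)
    (i : Fin n) (N : ℤ) : qnum (ħ / 2) (2 * (lam ⬝ᵥ eps i) + N) ≠ 0 := by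
  have h2 := qpow_half_sub_ne_zero hq
  have h3 := qpow_ne_zero (ħ / 2) 1
  refine div_ne_zero (fun h => ?_) fun h => h2.1 ?_
  · rw [sub_eq_zero, qpow_neg] at h
    have h4 : qpow ħ (2 * (lam ⬝ᵥ eps i) + N) = 1 := by
      rw [qpow_half (ħ := ħ), sq]
      nth_rewrite 1 [h]
      exact inv_mul_cancel₀ (qpow_ne_zero _ _)
    rw [qpow_add, hlam.1 i, neg_mul, ← qpow_add, show (-1 + N : ℂ) = (N - 1 : ℤ) by
      push_cast; ring, neg_eq_iff_eq_neg] at h4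
    by_cases hN : N = 1
    · rw [hN, sub_self, Int.cast_zero, qpow_zero] at h4
      norm_num at h4
    · refine hq.qpow_ne_one (k := (N - 1) + (N - 1)) (by omega) ?_
      rw [Int.cast_add, qpow_add, h4]
      norm_num
  · rw [qpow_neg] at h
    field_simp at h
    rwa [mul_zero] at h

/-- The conditions on `λ` give `q^{(λ, δ) + 1} = -1`, so the generic-looking shift by `λ` only
changes a sign. -/
theorem IsBaseWeight.qnum_dotProduct_add (hlam : IsBaseWeight ħ lam) {i j : Fin n}
    (hi : i.val = 0) (hj : j.val = 1) (z : ℂ) :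
    qnum ħ (lam ⬝ᵥ (eps i + eps j) + 1 + z) = -qnum ħ z := by
  have h1 := hlam.dotProduct_simpleRoot (i := j) (by omega)
  rw [simpleRoot_succ (by omega : i.val + 1 = j.val), dotProduct_sub, sub_eq_zero] at h1
  have h2 : qpow ħ (lam ⬝ᵥ (eps i + eps j) + 1) = -1 := by
    rw [dotProduct_add, h1, ← two_mul, qpow_add, hlam.1 i, neg_mul, qpow_neg_mul]
  generalize lam ⬝ᵥ (eps i + eps j) + 1 = a at h2 ⊢
  rw [qnum, neg_add, qpow_add, qpow_add, qpow_neg ħ a, h2, qnum]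
  ring

end Pairings

namespace BaseBasis

variable {n : ℕ} {ħ : ℂ} {lam : Weight n} {κ : ℂ} (B : BaseBasis ħ lam κ)
variable {V : Type*} [AddCommGroup V] [Module ℂ V] [Module (Uq n ħ) V] [IsScalarTower ℂ (Uq n ħ) V]

/-- Along the first variable the equation `e_1 u = 0` expresses each coefficient through the
preceding one, so the coefficients with `m_1 = 0` determine `u`. On these, pairing the weight with
`ε_1` is not affected by `m`. -/
theorem exists_coeff_ne_zero (hq : NotRootOfUnity ħ) (hκ : κ ≠ 0) {i : Fin n} (hi : i.val = 0)
    {u : QTensor V (BaseModule ħ lam)} (hE : Uq.E ħ i • u = 0) (hu : u ≠ 0) :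
    ∃ m : Fin n → ℕ, m i = 0 ∧ B.coeff m u ≠ 0 := by
  by_contra! h
  refine hu (B.eq_zero_of_coeff fun m => ?_)
  generalize hN : m i = N
  induction N generalizing m with
  | zero => exact h m hN
  | succ N ih =>
    obtain ⟨m, rfl⟩ := exponent_eq_add_single (show m i ≠ 0 by omega)
    have h1 := B.coeff_E_first hi m u
    rw [hE, map_zero, ih m (by simpa using hN), smul_zero, smul_zero, zero_add] at h1
    exact (smul_eq_zero.mp h1.symm).resolve_left (mul_ne_zero hκ (hq.qnum_succ_ne_zero _))

end BaseBasis

/-! ### Strings of `δ` over the base weight. -/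

section LongRoot

variable {n : ℕ} {ħ : ℂ} {lam : Weight n}
variable {W : Type*} [AddCommGroup W] [Module ℂ W] [Module (Uq n ħ) W] [IsScalarTower ℂ (Uq n ħ) W]
variable {i j : Fin n} {ζ : Weight n} {u : W}

/-- All denominators in the string are of this form. Integrality of `2(ζ, ε_1)` suffices:
half-integral weights are allowed. -/
theorem IsBaseWeight.qnum_half_add_ne_zero (hlam : IsBaseWeight ħ lam) (hq : NotRootOfUnity ħ)
    (hi : i.val = 0) {M : ℤ} (hM : 2 * (ζ ⬝ᵥ eps i) = M) (k : ℤ) :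
    qnum (ħ / 2) (2 * ((ζ + lam) ⬝ᵥ simpleRoot i) + k) ≠ 0 := by
  convert hlam.qnum_half_ne_zero hq i (M + k) using 2
  rw [simpleRoot_first hi, add_dotProduct]
  push_cast
  rw [← hM]
  ring

/-- The sign from `qnum_dotProduct_add` removes `λ` from the factor that decides about vanishing:
what is left is the `sl(2)`-string for the pairing `(ζ, δ)`. -/
theorem IsBaseWeight.exists_E_second_dynSeq (hlam : IsBaseWeight ħ lam) (hq : NotRootOfUnity ħ)
    (hi : i.val = 0) (hj : j.val = 1) (hu : u ∈ weightSpace ħ W (ζ + lam))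
    (hE : Uq.E ħ j • u = 0) {M : ℤ} (hM : 2 * (ζ ⬝ᵥ eps i) = M) (k : ℕ) :
    ∃ c : ℂ, c ≠ 0 ∧ Uq.E ħ j • dynSeq ħ i j ((ζ + lam) ⬝ᵥ simpleRoot i) u (k + 1) =
      (c * (qnum ħ (k + 1) * qnum ħ (ζ ⬝ᵥ (eps i + eps j) - k))) •
        Uq.F ħ i • Uq.F ħ i • dynSeq ħ i j ((ζ + lam) ⬝ᵥ simpleRoot i) u k := by
  have hne := hlam.qnum_half_add_ne_zero hq hi hM
  have h1 := hne (-2 * k)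
  have h2 := hne (-2 * k + 1)
  refine ⟨-(qpow (ħ / 2) (-2) * qnum (ħ / 2) 2 /
    (qnum (ħ / 2) (2 * ((ζ + lam) ⬝ᵥ simpleRoot i - k)) *
      qnum (ħ / 2) (2 * ((ζ + lam) ⬝ᵥ simpleRoot i - k) + 1))), neg_ne_zero.mpr (div_ne_zero
      (mul_ne_zero (qpow_ne_zero _ _) (qnum_half_two_ne_zero hq)) (mul_ne_zero ?_ ?_)), ?_⟩
  · convert h1 using 2
    push_cast
    ring
  · convert h2 using 2
    push_cast
    ring
  · rw [E_second_dynSeq hq hi hj hu hE rfl hne, show 2 * ((ζ + lam) ⬝ᵥ simpleRoot i) +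
      (ζ + lam) ⬝ᵥ simpleRoot j + 1 - k =
        lam ⬝ᵥ (eps i + eps j) + 1 + (ζ ⬝ᵥ (eps i + eps j) - k) by
          rw [simpleRoot_succ (by omega : i.val + 1 = j.val), simpleRoot_first hi]
          simp only [add_dotProduct, dotProduct_add, dotProduct_sub]
          ring, hlam.qnum_dotProduct_add hi hj]
    congr 1
    ring

theorem IsBaseWeight.isSingular_dynSeq (hlam : IsBaseWeight ħ lam) (hq : NotRootOfUnity ħ)
    (hi : i.val = 0) (hj : j.val = 1) (hu : u ∈ weightSpace ħ W (ζ + lam)) (hE : IsSingular n ħ u)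
    {M : ℤ} (hM : 2 * (ζ ⬝ᵥ eps i) = M) {m : ℕ} (hm : (m : ℂ) = ζ ⬝ᵥ (eps i + eps j) + 1) :
    IsSingular n ħ (dynSeq ħ i j ((ζ + lam) ⬝ᵥ simpleRoot i) u m) := by
  intro l
  by_cases hli : l = i
  · rw [hli]
    exact E_first_dynSeq hq hi hj hu (hE i) rfl (hlam.qnum_half_add_ne_zero hq hi hM) m
  by_cases hlj : l = j
  · rw [hlj]
    cases m with
    | zero => exact hE j
    | succ m =>
      obtain ⟨c, -, h⟩ := hlam.exists_E_second_dynSeq hq hi hj hu (hE j) hM m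
      rw [h, show ζ ⬝ᵥ (eps i + eps j) - m = 0 by push_cast at hm; linear_combination -hm]
      simp
  · exact E_dynSeq_of_ne hli hlj (hE l) m

end LongRoot

/-! ### Singular vectors with a negative pairing vanish. -/

section Vanishing

variable {n : ℕ} {ħ : ℂ} {lam : Weight n} {κ : ℂ}
variable {V : Type*} [AddCommGroup V] [Module ℂ V] [Module (Uq n ħ) V] [IsScalarTower ℂ (Uq n ħ) V]
  [FiniteDimensional ℂ V]
variable {ζ : Weight n} {u : QTensor V (BaseModule ħ lam)}

/-- There are no singular vectors in `V ⊗ M` of a weight `ζ + λ` with `(ζ, δ) < 0`. -/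
theorem BaseBasis.eq_zero_of_pairing_neg (B : BaseBasis ħ lam κ) (hq : NotRootOfUnity ħ)
    (hκ : κ ≠ 0) (hlam : IsBaseWeight ħ lam) {i j : Fin n} (hi : i.val = 0) (hj : j.val = 1)
    (hu : u ∈ weightSpace ħ (QTensor V (BaseModule ħ lam)) (ζ + lam)) (hE : IsSingular n ħ u)
    {M N : ℤ} (hM : 2 * (ζ ⬝ᵥ eps i) = M) (hN : ζ ⬝ᵥ (eps i + eps j) = N) (hN0 : N < 0) :
    u = 0 := by
  by_contra hu0
  set h := (ζ + lam) ⬝ᵥ simpleRoot i with hh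
  have hqn := hlam.qnum_half_add_ne_zero hq hi hM
  have hEi := E_first_dynSeq hq hi hj hu (hE i) hh.symm hqn
  have hwt := dynSeq_mem_weightSpace hi hj h hu
  have hpair : ∀ k : ℕ, (ζ + lam - (k : ℂ) • (eps i + eps j)) ⬝ᵥ simpleRoot i = h - k := fun k => by
    rw [sub_dotProduct, smul_dotProduct, eps_add_eps_dotProduct_first hi hj, smul_eq_mul, mul_one]
  have hne : ∀ k, dynSeq ħ i j h u k ≠ 0 := fun k => by
    induction k with
    | zero => exact hu0
    | succ k ih =>
      intro h0
      obtain ⟨c, hc, h1⟩ := hlam.exists_E_second_dynSeq hq hi hj hu (hE j) hM k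
      have h2 := hq.qnum_ne_zero (k := N - k) (by omega)
      push_cast at h2
      rw [← hh, h0, smul_zero, hN] at h1
      refine smul_ne_zero (mul_ne_zero hc (mul_ne_zero (hq.qnum_succ_ne_zero k) h2)) ?_ h1.symm
      refine F_first_F_first_smul_ne_zero hq hi (hwt k) (hEi k) (hpair k) ?_ ?_ ih
      · convert hqn (-2 * k) using 2
        push_cast
        ring
      · convert hqn (-2 * k - 1) using 2
        push_cast
        ring
  -- `V ⊗ M` is infinite-dimensional, so the infinite string alone is no contradiction. A
  -- coefficient with `m_1 = 0` transfers it to `V`, where `q^{h_1}` acts with eigenvalue `q^{(ζ,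
  -- ε_1) - k}`.
  refine false_of_eigenvectors (Algebra.lsmul ℂ ℂ V (Uq.K ħ i))
    (hq.qpow_sub_mul_injective (ζ ⬝ᵥ eps i) (d := 1) one_ne_zero) fun k => ?_
  obtain ⟨m, hm, hm0⟩ := B.exists_coeff_ne_zero hq hκ hi (hEi k) (hne k)
  refine ⟨_, hm0, (B.coeff_mem_weightSpace (hwt k) m i).trans ?_⟩
  congr 2
  rw [add_dotProduct, sub_dotProduct, hpair, hh, simpleRoot_first hi, eps_dotProduct (expWeight m),
    expWeight, hm, add_dotProduct]
  push_cast
  ring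

/-- There are no singular vectors in `V ⊗ M` of a weight `ζ + λ` with `(ζ, α) < 0`, where `α` is a
long simple root. -/
theorem BaseBasis.eq_zero_of_pairing_simpleRoot_neg (B : BaseBasis ħ lam κ) (hq : NotRootOfUnity ħ)
    (hκ : κ ≠ 0) {i : Fin n} (hi : 0 < i.val)
    (hu : u ∈ weightSpace ħ (QTensor V (BaseModule ħ lam)) (ζ + lam)) (hE : IsSingular n ħ u)
    {N : ℤ} (hN : ζ ⬝ᵥ simpleRoot i = N) (hN0 : N < 0) : u = 0 := by
  refine B.eq_zero_of_isSingular hq hκ hE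
    (eq_zero_of_E_smul_eq_zero hq (B.coeff_mem_weightSpace hu 0) hi (B.E_smul_coeff_zero hE hi)
      ?_ hN0)
  rw [← hN, add_sub_cancel_right]
  congr 1
  ext
  simp [expWeight]

end Vanishing

/-! ### Positivity of `m_α` and factorization through the pseudo-parabolic module. -/

section MainTheorem

variable {n : ℕ} {ħ : ℂ} {lam ξ : Weight n} {κ : ℂ}
variable {V : Type*} [AddCommGroup V] [Module ℂ V] [Module (Uq n ħ) V] [IsScalarTower ℂ (Uq n ħ) V]
  [FiniteDimensional ℂ V]

/-- This is the relation `2ε_1 = δ - α_2`. -/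
theorem exists_two_mul_eq_intCast (hξ : ∀ α ∈ kSimpleRoots n, ∃ k : ℤ, corootPairing ξ α = k)
    {i j : Fin n} (hi : i.val = 0) (hj : j.val = 1) : ∃ M : ℤ, 2 * (ξ ⬝ᵥ eps i) = M := by
  obtain ⟨k, hk⟩ := hξ _ (Or.inr ⟨i, j, hi, hj, rfl⟩)
  obtain ⟨l, hl⟩ := hξ _ (Or.inl ⟨j, by omega, rfl⟩)
  rw [corootPairing_eps_add_eps hi hj, dotProduct_add] at hk
  rw [corootPairing_simpleRoot (by omega), simpleRoot_succ (by omega : i.val + 1 = j.val),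
    dotProduct_sub] at hl
  refine ⟨k - l, ?_⟩
  push_cast
  rw [← hk, ← hl]
  ring

theorem exists_nat_eq_add_one {z : ℂ} {k : ℤ} (hk : z = k) (h : ¬ k < 0) :
    ∃ m : ℕ, 0 < m ∧ (m : ℂ) = z + 1 := by
  lift k to ℕ using not_lt.mp h
  exact ⟨k + 1, k.succ_pos, by rw [hk]; push_cast; rfl⟩

variable {v : V} {u : QTensor V (BaseModule ħ lam)}

theorem BaseBasis.exists_pos_eq_corootPairing_add_one (B : BaseBasis ħ lam κ)
    (hq : NotRootOfUnity ħ) (hκ : κ ≠ 0) (hlam : IsBaseWeight ħ lam)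
    (hξ : ∀ α ∈ kSimpleRoots n, ∃ k : ℤ, corootPairing ξ α = k)
    (hu : u ∈ weightSpace ħ (QTensor V (BaseModule ħ lam)) (ξ + lam)) (hE : IsSingular n ħ u)
    (hu0 : u ≠ 0) {α : Weight n} (hα : α ∈ kSimpleRoots n) :
    ∃ m : ℕ, 0 < m ∧ (m : ℂ) = corootPairing ξ α + 1 := by
  obtain ⟨k, hk⟩ := hξ α hα
  refine exists_nat_eq_add_one hk fun hk0 => hu0 ?_
  rcases hα with ⟨i, hi, rfl⟩ | ⟨i, j, hi, hj, rfl⟩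
  · rw [corootPairing_simpleRoot hi] at hk
    exact B.eq_zero_of_pairing_simpleRoot_neg hq hκ hi hu hE hk hk0
  · obtain ⟨M, hM⟩ := exists_two_mul_eq_intCast hξ hi hj
    rw [corootPairing_eps_add_eps hi hj] at hk
    exact B.eq_zero_of_pairing_neg hq hκ hlam hi hj hu hE hM hk hk0

theorem BaseBasis.F_pow_smul_eq_zero (B : BaseBasis ħ lam κ) (hq : NotRootOfUnity ħ) (hκ : κ ≠ 0)
    (hlam : IsBaseWeight ħ lam)
    (hu : u ∈ weightSpace ħ (QTensor V (BaseModule ħ lam)) (ξ + lam)) (hE : IsSingular n ħ u)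
    {i : Fin n} (hi : 0 < i.val) {m : ℕ} (hm : (m : ℂ) = ξ ⬝ᵥ simpleRoot i + 1) :
    Uq.F ħ i ^ m • u = 0 := by
  have hwt := F_pow_smul_mem_weightSpace hu i m
  rw [show ξ + lam - (m : ℂ) • simpleRoot i = ξ - (m : ℂ) • simpleRoot i + lam by abel] at hwt
  refine B.eq_zero_of_pairing_simpleRoot_neg hq hκ hi hwt (fun l => ?_)
    -- `(ξ - mα, α) = (m - 1) - 2m`, as in the reflection of `ξ` under the shifted action.
    (N := -m - 1) ?_ (by omega)
  · rcases eq_or_ne l i with rfl | hl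
    · cases m with
      | zero => simpa using hE l
      | succ m =>
        rw [E_F_pow_smul hq hu hi (hE l), add_dotProduct, hlam.dotProduct_simpleRoot hi,
          show ξ ⬝ᵥ simpleRoot l + 0 - m = 0 by push_cast at hm; linear_combination -hm]
        simp
    · have h : ∀ k : ℕ, Uq.E ħ l • Uq.F ħ i ^ k • u = 0 := fun k => by
        induction k with
        | zero => simpa using hE l
        | succ k ih => rw [pow_succ', mul_smul, E_F_smul_of_ne hl, ih, smul_zero]
      exact h m
  · rw [sub_dotProduct, smul_dotProduct, simpleRoot_self i (by omega), smul_eq_mul]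
    push_cast
    linear_combination -hm

theorem BaseBasis.fHatDynProd_smul_eq_zero (B : BaseBasis ħ lam κ) (hq : NotRootOfUnity ħ)
    (hκ : κ ≠ 0) (hlam : IsBaseWeight ħ lam)
    (hu : u ∈ weightSpace ħ (QTensor V (BaseModule ħ lam)) (ξ + lam)) (hE : IsSingular n ħ u)
    {i j : Fin n} (hi : i.val = 0) (hj : j.val = 1) {M : ℤ} (hM : 2 * (ξ ⬝ᵥ eps i) = M) {m : ℕ}
    (hm : (m : ℂ) = ξ ⬝ᵥ (eps i + eps j) + 1) :
    fHatDynProd ħ i j (2 * ((ξ + lam) ⬝ᵥ simpleRoot i) - 2 * m + 1) m • u = 0 := by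
  rw [fHatDynProd_smul]
  have hwt := dynSeq_mem_weightSpace hi hj ((ξ + lam) ⬝ᵥ simpleRoot i) hu m
  rw [show ξ + lam - (m : ℂ) • (eps i + eps j) = ξ - (m : ℂ) • (eps i + eps j) + lam by
    abel] at hwt
  -- The last vector of the string is singular because the factor `[(ξ, δ) - (m - 1)]` vanishes, and
  -- its new pairing with `δ` is `(m - 1) - 2m`.
  refine B.eq_zero_of_pairing_neg hq hκ hlam hi hj hwt
    (hlam.isSingular_dynSeq hq hi hj hu hE hM hm) (M := M - 2 * m) (N := -m - 1) ?_ ?_ (by omega)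
  · have h1 := eps_add_eps_dotProduct_first hi hj
    rw [simpleRoot_first hi] at h1
    rw [sub_dotProduct, smul_dotProduct, h1, smul_eq_mul]
    push_cast
    rw [← hM]
    ring
  · rw [sub_dotProduct, smul_dotProduct, eps_add_eps_dotProduct_self hi hj, smul_eq_mul]
    push_cast
    linear_combination -hm

theorem BaseBasis.pseudoParabolicSubmodule_le_ker (B : BaseBasis ħ lam κ) (hq : NotRootOfUnity ħ)
    (hκ : κ ≠ 0) (hlam : IsBaseWeight ħ lam)
    (hξ : ∀ α ∈ kSimpleRoots n, ∃ k : ℤ, corootPairing ξ α = k)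
    (hu : u ∈ weightSpace ħ (QTensor V (BaseModule ħ lam)) (ξ + lam)) (hE : IsSingular n ħ u)
    {ψ : Verma ħ (ξ + lam) →ₗ[Uq n ħ] QTensor V (BaseModule ħ lam)}
    (hψ : ψ (Verma.one ħ (ξ + lam)) = u) : pseudoParabolicSubmodule ħ ξ lam ≤ LinearMap.ker ψ := by
  rw [pseudoParabolicSubmodule, Submodule.span_le]
  rintro _ (⟨i, m, hi, hm, rfl⟩ | ⟨i, j, m, hi, hj, hm, rfl⟩)
  · rw [corootPairing_simpleRoot hi] at hm
    rw [SetLike.mem_coe, LinearMap.mem_ker, map_smul, hψ,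
      B.F_pow_smul_eq_zero hq hκ hlam hu hE hi hm]
  · obtain ⟨M, hM⟩ := exists_two_mul_eq_intCast hξ hi hj
    rw [corootPairing_eps_add_eps hi hj] at hm
    rw [SetLike.mem_coe, LinearMap.mem_ker, map_smul, hψ,
      B.fHatDynProd_smul_eq_zero hq hκ hlam hu hE hi hj hM hm]

end MainTheorem

end QSphere

end

theorem mainTheorem6 (n : ℕ) (hn : 1 ≤ n) (ħ : ℂ)
    (hq : ∀ k : ℕ, 0 < k → QSphere.qpow ħ 1 ^ k ≠ 1)
    (lam : QSphere.Weight n) (hlam : QSphere.IsBaseWeight ħ lam)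
    (V : Type*) [AddCommGroup V] [Module ℂ V] [Module (QSphere.Uq n ħ) V]
    [IsScalarTower ℂ (QSphere.Uq n ħ) V] [FiniteDimensional ℂ V]
    (ξ : QSphere.Weight n)
    (hξ : ∀ α ∈ QSphere.kSimpleRoots n, ∃ k : ℤ, QSphere.corootPairing ξ α = k)
    (v : V) (hv0 : v ≠ 0) (hvξ : v ∈ QSphere.weightSpace ħ V ξ) (hvM : v ∈ QSphere.VPlus n ħ V) :
    (∀ α ∈ QSphere.kSimpleRoots n, ∃ m : ℕ, 0 < m ∧ (m : ℂ) = QSphere.corootPairing ξ α + 1) ∧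
    ∃ u : QSphere.QTensor V (QSphere.BaseModule ħ lam),
      QSphere.IsDelta ħ lam v u ∧
      (∀ u' : QSphere.QTensor V (QSphere.BaseModule ħ lam), QSphere.IsDelta ħ lam v u' → u' = u) ∧
      ∃ ψ : QSphere.Verma ħ (ξ + lam) →ₗ[QSphere.Uq n ħ]
          QSphere.QTensor V (QSphere.BaseModule ħ lam),
        ψ (QSphere.Verma.one ħ (ξ + lam)) = u ∧
        ∃ φ : QSphere.PseudoParabolic ħ ξ lam →ₗ[QSphere.Uq n ħ]
            QSphere.QTensor V (QSphere.BaseModule ħ lam),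
          φ.comp (QSphere.pseudoParabolicSubmodule ħ ξ lam).mkQ = ψ := by
  obtain ⟨B⟩ := QSphere.exists_baseBasis hq hlam (i₀ := ⟨0, hn⟩) rfl
  have hκ := QSphere.modelConst_ne_zero hq (QSphere.qpow_ne_zero ħ (lam ⬝ᵥ QSphere.eps ⟨0, hn⟩))
  obtain ⟨u, hu, huw⟩ := B.exists_isDelta hq (i₀ := ⟨0, hn⟩) rfl hκ hlam hvξ hvM
  -- The only use of `v ≠ 0`: it turns the vanishing principle into non-negativity of the pairings
  -- of `ξ`.
  have hu0 : u ≠ 0 := fun h => hv0 (by rw [← B.coeff_zero_of_isDelta hu, h, map_zero])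
  obtain ⟨ψ, hψ⟩ := QSphere.Verma.exists_lift hu.1 huw
  exact ⟨fun α hα => B.exists_pos_eq_corootPairing_add_one hq hκ hlam hξ huw hu.1 hu0 hα,
    u, hu, fun u' hu' => B.isDelta_unique hq hκ hu hu', ψ, hψ,
    Submodule.liftQ _ ψ (B.pseudoParabolicSubmodule_le_ker hq hκ hlam hξ huw hu.1 hψ),
    Submodule.liftQ_mkQ _ _ _⟩
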